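/- Let $M$ be a smooth finite-dimensional manifold (Hausdorff, second countable, without boundary) and let $A\Rightarrow M$ be a Lie algebroid: a smooth real vector bundle $A\to M$ of finite rank with a Lie bracket $[\cdot,\cdot]$ on the space $\Gamma(A)$ of smooth sections and a smooth bundle map $\mathsf a\colon A\to TM$ (the anchor) such that $[\sigma,f\tau]=f[\sigma,\tau]+(\mathcal L_{\mathsf a(\sigma)}f)\,\tau$ for all $\sigma,\tau\in\Gamma(A)$, $f\in C^\infty(M)$. Assume that $A$ is transitive, i.e. $\mathsf a$ is surjective on every fibre. For $m\in M$ let $\mathfrak h_m=\ker(\mathsf a|_m)\subset A_m$ be the isotropy Lie algebra, with bracket $[\sigma(m),\tau(m)]=[\sigma,\tau](m)$ for $\sigma,\tau\in\Gamma(A)$ with $\sigma(m),\tau(m)\in\mathfrak h_m$. Then: (a) The bundle of isotropy Lie algebras $\mathfrak h=\ker(\mathsf a)\to M$ is a locally trivial Lie algebra bundle: every $m\in M$ has an open neighbourhood $U$ with a smooth vector bundle isomorphism $U\times\mathfrak h_m\cong\mathfrak h|_U\subset A|_U$ over $U$ that is a Lie algebra isomorphism on each fibre. (b) Let $U\subset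 M$ be open, let $m_0\in U$, and let $\varphi\colon[0,1]\times U\to U$, $(t,m)\mapsto\varphi_t(m)$, be a smooth deformation retraction of $U$ onto $m_0$, that is, a smooth map with $\varphi_0(m)=m_0$ and $\varphi_1(m)=m$ for all $m\in U$ (so that $U$ is contractible). Then there is an isomorphism of Lie algebroids over $\mathrm{id}_U$ (a smooth vector bundle isomorphism intertwining anchors and brackets) $A|_U\cong TU\times\mathfrak h_{m_0}$, where the right-hand side has the projection to $TU$ as anchor and the bracket $[X+\xi,Y+\eta]=[X,Y]+[\xi,\eta]+\mathcal L_X\eta-\mathcal L_Y\xi$ for vector fields $X,Y$ on $U$ and $\xi,\eta\in C^\infty(U,\mathfrak h_{m_0})$. -/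

import Mathlib

open Set Filter Topology Bundle TopologicalSpace
open scoped Manifold ContDiff

noncomputable section

set_option linter.unusedSectionVars false

/-- A real Lie algebra on a normed space. It is used in finite dimension only, where the norm just
provides the standard smooth structure. -/
class NormedLieAlgebra (𝔨 : Type*) extends NormedAddCommGroup 𝔨, LieRing 𝔨, NormedSpace ℝ 𝔨,
  LieAlgebra ℝ 𝔨

section Basic

variable {E : Type*} [NormedAddCommGroup E] [NormedSpace ℝ E]
  {M : Type*} [TopologicalSpace M] [ChartedSpace E M]
  {F : Type*} [NormedAddCommGroup F] [NormedSpace ℝ F]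
  {A : M → Type*} [TopologicalSpace (TotalSpace F A)]
  [∀ x, AddCommGroup (A x)] [∀ x, Module ℝ (A x)] [∀ x, TopologicalSpace (A x)]
  [FiberBundle F A] [VectorBundle ℝ F A]

/-- The product `f • σ` of a smooth function and a smooth section. -/
def ContMDiffSection.funSMul (f : C^∞⟮𝓘(ℝ, E), M; ℝ⟯) (σ : Cₛ^∞⟮𝓘(ℝ, E); F, A⟯) :
    Cₛ^∞⟮𝓘(ℝ, E); F, A⟯ :=
  ⟨fun x => f x • σ x, ContMDiff.smul_section f.contMDiff σ.contMDiff⟩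

theorem contMDiff_mvfderiv_apply [IsManifold 𝓘(ℝ, E) ∞ M]
    {G : Type*} [NormedAddCommGroup G] [NormedSpace ℝ G]
    {f : M → G} (hf : ContMDiff 𝓘(ℝ, E) 𝓘(ℝ, G) ∞ f)
    {X : ∀ x : M, TangentSpace 𝓘(ℝ, E) x}
    (hX : ContMDiff 𝓘(ℝ, E) 𝓘(ℝ, E).tangent ∞ (fun x => (⟨x, X x⟩ : TangentBundle 𝓘(ℝ, E) M))) :
    ContMDiff 𝓘(ℝ, E) 𝓘(ℝ, G) ∞ (fun x => mvfderiv 𝓘(ℝ, E) f x (X x)) :=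
  (contMDiff_snd_tangentBundle_modelSpace G 𝓘(ℝ, G)).comp
    ((hf.contMDiff_tangentMap (m := ∞) (by simp)).comp hX)

variable (E F A) in
/-- A Lie algebroid structure on the smooth real vector bundle `A → M` (with model fibre `F`, over
a manifold modelled on `E`): a Lie bracket on the space `Γ(A)` of smooth sections and a smooth
bundle map `anchor : A → TM` over the identity such that
`[σ, f τ] = f [σ, τ] + (L_{anchor σ} f) τ`. -/
structure LieAlgebroid [IsManifold 𝓘(ℝ, E) ∞ M] where
  bracket : Cₛ^∞⟮𝓘(ℝ, E); F, A⟯ →ₗ[ℝ] Cₛ^∞⟮𝓘(ℝ, E); F, A⟯ →ₗ[ℝ] Cₛ^∞⟮𝓘(ℝ, E); F, A⟯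
  bracket_self : ∀ σ, bracket σ σ = 0
  jacobi : ∀ σ τ υ,
    bracket σ (bracket τ υ) = bracket (bracket σ τ) υ + bracket τ (bracket σ υ)
  anchor : ∀ x : M, A x →L[ℝ] TangentSpace 𝓘(ℝ, E) x
  contMDiff_anchor : ContMDiff (𝓘(ℝ, E).prod 𝓘(ℝ, F)) 𝓘(ℝ, E).tangent ∞
    (fun p : TotalSpace F A => (⟨p.proj, anchor p.proj p.2⟩ : TangentBundle 𝓘(ℝ, E) M))
  leibniz : ∀ (σ τ : Cₛ^∞⟮𝓘(ℝ, E); F, A⟯) (f : C^∞⟮𝓘(ℝ, E), M; ℝ⟯) (x : M),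
    bracket σ (ContMDiffSection.funSMul f τ) x =
      f x • bracket σ τ x + mvfderiv 𝓘(ℝ, E) f x (anchor x (σ x)) • τ x

namespace LieAlgebroid

/-- A Lie algebroid is transitive if its anchor is surjective. -/
def IsTransitive [IsManifold 𝓘(ℝ, E) ∞ M] (L : LieAlgebroid E F A) : Prop :=
  ∀ x, Function.Surjective (L.anchor x)

theorem _root_.ContMDiffSection.sum_apply {ι : Type*} (u : Finset ι)
    (s : ι → Cₛ^∞⟮𝓘(ℝ, E); F, A⟯) (x : M) : (∑ i ∈ u, s i) x = ∑ i ∈ u, s i x :=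
  map_sum ((Pi.evalAddMonoidHom A x).comp (ContMDiffSection.coeAddHom 𝓘(ℝ, E) F ∞ A)) s u

theorem bracket_skew [IsManifold 𝓘(ℝ, E) ∞ M] (L : LieAlgebroid E F A)
    (σ τ : Cₛ^∞⟮𝓘(ℝ, E); F, A⟯) : L.bracket σ τ = - L.bracket τ σ := by
  have h := L.bracket_self (σ + τ)
  simp only [map_add, LinearMap.add_apply, L.bracket_self, zero_add, add_zero] at h
  exact eq_neg_of_add_eq_zero_right h

section Local

variable [FiniteDimensional ℝ E] [T2Space M] [IsManifold 𝓘(ℝ, E) ∞ M]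

theorem exists_bump {x : M} {u : Set M} (hu : u ∈ 𝓝 x) :
    ∃ ψ : C^∞⟮𝓘(ℝ, E), M; ℝ⟯, tsupport ψ ⊆ u ∧ ∀ᶠ y in 𝓝 x, ψ y = 1 := by
  obtain ⟨f, -, hf⟩ := (SmoothBumpFunction.nhds_basis_tsupport (I := 𝓘(ℝ, E)) x).mem_iff.1 hu
  exact ⟨⟨f, f.contMDiff⟩, hf, f.eventuallyEq_one⟩

theorem exists_section_eventuallyEq {x : M} {u : Set M} (hu : IsOpen u) (hx : x ∈ u)
    {s : ∀ y : M, A y}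
    (hs : ContMDiffOn 𝓘(ℝ, E) (𝓘(ℝ, E).prod 𝓘(ℝ, F)) ∞
      (fun y => (⟨y, s y⟩ : TotalSpace F A)) u) :
    ∃ σ : Cₛ^∞⟮𝓘(ℝ, E); F, A⟯, ∀ᶠ y in 𝓝 x, σ y = s y := by
  obtain ⟨ψ, hψ, h1⟩ := exists_bump (E := E) (hu.mem_nhds hx)
  refine ⟨⟨fun y => ψ y • s y,
    ContMDiffOn.smul_section_of_tsupport ψ.contMDiff.contMDiffOn hu hψ hs⟩, ?_⟩
  filter_upwards [h1] with y hy
  change ψ y • s y = s y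
  rw [hy, one_smul]

theorem exists_function_eventuallyEq {x : M} {u : Set M} (hu : IsOpen u) (hx : x ∈ u)
    {s : M → ℝ} (hs : ContMDiffOn 𝓘(ℝ, E) 𝓘(ℝ, ℝ) ∞ s u) :
    ∃ f : C^∞⟮𝓘(ℝ, E), M; ℝ⟯, ∀ᶠ y in 𝓝 x, f y = s y := by
  obtain ⟨ψ, hψ, h1⟩ := exists_bump (E := E) (hu.mem_nhds hx)
  refine ⟨⟨fun y => ψ y • s y, contMDiff_of_tsupport fun y hy => ?_⟩, ?_⟩
  · have hyu := hψ (tsupport_smul_subset_left _ _ hy)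
    exact ψ.contMDiff.contMDiffAt.smul (hs.contMDiffAt (hu.mem_nhds hyu))
  filter_upwards [h1] with y hy
  change ψ y • s y = s y
  rw [hy, one_smul]

theorem exists_section_apply_eq [ContMDiffVectorBundle ∞ F A 𝓘(ℝ, E)] {x : M} (v : A x) :
    ∃ σ : Cₛ^∞⟮𝓘(ℝ, E); F, A⟯, σ x = v := by
  obtain ⟨s, hs, hsm⟩ := FiberBundle.exists_contMDiffOn_extend (I := 𝓘(ℝ, E)) (k := ∞) F v
  obtain ⟨u, hus, hu, hxu⟩ := mem_nhds_iff.1 hs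
  obtain ⟨σ, hσ⟩ := exists_section_eventuallyEq hu hxu (hsm.mono hus)
  exact ⟨σ, by rw [hσ.self_of_nhds, FiberBundle.extend_apply_self]⟩

/-- A tangent vector that annihilates all smooth functions vanishes. -/
theorem eq_zero_of_mvfderiv {x : M} {v : TangentSpace 𝓘(ℝ, E) x}
    (h : ∀ f : C^∞⟮𝓘(ℝ, E), M; ℝ⟯, mvfderiv 𝓘(ℝ, E) f x v = 0) : v = 0 := by
  have h1 : ∀ ℓ : E →L[ℝ] ℝ, ℓ (mfderiv 𝓘(ℝ, E) 𝓘(ℝ, E) (extChartAt 𝓘(ℝ, E) x) x v) = 0 := by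
    intro ℓ
    have hd := mdifferentiableAt_extChartAt (I := 𝓘(ℝ, E)) (mem_chart_source E x)
    obtain ⟨f, hf⟩ := exists_function_eventuallyEq (E := E) (x := x) (chartAt E x).open_source
      (mem_chart_source E x) (s := fun y => ℓ (extChartAt 𝓘(ℝ, E) x y))
      (ℓ.contMDiff.comp_contMDiffOn contMDiffOn_extChartAt)
    have := h f
    rw [mvfderiv, EventuallyEq.mfderiv_eq hf] at this
    have h2 := mfderiv_comp x (ℓ.mdifferentiableAt (x := extChartAt 𝓘(ℝ, E) x x)) hd
    rw [ContinuousLinearMap.mfderiv_eq] at h2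
    erw [h2] at this
    exact this
  have h2 : mfderiv 𝓘(ℝ, E) 𝓘(ℝ, E) (extChartAt 𝓘(ℝ, E) x) x v = 0 := by
    have h3 : ∀ w : E, (∀ ℓ : E →L[ℝ] ℝ, ℓ w = 0) → w = 0 := fun w hw => by
      by_contra hne
      obtain ⟨ℓ, hℓ⟩ := SeparatingDual.exists_ne_zero (R := ℝ) hne
      exact hℓ (hw ℓ)
    exact h3 _ h1
  exact (isInvertible_mfderiv_extChartAt (I := 𝓘(ℝ, E)) (mem_extChartAt_source x)).injective
    (h2.trans (map_zero _).symm)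

variable (L : LieAlgebroid E F A)

theorem bracket_apply_eq_zero_right {x : M} (σ : Cₛ^∞⟮𝓘(ℝ, E); F, A⟯)
    {τ : Cₛ^∞⟮𝓘(ℝ, E); F, A⟯} (h : ∀ᶠ y in 𝓝 x, τ y = 0) : L.bracket σ τ x = 0 := by
  obtain ⟨ψ, hψ, h1⟩ := exists_bump (E := E) h
  have h0 : ContMDiffSection.funSMul ψ τ = 0 := by
    ext y
    change ψ y • τ y = 0
    by_cases hy : y ∈ tsupport ψ
    · rw [show τ y = 0 from hψ hy, smul_zero]
    · rw [image_eq_zero_of_notMem_tsupport hy, zero_smul]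
  have := L.leibniz σ τ ψ x
  rw [h0, map_zero, h1.self_of_nhds, h.self_of_nhds] at this
  simpa using this.symm

theorem bracket_congr {x : M} {σ σ' τ τ' : Cₛ^∞⟮𝓘(ℝ, E); F, A⟯}
    (hσ : ∀ᶠ y in 𝓝 x, σ y = σ' y) (hτ : ∀ᶠ y in 𝓝 x, τ y = τ' y) :
    L.bracket σ τ x = L.bracket σ' τ' x := by
  have h1 : L.bracket σ (τ - τ') x = 0 :=
    L.bracket_apply_eq_zero_right σ (hτ.mono fun y hy => by
      simp [hy])
  have h2 : L.bracket τ' (σ - σ') x = 0 :=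
    L.bracket_apply_eq_zero_right τ' (hσ.mono fun y hy => by
      simp [hy])
  rw [L.bracket_skew, map_sub, LinearMap.sub_apply] at h2
  rw [map_sub] at h1
  simp only [ContMDiffSection.coe_sub, ContMDiffSection.coe_neg, Pi.sub_apply,
    Pi.neg_apply] at h1 h2
  rw [neg_eq_zero, sub_eq_zero] at h2
  rw [sub_eq_zero] at h1
  rw [h1, h2]

variable [FiniteDimensional ℝ F] [ContMDiffVectorBundle ∞ F A 𝓘(ℝ, E)]

theorem bracket_apply_eq_zero_of_anchor {x : M} {σ τ : Cₛ^∞⟮𝓘(ℝ, E); F, A⟯}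
    (hσ : L.anchor x (σ x) = 0) (hτ : τ x = 0) : L.bracket σ τ x = 0 := by
  let t := trivializationAt F A x
  have x_mem : x ∈ t.baseSet := FiberBundle.mem_baseSet_trivializationAt F A x
  let b := Module.Basis.ofVectorSpace ℝ F
  have hs : ∀ i, ∃ s : Cₛ^∞⟮𝓘(ℝ, E); F, A⟯, ∀ᶠ y in 𝓝 x, s y = t.localFrame b i y := fun i =>
    exists_section_eventuallyEq t.open_baseSet x_mem
      (t.contMDiffOn_localFrame_baseSet (I := 𝓘(ℝ, E)) ∞ b i)
  have hc : ∀ i, ∃ f : C^∞⟮𝓘(ℝ, E), M; ℝ⟯,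
      ∀ᶠ y in 𝓝 x, f y = t.localFrameCoeff 𝓘(ℝ, E) b i y (τ y) := fun i =>
    exists_function_eventuallyEq t.open_baseSet x_mem
      (contMDiffOn_baseSet_localFrameCoeff b τ.contMDiff.contMDiffOn i)
  choose s hs using hs
  choose f hf using hc
  have key : ∀ᶠ y in 𝓝 x, τ y = (∑ i, ContMDiffSection.funSMul (f i) (s i)) y := by
    have h := t.eventually_eq_localFrame_sum_coeff_smul (I := 𝓘(ℝ, E)) b x_mem (s := τ)
    filter_upwards [h, eventually_all.2 hs, eventually_all.2 hf] with y hy hs hf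
    rw [hy]
    rw [ContMDiffSection.sum_apply]
    refine Finset.sum_congr rfl fun i _ => ?_
    change _ = f i y • s i y
    rw [hs, hf]
  rw [L.bracket_congr (.of_forall fun _ => rfl) key, map_sum]
  rw [ContMDiffSection.sum_apply]
  refine Finset.sum_eq_zero fun i _ => ?_
  rw [L.leibniz, hσ, (hf i).self_of_nhds, hτ]
  simp

end Local

/-- The Lie derivative `L_{anchor σ} f` of a smooth function. -/
def lieDeriv [IsManifold 𝓘(ℝ, E) ∞ M] (L : LieAlgebroid E F A) (σ : Cₛ^∞⟮𝓘(ℝ, E); F, A⟯)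
    (f : C^∞⟮𝓘(ℝ, E), M; ℝ⟯) : C^∞⟮𝓘(ℝ, E), M; ℝ⟯ :=
  ⟨fun x => mvfderiv 𝓘(ℝ, E) f x (L.anchor x (σ x)),
    contMDiff_mvfderiv_apply f.contMDiff (L.contMDiff_anchor.comp σ.contMDiff)⟩

theorem funSMul_bracket_expand [IsManifold 𝓘(ℝ, E) ∞ M] (L : LieAlgebroid E F A)
    (σ τ : Cₛ^∞⟮𝓘(ℝ, E); F, A⟯) (f : C^∞⟮𝓘(ℝ, E), M; ℝ⟯) :
    L.bracket σ (ContMDiffSection.funSMul f τ) =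
      ContMDiffSection.funSMul f (L.bracket σ τ) +
        ContMDiffSection.funSMul (L.lieDeriv σ f) τ := by
  ext x
  exact L.leibniz σ τ f x

/-- The anchor maps the bracket of sections to the commutator of derivations. -/
theorem mvfderiv_anchor_bracket [FiniteDimensional ℝ E] [T2Space M] [IsManifold 𝓘(ℝ, E) ∞ M]
    [ContMDiffVectorBundle ∞ F A 𝓘(ℝ, E)]
    (L : LieAlgebroid E F A) (σ τ : Cₛ^∞⟮𝓘(ℝ, E); F, A⟯) (f : C^∞⟮𝓘(ℝ, E), M; ℝ⟯) (x : M) :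
    mvfderiv 𝓘(ℝ, E) f x (L.anchor x (L.bracket σ τ x)) =
      mvfderiv 𝓘(ℝ, E) (L.lieDeriv τ f) x (L.anchor x (σ x)) -
        mvfderiv 𝓘(ℝ, E) (L.lieDeriv σ f) x (L.anchor x (τ x)) := by
  by_cases htriv : ∃ v : A x, v ≠ 0
  swap
  · push Not at htriv
    simp [htriv]
  obtain ⟨v, hv⟩ := htriv
  obtain ⟨υ, hυ⟩ := exists_section_apply_eq (E := E) (F := F) v
  have h1 := L.jacobi σ τ (ContMDiffSection.funSMul f υ)
  simp only [funSMul_bracket_expand, map_add] at h1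
  have h2 := L.jacobi σ τ υ
  replace h1 := congrArg (fun s => s x) h1
  replace h2 := congrArg (fun s => s x) h2
  simp only [ContMDiffSection.coe_add, Pi.add_apply] at h1 h2
  simp only [ContMDiffSection.funSMul, ContMDiffSection.coeFn_mk, h2] at h1
  have h3 : (mvfderiv 𝓘(ℝ, E) f x (L.anchor x (L.bracket σ τ x)) -
      (mvfderiv 𝓘(ℝ, E) (L.lieDeriv τ f) x (L.anchor x (σ x)) -
        mvfderiv 𝓘(ℝ, E) (L.lieDeriv σ f) x (L.anchor x (τ x)))) • υ x = 0 := by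
    change _ = _ at h1
    simp only [lieDeriv, ContMDiffMap.coeFn_mk] at h1 ⊢
    have h1' := sub_eq_zero.2 h1
    rw [← neg_eq_zero, ← h1']
    module
  rw [hυ] at h3
  exact sub_eq_zero.1 ((smul_eq_zero.1 h3).resolve_right hv)


section Isotropy

/-- The isotropy Lie algebra `𝔥ₘ = ker (anchor m) ⊆ A m` at a point. -/
def Isotropy [IsManifold 𝓘(ℝ, E) ∞ M] (L : LieAlgebroid E F A) (m : M) : Type _ :=
  LinearMap.ker (L.anchor m).toLinearMap

section

variable [IsManifold 𝓘(ℝ, E) ∞ M] {L : LieAlgebroid E F A} {m : M}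

instance : AddCommGroup (L.Isotropy m) :=
  inferInstanceAs (AddCommGroup (LinearMap.ker (L.anchor m).toLinearMap))

instance : Module ℝ (L.Isotropy m) :=
  inferInstanceAs (Module ℝ (LinearMap.ker (L.anchor m).toLinearMap))

variable (L m) in
/-- The inclusion `𝔥ₘ ⊆ A m`. -/
def Isotropy.incl : L.Isotropy m →ₗ[ℝ] A m :=
  (LinearMap.ker (L.anchor m).toLinearMap).subtype

theorem Isotropy.incl_injective : Function.Injective (Isotropy.incl L m) :=
  Subtype.val_injective

theorem Isotropy.anchor_incl (ξ : L.Isotropy m) : L.anchor m (Isotropy.incl L m ξ) = 0 :=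
  ξ.2

end

variable [FiniteDimensional ℝ E] [T2Space M] [IsManifold 𝓘(ℝ, E) ∞ M]
  [FiniteDimensional ℝ F] [ContMDiffVectorBundle ∞ F A 𝓘(ℝ, E)]
  {L : LieAlgebroid E F A} {m : M}

theorem anchor_bracket_eq_zero {σ τ : Cₛ^∞⟮𝓘(ℝ, E); F, A⟯}
    (hσ : L.anchor m (σ m) = 0) (hτ : L.anchor m (τ m) = 0) :
    L.anchor m (L.bracket σ τ m) = 0 :=
  eq_zero_of_mvfderiv fun f => by
    rw [L.mvfderiv_anchor_bracket, hσ, hτ, map_zero, map_zero, sub_zero]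

/-- A smooth section through a prescribed isotropy vector. -/
def Isotropy.toSection (ξ : L.Isotropy m) : Cₛ^∞⟮𝓘(ℝ, E); F, A⟯ :=
  (exists_section_apply_eq (E := E) (F := F) (Isotropy.incl L m ξ)).choose

theorem Isotropy.toSection_apply (ξ : L.Isotropy m) : ξ.toSection m = Isotropy.incl L m ξ :=
  (exists_section_apply_eq (E := E) (F := F) (Isotropy.incl L m ξ)).choose_spec

/-- The bracket of `𝔥ₘ`: `[σ(m), τ(m)] = [σ, τ](m)` for sections `σ, τ` whose values at `m` lie
in the kernel of the anchor (see `Isotropy.incl_bracket`). -/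
instance : Bracket (L.Isotropy m) (L.Isotropy m) where
  bracket ξ η := ⟨L.bracket ξ.toSection η.toSection m, anchor_bracket_eq_zero
    (by rw [ξ.toSection_apply, ξ.anchor_incl]) (by rw [η.toSection_apply, η.anchor_incl])⟩

theorem bracket_congr_of_anchor {σ σ' τ τ' : Cₛ^∞⟮𝓘(ℝ, E); F, A⟯}
    (h : σ m = σ' m) (h' : τ m = τ' m) (hσ : L.anchor m (σ m) = 0) (hτ : L.anchor m (τ m) = 0) :
    L.bracket σ τ m = L.bracket σ' τ' m := by
  have h1 : L.bracket σ (τ - τ') m = 0 :=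
    L.bracket_apply_eq_zero_of_anchor hσ (by simp [h'])
  have h2 : L.bracket τ' (σ - σ') m = 0 :=
    L.bracket_apply_eq_zero_of_anchor (h' ▸ hτ) (by simp [h])
  rw [L.bracket_skew, map_sub, LinearMap.sub_apply] at h2
  rw [map_sub] at h1
  simp only [ContMDiffSection.coe_sub, ContMDiffSection.coe_neg, Pi.sub_apply,
    Pi.neg_apply] at h1 h2
  rw [neg_eq_zero, sub_eq_zero] at h2
  rw [sub_eq_zero] at h1
  rw [h1, h2]

theorem Isotropy.incl_bracket {ξ η : L.Isotropy m} {σ τ : Cₛ^∞⟮𝓘(ℝ, E); F, A⟯}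
    (hσ : σ m = Isotropy.incl L m ξ) (hτ : τ m = Isotropy.incl L m η) :
    Isotropy.incl L m ⁅ξ, η⁆ = L.bracket σ τ m :=
  bracket_congr_of_anchor (ξ.toSection_apply.trans hσ.symm) (η.toSection_apply.trans hτ.symm)
    (by rw [ξ.toSection_apply, ξ.anchor_incl]) (by rw [η.toSection_apply, η.anchor_incl])

theorem Isotropy.incl_bracket_toSection (ξ η : L.Isotropy m) :
    L.bracket ξ.toSection η.toSection m = Isotropy.incl L m ⁅ξ, η⁆ := rfl

instance : LieRing (L.Isotropy m) where
  add_lie ξ η ζ := Isotropy.incl_injective <| by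
    rw [map_add, Isotropy.incl_bracket (σ := ξ.toSection + η.toSection) (τ := ζ.toSection)
      (by simp [Isotropy.toSection_apply]) ζ.toSection_apply]
    simp [Isotropy.incl_bracket_toSection]
  lie_add ξ η ζ := Isotropy.incl_injective <| by
    rw [map_add, Isotropy.incl_bracket (σ := ξ.toSection) (τ := η.toSection + ζ.toSection)
      ξ.toSection_apply (by simp [Isotropy.toSection_apply])]
    simp [Isotropy.incl_bracket_toSection]
  lie_self ξ := Isotropy.incl_injective <| by
    rw [← Isotropy.incl_bracket_toSection, L.bracket_self, map_zero]
    rfl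
  leibniz_lie ξ η ζ := Isotropy.incl_injective <| by
    rw [map_add,
      Isotropy.incl_bracket (σ := ξ.toSection) (τ := L.bracket η.toSection ζ.toSection)
        ξ.toSection_apply (Isotropy.incl_bracket_toSection _ _),
      Isotropy.incl_bracket (σ := L.bracket ξ.toSection η.toSection) (τ := ζ.toSection)
        (Isotropy.incl_bracket_toSection _ _) ζ.toSection_apply,
      Isotropy.incl_bracket (σ := η.toSection) (τ := L.bracket ξ.toSection ζ.toSection)
        η.toSection_apply (Isotropy.incl_bracket_toSection _ _), L.jacobi]
    rfl

instance : LieAlgebra ℝ (L.Isotropy m) where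
  lie_smul c ξ η := Isotropy.incl_injective <| by
    rw [map_smul, Isotropy.incl_bracket (σ := ξ.toSection) (τ := c • η.toSection)
      ξ.toSection_apply (by simp [Isotropy.toSection_apply])]
    simp [Isotropy.incl_bracket_toSection]

/-- A norm on the finite-dimensional space `𝔥ₘ`, transported from the model fibre. -/
instance : NormedAddCommGroup (L.Isotropy m) :=
  NormedAddCommGroup.induced (L.Isotropy m) F
    ((VectorBundle.continuousLinearEquivAt ℝ F A m).toLinearMap ∘ₗ Isotropy.incl L m)
    ((VectorBundle.continuousLinearEquivAt ℝ F A m).injective.comp Isotropy.incl_injective)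

instance : NormedSpace ℝ (L.Isotropy m) :=
  NormedSpace.induced ℝ (L.Isotropy m) F
    ((VectorBundle.continuousLinearEquivAt ℝ F A m).toLinearMap ∘ₗ Isotropy.incl L m)

instance : FiniteDimensional ℝ (L.Isotropy m) :=
  FiniteDimensional.of_injective
    ((VectorBundle.continuousLinearEquivAt ℝ F A m).toLinearMap ∘ₗ Isotropy.incl L m)
    ((VectorBundle.continuousLinearEquivAt ℝ F A m).injective.comp Isotropy.incl_injective)

instance : NormedLieAlgebra (L.Isotropy m) where
  lie_smul := lie_smul
  norm_smul_le := norm_smul_le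

end Isotropy


end LieAlgebroid
end Basic

section Models

variable {E : Type*} [NormedAddCommGroup E] [NormedSpace ℝ E] [FiniteDimensional ℝ E]
  {M : Type*} [TopologicalSpace M] [ChartedSpace E M] [IsManifold 𝓘(ℝ, E) ∞ M]

namespace LieAlgebroid

variable (E M) in
/-- The tangent Lie algebroid `TM`: the bracket of vector fields, with the identity as anchor. -/
def tangent : LieAlgebroid E E (TangentSpace 𝓘(ℝ, E) : M → Type _) where
  bracket := LinearMap.mk₂ ℝ
    (fun X Y => ⟨VectorField.mlieBracket 𝓘(ℝ, E) X Y,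
      have : IsManifold 𝓘(ℝ, E) (((⊤ : ℕ∞) : WithTop ℕ∞) + 1) M :=
        inferInstanceAs (IsManifold 𝓘(ℝ, E) ∞ M)
      have : IsManifold 𝓘(ℝ, E) (minSmoothness ℝ 2) M := by
        simpa using (inferInstance : IsManifold 𝓘(ℝ, E) 2 M)
      ContDiff.mlieBracket_vectorField (m := ⊤) (n := ⊤) X.contMDiff Y.contMDiff (by simp)⟩)
    (fun X X' Y => by
      ext x
      exact VectorField.mlieBracket_add_left X.mdifferentiableAt X'.mdifferentiableAt)
    (fun c X Y => by
      ext x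
      exact VectorField.mlieBracket_const_smul_left X.mdifferentiableAt)
    (fun X Y Y' => by
      ext x
      exact VectorField.mlieBracket_add_right Y.mdifferentiableAt Y'.mdifferentiableAt)
    (fun c X Y => by
      ext x
      exact VectorField.mlieBracket_const_smul_right Y.mdifferentiableAt)
  bracket_self X := by
    ext x
    exact congrFun VectorField.mlieBracket_self x
  jacobi X Y Z := by
    have : IsManifold 𝓘(ℝ, E) (minSmoothness ℝ 3) M := by
      simpa using (inferInstance : IsManifold 𝓘(ℝ, E) 3 M)
    have h2 : minSmoothness ℝ 2 ≤ (∞ : WithTop ℕ∞) := by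
      simpa using (mod_cast le_top : ((2 : ℕ∞) : WithTop ℕ∞) ≤ ∞)
    ext x
    exact VectorField.leibniz_identity_mlieBracket_apply
      ((X.contMDiff x).of_le h2) ((Y.contMDiff x).of_le h2)
      ((Z.contMDiff x).of_le h2)
  anchor x := ContinuousLinearMap.id ℝ _
  contMDiff_anchor := contMDiff_id
  leibniz X Y f x := by
    have := VectorField.mlieBracket_smul_right (I := 𝓘(ℝ, E)) (V := X) (W := Y) (f := f) (x := x)
      f.mdifferentiableAt Y.mdifferentiableAt
    exact this.trans (add_comm _ _)

section Trivial

variable {𝔨 : Type*} [NormedLieAlgebra 𝔨]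

/-- The bundle `TM × 𝔨` over `M`. -/
abbrev TrivialBundle (E M 𝔨 : Type*) [NormedAddCommGroup E] [NormedSpace ℝ E]
    [TopologicalSpace M] [ChartedSpace E M] : M → Type _ :=
  (TangentSpace 𝓘(ℝ, E) : M → Type _) ×ᵇ Bundle.Trivial M 𝔨

theorem contMDiff_pair_iff {s : ∀ x : M, TrivialBundle E M 𝔨 x} :
    ContMDiff 𝓘(ℝ, E) (𝓘(ℝ, E).prod 𝓘(ℝ, E × 𝔨)) ∞
        (fun x => (⟨x, s x⟩ : TotalSpace (E × 𝔨) (TrivialBundle E M 𝔨))) ↔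
      ContMDiff 𝓘(ℝ, E) 𝓘(ℝ, E).tangent ∞
        (fun x => (⟨x, (s x).1⟩ : TangentBundle 𝓘(ℝ, E) M)) ∧
      ContMDiff 𝓘(ℝ, E) 𝓘(ℝ, 𝔨) ∞ (fun x => ((s x).2 : 𝔨)) := by
  unfold ContMDiff
  rw [← forall_and]
  refine forall_congr' fun x => ?_
  rw [contMDiffAt_section, contMDiffAt_section, modelWithCornersSelf_prod, ← chartedSpaceSelf_prod]
  exact contMDiffAt_prod_iff _

/-- The vector field component of a section of `TM × 𝔨`. -/
def pairFst (s : Cₛ^∞⟮𝓘(ℝ, E); E × 𝔨, TrivialBundle E M 𝔨⟯) :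
    Cₛ^∞⟮𝓘(ℝ, E); E, (TangentSpace 𝓘(ℝ, E) : M → Type _)⟯ :=
  ⟨fun x => (s x).1, (contMDiff_pair_iff.1 s.contMDiff).1⟩

/-- The `𝔨`-valued function component of a section of `TM × 𝔨`. -/
def pairSnd (s : Cₛ^∞⟮𝓘(ℝ, E); E × 𝔨, TrivialBundle E M 𝔨⟯) : C^∞⟮𝓘(ℝ, E), M; 𝓘(ℝ, 𝔨), 𝔨⟯ :=
  ⟨fun x => (s x).2, (contMDiff_pair_iff.1 s.contMDiff).2⟩

section Deriv

variable {G : Type*} [NormedAddCommGroup G] [NormedSpace ℝ G]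

/-- The derivative `L_X g` of a vector valued function along a vector field. -/
def vDeriv (X : Cₛ^∞⟮𝓘(ℝ, E); E, (TangentSpace 𝓘(ℝ, E) : M → Type _)⟯)
    (g : C^∞⟮𝓘(ℝ, E), M; 𝓘(ℝ, G), G⟯) : C^∞⟮𝓘(ℝ, E), M; 𝓘(ℝ, G), G⟯ :=
  ⟨fun x => mvfderiv 𝓘(ℝ, E) g x (X x), contMDiff_mvfderiv_apply g.contMDiff X.contMDiff⟩

theorem mvfderiv_clm_comp {G' : Type*} [NormedAddCommGroup G'] [NormedSpace ℝ G']
    (ℓ : G →L[ℝ] G') {g : M → G} {x : M} (hg : MDifferentiableAt 𝓘(ℝ, E) 𝓘(ℝ, G) g x)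
    (v : TangentSpace 𝓘(ℝ, E) x) :
    mvfderiv 𝓘(ℝ, E) (fun y => ℓ (g y)) x v = ℓ (mvfderiv 𝓘(ℝ, E) g x v) := by
  have h2 := mfderiv_comp x (ℓ.mdifferentiableAt (x := g x)) hg
  rw [ContinuousLinearMap.mfderiv_eq] at h2
  change mfderiv 𝓘(ℝ, E) 𝓘(ℝ, G') (ℓ ∘ g) x v = _
  rw [h2]
  rfl

theorem vDeriv_bracket [T2Space M]
    (X Y : Cₛ^∞⟮𝓘(ℝ, E); E, (TangentSpace 𝓘(ℝ, E) : M → Type _)⟯)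
    (g : C^∞⟮𝓘(ℝ, E), M; 𝓘(ℝ, G), G⟯) (x : M) :
    vDeriv ((tangent E M).bracket X Y) g x = vDeriv X (vDeriv Y g) x - vDeriv Y (vDeriv X g) x := by
  rw [← sub_eq_zero]
  by_contra hne
  obtain ⟨ℓ, hℓ⟩ := SeparatingDual.exists_ne_zero (R := ℝ) hne
  apply hℓ
  have key := (tangent E M).mvfderiv_anchor_bracket X Y
    ⟨fun y => ℓ (g y), ℓ.contMDiff.comp g.contMDiff⟩ x
  have e : ∀ Z, ⇑((tangent E M).lieDeriv Z ⟨fun y => ℓ (g y), ℓ.contMDiff.comp g.contMDiff⟩) =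
      fun y => ℓ (vDeriv Z g y) := fun Z => funext fun y =>
    mvfderiv_clm_comp ℓ g.mdifferentiableAt _
  rw [e, e, mvfderiv_clm_comp ℓ (vDeriv _ g).mdifferentiableAt,
    mvfderiv_clm_comp ℓ (vDeriv _ g).mdifferentiableAt] at key
  rw [map_sub, map_sub, sub_eq_zero]
  exact (mvfderiv_clm_comp ℓ g.mdifferentiableAt _).symm.trans key

theorem vDeriv_add (X : Cₛ^∞⟮𝓘(ℝ, E); E, (TangentSpace 𝓘(ℝ, E) : M → Type _)⟯)
    (g h : C^∞⟮𝓘(ℝ, E), M; 𝓘(ℝ, G), G⟯) (x : M) :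
    vDeriv X (g + h) x = vDeriv X g x + vDeriv X h x :=
  congrArg (fun T => T (X x)) (mvfderiv_add (I := 𝓘(ℝ, E)) (x := x)
    g.mdifferentiableAt h.mdifferentiableAt)

theorem vDeriv_smul (X : Cₛ^∞⟮𝓘(ℝ, E); E, (TangentSpace 𝓘(ℝ, E) : M → Type _)⟯) (c : ℝ)
    (g : C^∞⟮𝓘(ℝ, E), M; 𝓘(ℝ, G), G⟯) (x : M) :
    vDeriv X (c • g) x = c • vDeriv X g x :=
  mvfderiv_clm_comp (c • ContinuousLinearMap.id ℝ G) g.mdifferentiableAt (X x)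

theorem mvfderiv_bilin (B : G →L[ℝ] G →L[ℝ] G) {g h : M → G} {x : M}
    (hg : MDifferentiableAt 𝓘(ℝ, E) 𝓘(ℝ, G) g x) (hh : MDifferentiableAt 𝓘(ℝ, E) 𝓘(ℝ, G) h x)
    (v : TangentSpace 𝓘(ℝ, E) x) :
    mvfderiv 𝓘(ℝ, E) (fun y => B (g y) (h y)) x v =
      B (mvfderiv 𝓘(ℝ, E) g x v) (h x) + B (g x) (mvfderiv 𝓘(ℝ, E) h x v) := by
  have hb := (B.isBoundedBilinearMap.hasFDerivAt (g x, h x)).hasMFDerivAt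
  have hp := HasMFDerivAt.prodMk hg.hasMFDerivAt hh.hasMFDerivAt
  rw [modelWithCornersSelf_prod, ← chartedSpaceSelf_prod] at hb
  have hc := (hb.comp x hp).mfderiv
  change mfderiv 𝓘(ℝ, E) 𝓘(ℝ, G) ((fun p : G × G => B p.1 p.2) ∘ fun y => (g y, h y)) x v = _
  rw [hc, add_comm]
  rfl

end Deriv

variable [FiniteDimensional ℝ 𝔨]

variable (𝔨) in
/-- The bracket of `𝔨` as a continuous bilinear map. -/
def bracketCLM : 𝔨 →L[ℝ] 𝔨 →L[ℝ] 𝔨 :=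
  (LinearMap.mk₂ ℝ (fun ξ η : 𝔨 => ⁅ξ, η⁆) add_lie smul_lie lie_add
    (fun c ξ η => lie_smul c ξ η)).toContinuousBilinearMap

theorem bracketCLM_apply (ξ η : 𝔨) : bracketCLM 𝔨 ξ η = ⁅ξ, η⁆ := rfl

/-- The bracket `[X + ξ, Y + η] = [X, Y] + [ξ, η] + L_X η - L_Y ξ` on sections of `TM × 𝔨`. -/
def trivialBracket (s t : Cₛ^∞⟮𝓘(ℝ, E); E × 𝔨, TrivialBundle E M 𝔨⟯) :
    Cₛ^∞⟮𝓘(ℝ, E); E × 𝔨, TrivialBundle E M 𝔨⟯ :=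
  ⟨fun x => ((tangent E M).bracket (pairFst s) (pairFst t) x,
      (⁅pairSnd s x, pairSnd t x⁆ + vDeriv (pairFst s) (pairSnd t) x
        - vDeriv (pairFst t) (pairSnd s) x : 𝔨)),
    contMDiff_pair_iff.2 ⟨((tangent E M).bracket (pairFst s) (pairFst t)).contMDiff,
      (((((bracketCLM 𝔨).contMDiff.comp (pairSnd s).contMDiff).clm_apply
        (pairSnd t).contMDiff).add (vDeriv (pairFst s) (pairSnd t)).contMDiff).sub
          (vDeriv (pairFst t) (pairSnd s)).contMDiff)⟩⟩

theorem pairSnd_trivialBracket (s t : Cₛ^∞⟮𝓘(ℝ, E); E × 𝔨, TrivialBundle E M 𝔨⟯) :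
    (⇑(pairSnd (trivialBracket s t)) : M → 𝔨) = fun x =>
      bracketCLM 𝔨 (pairSnd s x) (pairSnd t x) + vDeriv (pairFst s) (pairSnd t) x
        - vDeriv (pairFst t) (pairSnd s) x := rfl

theorem pairFst_trivialBracket (s t : Cₛ^∞⟮𝓘(ℝ, E); E × 𝔨, TrivialBundle E M 𝔨⟯) :
    pairFst (trivialBracket s t) = (tangent E M).bracket (pairFst s) (pairFst t) := rfl

theorem vDeriv_pairSnd_trivialBracket
    (X : Cₛ^∞⟮𝓘(ℝ, E); E, (TangentSpace 𝓘(ℝ, E) : M → Type _)⟯)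
    (s t : Cₛ^∞⟮𝓘(ℝ, E); E × 𝔨, TrivialBundle E M 𝔨⟯) (x : M) :
    vDeriv X (pairSnd (trivialBracket s t)) x =
      ⁅vDeriv X (pairSnd s) x, pairSnd t x⁆ + ⁅pairSnd s x, vDeriv X (pairSnd t) x⁆ +
        vDeriv X (vDeriv (pairFst s) (pairSnd t)) x -
          vDeriv X (vDeriv (pairFst t) (pairSnd s)) x := by
  have hB : MDifferentiableAt 𝓘(ℝ, E) 𝓘(ℝ, 𝔨)
      (fun y => bracketCLM 𝔨 (pairSnd s y) (pairSnd t y)) x :=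
    (((bracketCLM 𝔨).contMDiff.comp (pairSnd s).contMDiff).clm_apply
        (pairSnd t).contMDiff).mdifferentiableAt (by simp)
  change mvfderiv 𝓘(ℝ, E) (pairSnd (trivialBracket s t)) x (X x) = _
  rw [pairSnd_trivialBracket]
  have h1 := mvfderiv_sub (hB.add (vDeriv (pairFst s) (pairSnd t)).mdifferentiableAt)
    (vDeriv (pairFst t) (pairSnd s)).mdifferentiableAt (I := 𝓘(ℝ, E)) (x := x)
  have h2 := mvfderiv_add hB (vDeriv (pairFst s) (pairSnd t)).mdifferentiableAt (I := 𝓘(ℝ, E))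
  rw [h2] at h1
  have h3 := mvfderiv_bilin (bracketCLM 𝔨) (pairSnd s).mdifferentiableAt
    (pairSnd t).mdifferentiableAt (X x)
  refine (congrArg (fun T => T (X x)) h1).trans ?_
  simp only [sub_apply, add_apply]
  rw [h3]
  rfl

variable (E M 𝔨) in
/-- The trivial transitive Lie algebroid `TM × 𝔨`, with the projection to `TM` as anchor. -/
def trivial [T2Space M] : LieAlgebroid E (E × 𝔨) (TrivialBundle E M 𝔨) where
  bracket := LinearMap.mk₂ ℝ trivialBracket
    (fun s s' t => ContMDiffSection.ext fun x => Prod.ext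
      (congrArg (fun X => X x) ((tangent E M).bracket.map_add₂ (pairFst s) (pairFst s') (pairFst t)))
      (by
        change ⁅pairSnd s x + pairSnd s' x, pairSnd t x⁆
            + mvfderiv 𝓘(ℝ, E) (pairSnd t) x (pairFst s x + pairFst s' x)
            - vDeriv (pairFst t) (pairSnd s + pairSnd s') x =
          (⁅pairSnd s x, pairSnd t x⁆ + mvfderiv 𝓘(ℝ, E) (pairSnd t) x (pairFst s x)
            - vDeriv (pairFst t) (pairSnd s) x) +
          (⁅pairSnd s' x, pairSnd t x⁆ + mvfderiv 𝓘(ℝ, E) (pairSnd t) x (pairFst s' x)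
            - vDeriv (pairFst t) (pairSnd s') x)
        rw [vDeriv_add, map_add, add_lie]
        abel))
    (fun c s t => ContMDiffSection.ext fun x => Prod.ext
      (congrArg (fun X => X x) ((tangent E M).bracket.map_smul₂ c (pairFst s) (pairFst t)))
      (by
        change ⁅c • pairSnd s x, pairSnd t x⁆
            + mvfderiv 𝓘(ℝ, E) (pairSnd t) x (c • pairFst s x)
            - vDeriv (pairFst t) (c • pairSnd s) x =
          c • (⁅pairSnd s x, pairSnd t x⁆ + mvfderiv 𝓘(ℝ, E) (pairSnd t) x (pairFst s x)
            - vDeriv (pairFst t) (pairSnd s) x)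
        rw [vDeriv_smul, map_smul, smul_lie, smul_sub, smul_add]))
    (fun s t t' => ContMDiffSection.ext fun x => Prod.ext
      (congrArg (fun X => X x) (((tangent E M).bracket (pairFst s)).map_add (pairFst t) (pairFst t')))
      (by
        change ⁅pairSnd s x, pairSnd t x + pairSnd t' x⁆
            + vDeriv (pairFst s) (pairSnd t + pairSnd t') x
            - mvfderiv 𝓘(ℝ, E) (pairSnd s) x (pairFst t x + pairFst t' x) =
          (⁅pairSnd s x, pairSnd t x⁆ + vDeriv (pairFst s) (pairSnd t) x
            - mvfderiv 𝓘(ℝ, E) (pairSnd s) x (pairFst t x)) +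
          (⁅pairSnd s x, pairSnd t' x⁆ + vDeriv (pairFst s) (pairSnd t') x
            - mvfderiv 𝓘(ℝ, E) (pairSnd s) x (pairFst t' x))
        rw [vDeriv_add, map_add, lie_add]
        abel))
    (fun c s t => ContMDiffSection.ext fun x => Prod.ext
      (congrArg (fun X => X x) (((tangent E M).bracket (pairFst s)).map_smul c (pairFst t)))
      (by
        change ⁅pairSnd s x, c • pairSnd t x⁆
            + vDeriv (pairFst s) (c • pairSnd t) x
            - mvfderiv 𝓘(ℝ, E) (pairSnd s) x (c • pairFst t x) =
          c • (⁅pairSnd s x, pairSnd t x⁆ + vDeriv (pairFst s) (pairSnd t) x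
            - mvfderiv 𝓘(ℝ, E) (pairSnd s) x (pairFst t x))
        rw [vDeriv_smul, map_smul, lie_smul, smul_sub, smul_add]))
  bracket_self s := by
    refine ContMDiffSection.ext fun x => Prod.ext ?_ ?_
    · exact congrArg (fun X => X x) ((tangent E M).bracket_self (pairFst s))
    · change ⁅pairSnd s x, pairSnd s x⁆ + vDeriv (pairFst s) (pairSnd s) x
        - vDeriv (pairFst s) (pairSnd s) x = (0 : 𝔨)
      simp
  jacobi s t u := by
    refine ContMDiffSection.ext fun x => Prod.ext ?_ ?_
    · exact congrArg (fun X => X x) ((tangent E M).jacobi (pairFst s) (pairFst t) (pairFst u))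
    · change ⁅pairSnd s x, pairSnd (trivialBracket t u) x⁆
          + vDeriv (pairFst s) (pairSnd (trivialBracket t u)) x
          - vDeriv (pairFst (trivialBracket t u)) (pairSnd s) x =
        (⁅pairSnd (trivialBracket s t) x, pairSnd u x⁆
          + vDeriv (pairFst (trivialBracket s t)) (pairSnd u) x
          - vDeriv (pairFst u) (pairSnd (trivialBracket s t)) x) +
        (⁅pairSnd t x, pairSnd (trivialBracket s u) x⁆
          + vDeriv (pairFst t) (pairSnd (trivialBracket s u)) x
          - vDeriv (pairFst (trivialBracket s u)) (pairSnd t) x)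
      simp only [vDeriv_pairSnd_trivialBracket, pairFst_trivialBracket, vDeriv_bracket,
        pairSnd_trivialBracket, bracketCLM_apply, lie_add, lie_sub, add_lie, sub_lie]
      rw [leibniz_lie (pairSnd s x) (pairSnd t x) (pairSnd u x),
        ← lie_skew (vDeriv (pairFst t) (pairSnd s) x) (pairSnd u x),
        ← lie_skew (vDeriv (pairFst u) (pairSnd s) x) (pairSnd t x)]
      abel
  anchor x := ContinuousLinearMap.fst ℝ _ _
  contMDiff_anchor := fun p => by
    have h := (contMDiffAt_totalSpace (IM := 𝓘(ℝ, E).prod 𝓘(ℝ, E × 𝔨)) (IB := 𝓘(ℝ, E)) (n := ∞)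
      (f := fun q : TotalSpace (E × 𝔨) (TrivialBundle E M 𝔨) => q) (x₀ := p)).1 contMDiffAt_id
    have h2 := (ContinuousLinearMap.fst ℝ E 𝔨).contMDiff.contMDiffAt.comp p h.2
    exact contMDiffAt_totalSpace.2 ⟨h.1, h2⟩
  leibniz s t f x := by
    refine Prod.ext ?_ ?_
    · exact (tangent E M).leibniz (pairFst s) (pairFst t) f x
    · have h := congrArg (fun T => T (pairFst s x)) (mvfderiv_smul (I := 𝓘(ℝ, E)) (x := x)
        f.mdifferentiableAt (pairSnd t).mdifferentiableAt)
      change ⁅pairSnd s x, f x • pairSnd t x⁆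
          + mvfderiv 𝓘(ℝ, E) (⇑f • ⇑(pairSnd t)) x (pairFst s x)
          - mvfderiv 𝓘(ℝ, E) (pairSnd s) x (f x • pairFst t x) =
        f x • (⁅pairSnd s x, pairSnd t x⁆ + mvfderiv 𝓘(ℝ, E) (pairSnd t) x (pairFst s x)
          - mvfderiv 𝓘(ℝ, E) (pairSnd s) x (pairFst t x)) +
          mvfderiv 𝓘(ℝ, E) f x (pairFst s x) • pairSnd t x
      rw [lie_smul, map_smul, h]
      simp
      module

end Trivial
end LieAlgebroid
end Models

section Restriction

variable {E : Type*} [NormedAddCommGroup E] [NormedSpace ℝ E]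
  {M : Type*} [TopologicalSpace M] [ChartedSpace E M]

namespace LieAlgebroid

variable (E) in
/-- The inclusion of an open subset `U ⊆ M`, as a smooth map. -/
def openIncl (U : Opens M) : C^∞⟮𝓘(ℝ, E), U; 𝓘(ℝ, E), M⟯ :=
  ⟨Subtype.val, contMDiff_subtype_val⟩

section Opens

variable {U : Opens M}

open Classical in
/-- A left inverse of the inclusion `U ⊆ M`, with the value `x₀` outside `U`. -/
def openRetr (x₀ : U) (y : M) : U := if h : y ∈ U then ⟨y, h⟩ else x₀

theorem openRetr_coe (x₀ y : U) : openRetr x₀ (y : M) = y := by simp [openRetr]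

theorem openRetr_comp (x₀ : U) : (fun y : U => openRetr x₀ (y : M)) = id :=
  funext (openRetr_coe x₀)

theorem contMDiffAt_openRetr (x₀ y : U) :
    ContMDiffAt 𝓘(ℝ, E) 𝓘(ℝ, E) ∞ (openRetr x₀) (y : M) := by
  rw [← contMDiffAt_subtype_iff, openRetr_comp]
  exact contMDiffAt_id

theorem mfderiv_openRetr_comp (x₀ y : U) (v : TangentSpace 𝓘(ℝ, E) y) :
    (mfderiv 𝓘(ℝ, E) 𝓘(ℝ, E) (openRetr x₀) (openIncl E U y)
      (mfderiv 𝓘(ℝ, E) 𝓘(ℝ, E) (openIncl E U) y v) : E) = v := by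
  have h1 : MDifferentiableAt 𝓘(ℝ, E) 𝓘(ℝ, E) (openIncl E U) y :=
    (openIncl E U).contMDiff.mdifferentiableAt (by simp)
  have h2 : MDifferentiableAt 𝓘(ℝ, E) 𝓘(ℝ, E) (openRetr x₀) (openIncl E U y) :=
    (contMDiffAt_openRetr x₀ y).mdifferentiableAt (by simp)
  have h3 : openRetr x₀ ∘ openIncl E U = id := openRetr_comp x₀
  have h := mfderiv_comp y h2 h1
  rw [h3, mfderiv_id] at h
  exact (congrArg (fun T : E →L[ℝ] E => T v) h).symm

theorem mfderiv_openIncl_comp (x₀ y : U) (v : TangentSpace 𝓘(ℝ, E) (openIncl E U y)) :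
    (mfderiv 𝓘(ℝ, E) 𝓘(ℝ, E) (openIncl E U) y
      (mfderiv 𝓘(ℝ, E) 𝓘(ℝ, E) (openRetr x₀) (openIncl E U y) v : E) : E) = v := by
  have h1 : MDifferentiableAt 𝓘(ℝ, E) 𝓘(ℝ, E) (openIncl E U) y :=
    (openIncl E U).contMDiff.mdifferentiableAt (by simp)
  have h2 : MDifferentiableAt 𝓘(ℝ, E) 𝓘(ℝ, E) (openRetr x₀) (openIncl E U y) :=
    (contMDiffAt_openRetr x₀ y).mdifferentiableAt (by simp)
  have h4 : openIncl E U ∘ openRetr x₀ =ᶠ[𝓝 (openIncl E U y)] id := by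
    filter_upwards [U.isOpen.mem_nhds y.2] with z hz
    have hz' : z ∈ U := hz
    simp [openRetr, openIncl, hz']
  have h := mfderiv_comp_of_eq (x := openIncl E U y) h1 h2 (openRetr_coe x₀ y)
  rw [h4.mfderiv_eq, mfderiv_id] at h
  have h5 : ∀ z : U, z = y → (mfderiv 𝓘(ℝ, E) 𝓘(ℝ, E) (openIncl E U) z : E →L[ℝ] E) =
      mfderiv 𝓘(ℝ, E) 𝓘(ℝ, E) (openIncl E U) y := by
    rintro _ rfl
    rfl
  have h6 := (congrArg (fun T : E →L[ℝ] E => T v) h).symm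
  exact (congrArg (fun T : E →L[ℝ] E => T _) (h5 _ (openRetr_coe x₀ y)).symm).trans h6

/-- The inclusion `U ⊆ M` induces isomorphisms of tangent spaces. -/
theorem isInvertible_mfderiv_openIncl (y : U) :
    (mfderiv 𝓘(ℝ, E) 𝓘(ℝ, E) (openIncl E U) y).IsInvertible :=
  ContinuousLinearMap.IsInvertible.of_inverse
    (f := mfderiv 𝓘(ℝ, E) 𝓘(ℝ, E) (openIncl E U) y)
    (g := (mfderiv 𝓘(ℝ, E) 𝓘(ℝ, E) (openRetr y) (openIncl E U y) : E →L[ℝ] E))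
    (ContinuousLinearMap.ext fun v => mfderiv_openIncl_comp y y v)
    (ContinuousLinearMap.ext fun v => mfderiv_openRetr_comp y y v)

theorem inverse_mfderiv_openIncl (x₀ y : U) (v : TangentSpace 𝓘(ℝ, E) (openIncl E U y)) :
    (mfderiv 𝓘(ℝ, E) 𝓘(ℝ, E) (openIncl E U) y).inverse v =
      (mfderiv 𝓘(ℝ, E) 𝓘(ℝ, E) (openRetr x₀) (openIncl E U y) v : E) :=
  (isInvertible_mfderiv_openIncl y).inverse_apply_eq.2 (mfderiv_openIncl_comp x₀ y v).symm

theorem tangentMap_openRetr [IsManifold 𝓘(ℝ, E) ∞ M] (x₀ y : U)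
    (v : TangentSpace 𝓘(ℝ, E) (openIncl E U y)) :
    tangentMap 𝓘(ℝ, E) 𝓘(ℝ, E) (openRetr x₀) ⟨openIncl E U y, v⟩ =
      (⟨y, (mfderiv 𝓘(ℝ, E) 𝓘(ℝ, E) (openIncl E U) y).inverse v⟩ : TangentBundle 𝓘(ℝ, E) U) := by
  have h : ∀ (z : U) (w w' : E), z = y → w = w' →
      (⟨z, w⟩ : TangentBundle 𝓘(ℝ, E) U) = ⟨y, w'⟩ := by
    rintro _ _ _ rfl rfl
    rfl
  exact h _ _ _ (openRetr_coe x₀ y) (inverse_mfderiv_openIncl x₀ y v).symm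

theorem contMDiffAt_tangentMap_openRetr [IsManifold 𝓘(ℝ, E) ∞ M] (x₀ y : U)
    (v : TangentSpace 𝓘(ℝ, E) (openIncl E U y)) :
    ContMDiffAt 𝓘(ℝ, E).tangent 𝓘(ℝ, E).tangent ∞
      (tangentMap 𝓘(ℝ, E) 𝓘(ℝ, E) (openRetr x₀)) ⟨openIncl E U y, v⟩ := by
  have h1 : ContMDiffOn 𝓘(ℝ, E) 𝓘(ℝ, E) ∞ (openRetr x₀) (U : Set M) := fun z hz =>
    (contMDiffAt_openRetr x₀ ⟨z, hz⟩).contMDiffWithinAt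
  have h2 := h1.contMDiffOn_tangentMapWithin (m := ∞) (by simp) U.isOpen.uniqueMDiffOn
  have h3 : IsOpen (TotalSpace.proj ⁻¹' (U : Set M) : Set (TangentBundle 𝓘(ℝ, E) M)) :=
    U.isOpen.preimage (FiberBundle.continuous_proj E (TangentSpace 𝓘(ℝ, E)))
  refine (h2.contMDiffAt (h3.mem_nhds y.2)).congr_of_eventuallyEq ?_
  filter_upwards [h3.mem_nhds (x := ⟨openIncl E U y, v⟩) y.2] with z hz
  rw [tangentMapWithin, tangentMap, mfderivWithin_of_isOpen U.isOpen hz]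

end Opens

section
variable {F : Type*} [NormedAddCommGroup F] [NormedSpace ℝ F]
  {A : M → Type*} [TopologicalSpace (TotalSpace F A)]
  [∀ x, AddCommGroup (A x)] [∀ x, Module ℝ (A x)] [∀ x, TopologicalSpace (A x)]
  [FiberBundle F A] [VectorBundle ℝ F A]

variable (E A) in
/-- The restriction `A|_U` of the bundle `A` to an open subset. -/
abbrev RestrictBundle (U : Opens M) : U → Type _ := (openIncl E U : U → M) *ᵖ A

variable {U : Opens M}

instance (x : U) : AddCommGroup (RestrictBundle E A U x) :=
  inferInstanceAs (AddCommGroup (A (openIncl E U x)))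

theorem contMDiffAt_restrict_iff {s : ∀ y : M, A y} {x : U} :
    ContMDiffAt 𝓘(ℝ, E) (𝓘(ℝ, E).prod 𝓘(ℝ, F)) ∞
        (fun y : U => (⟨y, s (openIncl E U y)⟩ : TotalSpace F (RestrictBundle E A U))) x ↔
      ContMDiffAt 𝓘(ℝ, E) (𝓘(ℝ, E).prod 𝓘(ℝ, F)) ∞
        (fun y : M => (⟨y, s y⟩ : TotalSpace F A)) (x : M) := by
  refine (contMDiffAt_section (E := RestrictBundle E A U) x).trans ?_
  rw [contMDiffAt_section]
  exact contMDiffAt_subtype_iff (f := fun y : M => (trivializationAt F A (x : M) ⟨y, s y⟩).2)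

/-- The restriction of a section to `U`. -/
def restrictSection (U : Opens M) (σ : Cₛ^∞⟮𝓘(ℝ, E); F, A⟯) :
    Cₛ^∞⟮𝓘(ℝ, E); F, RestrictBundle E A U⟯ :=
  ⟨fun y => σ (openIncl E U y), fun x => contMDiffAt_restrict_iff.2 (σ.contMDiff (x : M))⟩

theorem exists_germ [FiniteDimensional ℝ E] [T2Space M] [IsManifold 𝓘(ℝ, E) ∞ M]
    (s : Cₛ^∞⟮𝓘(ℝ, E); F, RestrictBundle E A U⟯) (x : U) :
    ∃ σ : Cₛ^∞⟮𝓘(ℝ, E); F, A⟯, ∀ᶠ y in 𝓝 x, σ (openIncl E U y) = s y := by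
  classical
  let s' : ∀ y : M, A y := fun y => if h : y ∈ U then s ⟨y, h⟩ else 0
  have hs' : ∀ y : U, s' (openIncl E U y) = s y := fun y => dif_pos y.2
  have hsm : ContMDiffOn 𝓘(ℝ, E) (𝓘(ℝ, E).prod 𝓘(ℝ, F)) ∞
      (fun y => (⟨y, s' y⟩ : TotalSpace F A)) U := fun y hy => by
    refine ContMDiffAt.contMDiffWithinAt ?_
    refine (contMDiffAt_restrict_iff (x := ⟨y, hy⟩)).1 ?_
    simp only [hs']
    exact s.contMDiff _
  obtain ⟨σ, hσ⟩ := exists_section_eventuallyEq U.isOpen x.2 hsm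
  exact ⟨σ, (continuous_subtype_val.continuousAt.eventually hσ).mono fun y hy => hy.trans (hs' y)⟩

section Restrict

variable [FiniteDimensional ℝ E] [T2Space M] [IsManifold 𝓘(ℝ, E) ∞ M]

/-- A section over `M` with the same germ at `x` as a given section over `U`. -/
def germExt (s : Cₛ^∞⟮𝓘(ℝ, E); F, RestrictBundle E A U⟯) (x : U) : Cₛ^∞⟮𝓘(ℝ, E); F, A⟯ :=
  (exists_germ s x).choose

theorem germExt_eventuallyEq (s : Cₛ^∞⟮𝓘(ℝ, E); F, RestrictBundle E A U⟯) (x : U) :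
    ∀ᶠ y in 𝓝 x, germExt s x (openIncl E U y) = s y :=
  (exists_germ s x).choose_spec

theorem eventually_openIncl {p : M → Prop} {x : U} (h : ∀ᶠ y in 𝓝 x, p (openIncl E U y)) :
    ∀ᶠ y in 𝓝 (openIncl E U x), p y := by
  have := U.isOpen.isOpenEmbedding_subtypeVal.map_nhds_eq x
  change ∀ᶠ y in 𝓝 (x : M), p y
  rw [← this]
  exact h

variable (L : LieAlgebroid E F A)

theorem bracket_germ {x : U} {s t : Cₛ^∞⟮𝓘(ℝ, E); F, RestrictBundle E A U⟯}
    {σ τ : Cₛ^∞⟮𝓘(ℝ, E); F, A⟯} (hσ : ∀ᶠ y in 𝓝 x, σ (openIncl E U y) = s y)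
    (hτ : ∀ᶠ y in 𝓝 x, τ (openIncl E U y) = t y) :
    L.bracket (germExt s x) (germExt t x) (openIncl E U x) = L.bracket σ τ (openIncl E U x) := by
  refine L.bracket_congr (eventually_openIncl (E := E) ?_) (eventually_openIncl (E := E) ?_)
  · filter_upwards [germExt_eventuallyEq s x, hσ] with y h1 h2 using h1.trans h2.symm
  · filter_upwards [germExt_eventuallyEq t x, hτ] with y h1 h2 using h1.trans h2.symm

/-- The bracket of sections of `A|_U`, computed from local extensions to sections of `A`. -/
def restrictBracket (s t : Cₛ^∞⟮𝓘(ℝ, E); F, RestrictBundle E A U⟯) :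
    Cₛ^∞⟮𝓘(ℝ, E); F, RestrictBundle E A U⟯ :=
  ⟨fun x => L.bracket (germExt s x) (germExt t x) (openIncl E U x), fun x => by
    refine ((restrictSection U (L.bracket (germExt s x) (germExt t x))).contMDiff
      x).congr_of_eventuallyEq ?_
    filter_upwards [(germExt_eventuallyEq s x).eventually_nhds,
      (germExt_eventuallyEq t x).eventually_nhds] with y h1 h2
    exact congrArg (fun v => (⟨y, v⟩ : TotalSpace F (RestrictBundle E A U)))
      (L.bracket_germ h1 h2)⟩

theorem restrictBracket_apply {x : U} {s t : Cₛ^∞⟮𝓘(ℝ, E); F, RestrictBundle E A U⟯}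
    {σ τ : Cₛ^∞⟮𝓘(ℝ, E); F, A⟯} (hσ : ∀ᶠ y in 𝓝 x, σ (openIncl E U y) = s y)
    (hτ : ∀ᶠ y in 𝓝 x, τ (openIncl E U y) = t y) :
    L.restrictBracket s t x = L.bracket σ τ (openIncl E U x) :=
  L.bracket_germ hσ hτ

/-- The bracket on `A|_U` extends the bracket on `A`. -/
theorem restrictBracket_restrictSection (σ τ : Cₛ^∞⟮𝓘(ℝ, E); F, A⟯) :
    L.restrictBracket (restrictSection U σ) (restrictSection U τ) =
      restrictSection U (L.bracket σ τ) :=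
  ContMDiffSection.ext fun _ =>
    L.restrictBracket_apply (.of_forall fun _ => rfl) (.of_forall fun _ => rfl)

theorem restrictBracket_germ (s t : Cₛ^∞⟮𝓘(ℝ, E); F, RestrictBundle E A U⟯) (x : U) :
    ∀ᶠ y in 𝓝 x, L.bracket (germExt s x) (germExt t x) (openIncl E U y) =
      L.restrictBracket s t y := by
  filter_upwards [(germExt_eventuallyEq s x).eventually_nhds,
    (germExt_eventuallyEq t x).eventually_nhds] with y h1 h2 using
    (L.restrictBracket_apply h1 h2).symm

theorem germExt_add (s t : Cₛ^∞⟮𝓘(ℝ, E); F, RestrictBundle E A U⟯) (x : U) :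
    ∀ᶠ y in 𝓝 x, (germExt s x + germExt t x) (openIncl E U y) = (s + t) y := by
  filter_upwards [germExt_eventuallyEq s x, germExt_eventuallyEq t x] with y h1 h2
  change germExt s x (openIncl E U y) + germExt t x (openIncl E U y) = s y + t y
  rw [h1, h2]
  rfl

theorem germExt_smul (c : ℝ) (s : Cₛ^∞⟮𝓘(ℝ, E); F, RestrictBundle E A U⟯) (x : U) :
    ∀ᶠ y in 𝓝 x, (c • germExt s x) (openIncl E U y) = (c • s) y := by
  filter_upwards [germExt_eventuallyEq s x] with y h1
  change c • germExt s x (openIncl E U y) = c • s y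
  rw [h1]
  rfl

theorem contMDiff_lift :
    ContMDiff (𝓘(ℝ, E).prod 𝓘(ℝ, F)) (𝓘(ℝ, E).prod 𝓘(ℝ, F)) ∞
      (fun q : TotalSpace F (RestrictBundle E A U) =>
        (⟨openIncl E U q.proj, q.2⟩ : TotalSpace F A)) := fun p => by
  have h := (contMDiffAt_totalSpace (IM := 𝓘(ℝ, E).prod 𝓘(ℝ, F)) (IB := 𝓘(ℝ, E)) (n := ∞)
      (f := fun q : TotalSpace F (RestrictBundle E A U) => q) (x₀ := p)).1 contMDiffAt_id
  have h1 : ContMDiffAt (𝓘(ℝ, E).prod 𝓘(ℝ, F)) 𝓘(ℝ, E) ∞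
      (fun q : TotalSpace F (RestrictBundle E A U) => openIncl E U q.proj) p :=
    (openIncl E U).contMDiff.contMDiffAt.comp p h.1
  exact contMDiffAt_totalSpace.2 ⟨h1, h.2⟩

/-- The anchor of `A|_U`. -/
def restrictAnchor (y : U) : RestrictBundle E A U y →L[ℝ] TangentSpace 𝓘(ℝ, E) y :=
  (mfderiv 𝓘(ℝ, E) 𝓘(ℝ, E) (openIncl E U) y).inverse ∘L L.anchor (openIncl E U y)

theorem contMDiff_restrictAnchor :
    ContMDiff (𝓘(ℝ, E).prod 𝓘(ℝ, F)) 𝓘(ℝ, E).tangent ∞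
      (fun p : TotalSpace F (RestrictBundle E A U) =>
        (⟨p.proj, L.restrictAnchor p.proj p.2⟩ : TangentBundle 𝓘(ℝ, E) U)) := fun p => by
  have h2 : ContMDiffAt (𝓘(ℝ, E).prod 𝓘(ℝ, F)) 𝓘(ℝ, E).tangent ∞
      (fun q : TotalSpace F (RestrictBundle E A U) =>
        (⟨openIncl E U q.proj, L.anchor (openIncl E U q.proj) q.2⟩ : TangentBundle 𝓘(ℝ, E) M)) p :=
    (L.contMDiff_anchor.comp contMDiff_lift) p
  have h3 := (contMDiffAt_tangentMap_openRetr p.proj p.proj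
    (L.anchor (openIncl E U p.proj) p.2)).comp p h2
  refine h3.congr_of_eventuallyEq (.of_forall fun q => ?_)
  exact (tangentMap_openRetr p.proj q.proj _).symm

theorem restrict_leibniz (s t : Cₛ^∞⟮𝓘(ℝ, E); F, RestrictBundle E A U⟯)
  (f : C^∞⟮𝓘(ℝ, E), U; ℝ⟯) (x : U) :
  L.restrictBracket s (ContMDiffSection.funSMul f t) x = f x • L.restrictBracket s t x +
    mvfderiv 𝓘(ℝ, E) f x (L.restrictAnchor x (s x)) • t x := by
  obtain ⟨g, hg⟩ := exists_function_eventuallyEq (E := E) (x := openIncl E U x) U.isOpen x.2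
    (s := fun y => f (openRetr x y)) (fun y hy =>
      (f.contMDiff.contMDiffAt.comp y (contMDiffAt_openRetr x ⟨y, hy⟩)).contMDiffWithinAt)
  have hg' : ⇑f =ᶠ[𝓝 x] g ∘ openIncl E U := by
    filter_upwards [(openIncl E U).contMDiff.continuous.continuousAt.eventually hg] with y hy
    rw [Function.comp_apply, hy]
    exact congrArg f (openRetr_coe x y).symm
  have h1 : ∀ᶠ y in 𝓝 x, ContMDiffSection.funSMul g (germExt t x) (openIncl E U y) =
      ContMDiffSection.funSMul f t y := by
    filter_upwards [germExt_eventuallyEq t x, hg'] with y h1 h2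
    change g (openIncl E U y) • germExt t x (openIncl E U y) = f y • t y
    rw [h1, h2]
    rfl
  have h2 := mvfderiv_comp x (g.mdifferentiableAt (x := openIncl E U x))
    (openIncl E U).mdifferentiableAt
  have h3 : mvfderiv 𝓘(ℝ, E) f x = mvfderiv 𝓘(ℝ, E) (g ∘ openIncl E U) x :=
    ContinuousLinearMap.ext fun v => congrArg (fun T : E →L[ℝ] ℝ => T v) hg'.mfderiv_eq
  refine (L.restrictBracket_apply (germExt_eventuallyEq s x) h1).trans ?_
  rw [L.leibniz, (germExt_eventuallyEq s x).self_of_nhds,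
    (germExt_eventuallyEq t x).self_of_nhds, h3, h2, hg'.self_of_nhds,
    ContinuousLinearMap.comp_apply]
  have h4 := (isInvertible_mfderiv_openIncl (E := E) x).self_apply_inverse
    (L.anchor (openIncl E U x) (s x))
  exact congrArg (fun v => g (openIncl E U x) • L.restrictBracket s t x +
    mvfderiv 𝓘(ℝ, E) g (openIncl E U x) v • t x) h4.symm

/-- The restriction `A|_U` of a Lie algebroid to an open subset `U`. The anchor is the anchor of
`A`, followed by the identification of the tangent spaces of `U` and `M`. -/
def restrict (U : Opens M) : LieAlgebroid E F (RestrictBundle E A U) where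
  bracket := LinearMap.mk₂ ℝ L.restrictBracket
    (fun s s' t => ContMDiffSection.ext fun x => by
      rw [L.restrictBracket_apply (germExt_add s s' x) (germExt_eventuallyEq t x), map_add]
      rfl)
    (fun c s t => ContMDiffSection.ext fun x => by
      rw [L.restrictBracket_apply (germExt_smul c s x) (germExt_eventuallyEq t x), map_smul]
      rfl)
    (fun s t t' => ContMDiffSection.ext fun x => by
      rw [L.restrictBracket_apply (germExt_eventuallyEq s x) (germExt_add t t' x), map_add]
      rfl)
    (fun c s t => ContMDiffSection.ext fun x => by
      rw [L.restrictBracket_apply (germExt_eventuallyEq s x) (germExt_smul c t x), map_smul]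
      rfl)
  bracket_self s := ContMDiffSection.ext fun x => by
    change L.bracket (germExt s x) (germExt s x) (openIncl E U x) = 0
    rw [L.bracket_self]
    rfl
  jacobi s t u := ContMDiffSection.ext fun x => by
    change L.restrictBracket s (L.restrictBracket t u) x =
      L.restrictBracket (L.restrictBracket s t) u x + L.restrictBracket t (L.restrictBracket s u) x
    rw [L.restrictBracket_apply (germExt_eventuallyEq s x) (L.restrictBracket_germ t u x),
      L.restrictBracket_apply (L.restrictBracket_germ s t x) (germExt_eventuallyEq u x),
      L.restrictBracket_apply (germExt_eventuallyEq t x) (L.restrictBracket_germ s u x), L.jacobi]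
    rfl
  anchor := L.restrictAnchor
  contMDiff_anchor := L.contMDiff_restrictAnchor
  leibniz := L.restrict_leibniz

end Restrict

end

end LieAlgebroid
end Restriction

section Main

variable {E : Type*} [NormedAddCommGroup E] [NormedSpace ℝ E]
  {M : Type*} [TopologicalSpace M] [ChartedSpace E M] [IsManifold 𝓘(ℝ, E) ∞ M]
  {F : Type*} [NormedAddCommGroup F] [NormedSpace ℝ F]
  {A : M → Type*} [TopologicalSpace (TotalSpace F A)]
  [∀ x, AddCommGroup (A x)] [∀ x, Module ℝ (A x)] [∀ x, TopologicalSpace (A x)]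
  [FiberBundle F A] [VectorBundle ℝ F A]
  {F' : Type*} [NormedAddCommGroup F'] [NormedSpace ℝ F']
  {A' : M → Type*} [TopologicalSpace (TotalSpace F' A')]
  [∀ x, AddCommGroup (A' x)] [∀ x, Module ℝ (A' x)] [∀ x, TopologicalSpace (A' x)]
  [FiberBundle F' A'] [VectorBundle ℝ F' A']

variable (E F A F' A') in
/-- An isomorphism of smooth vector bundles over the identity of `M`. -/
structure SmoothBundleIso where
  fiberEquiv : ∀ x : M, A x ≃L[ℝ] A' x
  contMDiff_toFun : ContMDiff (𝓘(ℝ, E).prod 𝓘(ℝ, F)) (𝓘(ℝ, E).prod 𝓘(ℝ, F')) ∞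
    (fun p : TotalSpace F A => (⟨p.proj, fiberEquiv p.proj p.2⟩ : TotalSpace F' A'))
  contMDiff_invFun : ContMDiff (𝓘(ℝ, E).prod 𝓘(ℝ, F')) (𝓘(ℝ, E).prod 𝓘(ℝ, F)) ∞
    (fun p : TotalSpace F' A' => (⟨p.proj, (fiberEquiv p.proj).symm p.2⟩ : TotalSpace F A))

/-- The image of a section under a bundle isomorphism. -/
def SmoothBundleIso.mapSection (Φ : SmoothBundleIso E F A F' A') (σ : Cₛ^∞⟮𝓘(ℝ, E); F, A⟯) :
    Cₛ^∞⟮𝓘(ℝ, E); F', A'⟯ :=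
  ⟨fun x => Φ.fiberEquiv x (σ x), Φ.contMDiff_toFun.comp σ.contMDiff⟩

namespace LieAlgebroid

/-- An isomorphism of Lie algebroids over the identity of `M`: a vector bundle isomorphism that
intertwines the anchors and the brackets of sections. -/
structure Iso (L : LieAlgebroid E F A) (L' : LieAlgebroid E F' A') extends
    SmoothBundleIso E F A F' A' where
  anchor_comp : ∀ (x : M) (a : A x), L'.anchor x (fiberEquiv x a) = L.anchor x a
  map_bracket : ∀ σ τ : Cₛ^∞⟮𝓘(ℝ, E); F, A⟯,
    toSmoothBundleIso.mapSection (L.bracket σ τ) =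
      L'.bracket (toSmoothBundleIso.mapSection σ) (toSmoothBundleIso.mapSection τ)

section IsotropyBundle

variable [FiniteDimensional ℝ E] [T2Space M] [FiniteDimensional ℝ F]
  [ContMDiffVectorBundle ∞ F A 𝓘(ℝ, E)]

/-- A trivialization over `U`, with fibre the Lie algebra `𝔨`, of the bundle of isotropy Lie
algebras `𝔥 = ker anchor ⊆ A`: Lie algebra isomorphisms `𝔨 ≅ 𝔥ₓ` for `x ∈ U` such that the map
`U × 𝔨 → A` is smooth and its inverse `𝔥|_U → U × 𝔨` is smooth, that is, the `𝔨`-component of the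
inverse is the restriction to `𝔥|_U` of a smooth map on `A|_U`. -/
structure IsotropyTrivialization (L : LieAlgebroid E F A) (U : Opens M)
    (𝔨 : Type*) [NormedLieAlgebra 𝔨] where
  fiberEquiv : ∀ x : U, 𝔨 ≃ₗ⁅ℝ⁆ L.Isotropy (x : M)
  contMDiff_toFun : ContMDiff (𝓘(ℝ, E).prod 𝓘(ℝ, 𝔨)) (𝓘(ℝ, E).prod 𝓘(ℝ, F)) ∞
    (fun p : U × 𝔨 =>
      (⟨(p.1 : M), Isotropy.incl L (p.1 : M) (fiberEquiv p.1 p.2)⟩ : TotalSpace F A))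
  contMDiff_invFun : ∃ ρ : TotalSpace F (RestrictBundle E A U) → 𝔨,
    ContMDiff (𝓘(ℝ, E).prod 𝓘(ℝ, F)) 𝓘(ℝ, 𝔨) ∞ ρ ∧
      ∀ (x : U) (ζ : L.Isotropy (x : M)),
        ρ ⟨x, Isotropy.incl L (x : M) ζ⟩ = (fiberEquiv x).symm ζ

/-- The bundle of isotropy Lie algebras is a locally trivial Lie algebra bundle: every point has
an open neighbourhood over which it is smoothly isomorphic, as a bundle of Lie algebras, to the
product with a fixed finite-dimensional Lie algebra (necessarily isomorphic to the fibre). -/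
def IsotropyLocallyTrivial (L : LieAlgebroid E F A) : Prop :=
  ∀ m : M, ∃ U : Opens M, m ∈ U ∧ Nonempty (L.IsotropyTrivialization U (L.Isotropy m))

end IsotropyBundle

end LieAlgebroid

/-- `φ` is a smooth deformation retraction of `U` onto the point `m₀`: a smooth homotopy
`φ_t : U → U`, `0 ≤ t ≤ 1`, with `φ_0` constant equal to `m₀` and `φ_1 = id`. The values of `φ` for
`t ∉ [0, 1]` are irrelevant, and `m₀` need not be fixed for `0 < t < 1`. -/
structure IsSmoothDeformationRetraction (U : Opens M) (m₀ : U) (φ : ℝ × U → U) : Prop where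
  contMDiffOn : ContMDiffOn (𝓘(ℝ, ℝ).prod 𝓘(ℝ, E)) 𝓘(ℝ, E) ∞ φ (Icc (0 : ℝ) 1 ×ˢ univ)
  map_zero : ∀ m : U, φ (0, m) = m₀
  map_one : ∀ m : U, φ (1, m) = m

end Main

end

/-! The contraction is used to transport data from the single point `m₀` to all of `U`. After a
change of time the contraction becomes a smooth map `φ` from `ℝ × U` to `U`, and transitivity lets
its velocity be lifted to a section `a` of `A` along `φ` (`exists_velocity_lift`). Sections of `A`
along `φ` that lift vector fields on `ℝ × U` have a bracket, as in the pullback algebroid. Fix a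
constant vector `X` in a chart and an element `ξ` of the isotropy at `m₀`, and look for a section
`u` that lifts `(0, X)`, commutes with `a`, and has the value `ξ` at time `0`. Commuting with `a` is
a linear differential equation in time, with the points of `U` as parameters, so it can be solved up
to time `1`. The lifting condition holds at time `0`, because `φ_0` is constant and `ξ` has zero
anchor. It persists because its defect solves a homogeneous linear equation
(`hasDerivAt_lift_defect`).

At time `1` the contraction is the identity, so the pairs `(X, ξ)` give a fibrewise linear map from
`TU × 𝔥` to `A` that respects anchors. It is injective by backward uniqueness, and bijective by
counting dimensions. By the Jacobi identity the bracket of two transported sections again commutes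
with `a` (`bracketAlong_bracketAlong`). It is therefore determined by its value at time `0`, where
the sections are constant and only the isotropy bracket remains (`bracketIn_sec`). This is the
structure equation of the trivial algebroid, and the Leibniz rule extends it to all sections
(`TrivialFrame.iso`).

The local triviality of the isotropy bundle follows by applying this result to a chart ball, which
contracts along straight lines, and restricting the isomorphism to the kernels of the anchors.

Two tools carry the argument. Smooth dependence of linear equations on parameters comes from writing
the solution as the inverse of an operator on continuous functions on `[0, 1]`: inversion is smooth
on units, and time itself becomes a parameter after rescaling. The calculus of brackets is done in a
chart and a frame through structure functions `ρ` and `C` (`isAlgebroidModel`). Covariance under a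
change of frame (`bracketAlong_frameChange`) makes the local computations fit together. -/

noncomputable section

set_option linter.unusedSectionVars false

/-! ### Smooth families of curves as smooth maps into a space of continuous functions -/

section ParametricCurves

variable {K : Type*} [TopologicalSpace K] [CompactSpace K]
  {T : Type*} [NormedAddCommGroup T] [NormedSpace ℝ T]
  {Z : Type*} [NormedAddCommGroup Z] [NormedSpace ℝ Z]
  {G : Type*} [NormedAddCommGroup G] [NormedSpace ℝ G]

/-- The family of continuous maps `k ↦ H (ι k, z)` with parameter `z`. -/
def paramCurve (ι : C(K, T)) (H : T × Z → G) (hH : Continuous H) (z : Z) : C(K, G) :=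
  ⟨fun k => H (ι k, z), by fun_prop⟩

/-- For each `k` the remainder is bounded by the mean value inequality. Compactness of `K` makes the
partial derivative in `z` continuous uniformly in `k`, so the bounds combine into one in the
supremum norm. -/
theorem hasFDerivAt_paramCurve [FiniteDimensional ℝ Z] (ι : C(K, T)) {H : T × Z → G}
    (hH : ContDiff ℝ ∞ H) (z : Z) :
    ∃ D : Z →L[ℝ] C(K, G), HasFDerivAt (paramCurve ι H hH.continuous) D z ∧
      ∀ v k, D v k = fderiv ℝ H (ι k, z) (0, v) := by
  have hc : Continuous (fderiv ℝ H) := hH.continuous_fderiv (by simp)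
  let D : Z →ₗ[ℝ] C(K, G) :=
    { toFun := fun v => ⟨fun k => fderiv ℝ H (ι k, z) (0, v), by fun_prop⟩
      map_add' := fun v w => by
        ext k
        change fderiv ℝ H (ι k, z) (0, v + w) =
          fderiv ℝ H (ι k, z) (0, v) + fderiv ℝ H (ι k, z) (0, w)
        rw [← map_add, Prod.mk_add_mk, add_zero]
      map_smul' := fun c v => by
        ext k
        change fderiv ℝ H (ι k, z) (0, c • v) = c • fderiv ℝ H (ι k, z) (0, v)
        rw [← map_smul, Prod.smul_mk, smul_zero] }
  refine ⟨D.toContinuousLinearMap, ?_, fun v k => rfl⟩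
  rw [hasFDerivAt_iff_isLittleO_nhds_zero, Asymptotics.isLittleO_iff]
  intro ε hε
  have h1 : ∀ᶠ z' in 𝓝 z, ∀ k : K,
      ‖(fderiv ℝ H (ι k, z')).comp (ContinuousLinearMap.inr ℝ T Z)
        - (fderiv ℝ H (ι k, z)).comp (ContinuousLinearMap.inr ℝ T Z)‖ < ε := by
    have := isCompact_univ (X := K).eventually_forall_of_forall_eventually (x₀ := z)
      (P := fun z' k => ‖(fderiv ℝ H (ι k, z')).comp (ContinuousLinearMap.inr ℝ T Z)
        - (fderiv ℝ H (ι k, z)).comp (ContinuousLinearMap.inr ℝ T Z)‖ < ε) ?_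
    · simpa using this
    · intro k _
      have hcont : Continuous fun q : Z × K =>
          ‖(fderiv ℝ H (ι q.2, q.1)).comp (ContinuousLinearMap.inr ℝ T Z)
          - (fderiv ℝ H (ι q.2, z)).comp (ContinuousLinearMap.inr ℝ T Z)‖ := by fun_prop
      exact hcont.continuousAt.eventually_lt continuousAt_const (by simpa using hε)
  obtain ⟨δ, hδ, hball⟩ := Metric.eventually_nhds_iff_ball.1 h1
  filter_upwards [Metric.ball_mem_nhds (0 : Z) hδ] with h hh
  rw [ContinuousMap.norm_le _ (by positivity)]
  intro k
  change ‖H (ι k, z + h) - H (ι k, z) - fderiv ℝ H (ι k, z) (0, h)‖ ≤ _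
  have hd : ∀ z' ∈ Metric.ball z δ, HasFDerivWithinAt (fun z' => H (ι k, z'))
      ((fderiv ℝ H (ι k, z')).comp (ContinuousLinearMap.inr ℝ T Z)) (Metric.ball z δ) z' := by
    intro z' _
    exact (((hH.differentiable (by simp)) (ι k, z')).hasFDerivAt.comp z'
      (hasFDerivAt_prodMk_right (ι k) z')).hasFDerivWithinAt
  have := (convex_ball z δ).norm_image_sub_le_of_norm_hasFDerivWithin_le' hd
    (fun z' hz' => (hball z' hz' k).le) (Metric.mem_ball_self hδ)
    (y := z + h) (by simpa using hh)
  simpa using this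

/-- A smooth family of curves on a compact space is smooth as a map into the Banach space of
continuous maps. -/
theorem contDiff_paramCurve [FiniteDimensional ℝ Z] (ι : C(K, T)) {H : T × Z → G}
    (hH : ContDiff ℝ ∞ H) : ContDiff ℝ ∞ (paramCurve ι H hH.continuous) := by
  rw [contDiff_infty]
  intro n
  -- `H` must stay general: each directional derivative of the family is a family of the same kind,
  -- built from a partial derivative of `H`.
  induction n generalizing H with
  | zero =>
    refine contDiff_zero.2 (continuous_iff_continuousAt.2 fun z => ?_)
    obtain ⟨D, hD, -⟩ := hasFDerivAt_paramCurve ι hH z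
    exact hD.continuousAt
  | succ n ih =>
    rw [Nat.cast_succ, contDiff_succ_iff_fderiv_apply]
    refine ⟨fun z => ?_, by simp, fun v => ?_⟩
    · obtain ⟨D, hD, -⟩ := hasFDerivAt_paramCurve ι hH z
      exact hD.differentiableAt
    · have h' : ContDiff ℝ ∞ fun q : T × Z => fderiv ℝ H q (0, v) :=
        (hH.fderiv_right (m := ∞) (by simp)).clm_apply contDiff_const
      convert ih h' using 1
      funext z
      obtain ⟨D, hD, hD'⟩ := hasFDerivAt_paramCurve ι hH z
      rw [hD.fderiv]
      ext k
      exact hD' v k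

end ParametricCurves

/-! ### Linear equations as integral equations on the unit interval -/

section Volterra

variable {R : Type*} [NormedRing R] [NormedAlgebra ℝ R] [CompleteSpace R]

open unitInterval

theorem continuous_primitive_unitInterval (w : C(I, R)) :
    Continuous fun τ : I => ∫ s in (0 : ℝ)..τ, w (projIcc 0 1 zero_le_one s) := by
  have h : Continuous fun s : ℝ => w (projIcc 0 1 zero_le_one s) :=
    w.continuous.comp continuous_projIcc
  exact (intervalIntegral.continuous_primitive (fun a b => h.intervalIntegrable a b) 0).comp
    continuous_subtype_val

variable (R) in
/-- The operator `w ↦ ∫₀ w` on continuous functions on the unit interval. -/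
def volterra : C(I, R) →L[ℝ] C(I, R) :=
  LinearMap.mkContinuous
    { toFun := fun w => ⟨fun τ => ∫ s in (0 : ℝ)..τ, w (projIcc 0 1 zero_le_one s),
        continuous_primitive_unitInterval w⟩
      map_add' := fun w w' => by
        have h : ∀ w : C(I, R), Continuous fun s : ℝ => w (projIcc 0 1 zero_le_one s) :=
          fun w => w.continuous.comp continuous_projIcc
        ext τ
        exact intervalIntegral.integral_add ((h w).intervalIntegrable _ _)
          ((h w').intervalIntegrable _ _)
      map_smul' := fun c w => by
        ext τ
        exact intervalIntegral.integral_smul c _ } 1 (fun w => by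
    rw [one_mul, ContinuousMap.norm_le _ (norm_nonneg _)]
    intro τ
    refine (intervalIntegral.norm_integral_le_of_norm_le_const
      (C := ‖w‖) fun s _ => w.norm_coe_le_norm _).trans ?_
    rw [sub_zero, abs_of_nonneg τ.2.1]
    exact mul_le_of_le_one_right (norm_nonneg _) τ.2.2)

theorem volterra_apply (w : C(I, R)) (τ : I) :
    volterra R w τ = ∫ s in (0 : ℝ)..τ, w (projIcc 0 1 zero_le_one s) := rfl

variable (R) in
/-- The operator `b ↦ (w ↦ ∫₀ b w)`. -/
def volterraMul : C(I, R) →L[ℝ] C(I, R) →L[ℝ] C(I, R) :=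
  (ContinuousLinearMap.compL ℝ C(I, R) C(I, R) C(I, R) (volterra R)).comp
    (ContinuousLinearMap.mul ℝ C(I, R))

theorem volterraMul_apply (b w : C(I, R)) : volterraMul R b w = volterra R (b * w) := rfl

variable {Y : Type*} [NormedAddCommGroup Y] [NormedSpace ℝ Y] [FiniteDimensional ℝ Y]

/-- Rescaled coefficient `τ ↦ t B (τ t, y)` of a linear differential equation. -/
def scaledCoeff (B : ℝ × Y → R) (hB : ContDiff ℝ ∞ B) : ℝ × Y → C(I, R) :=
  paramCurve ⟨Subtype.val, continuous_subtype_val⟩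
    (fun q : ℝ × ℝ × Y => q.2.1 • B (q.1 * q.2.1, q.2.2)) (by
      have := hB.continuous
      fun_prop)

/-- Rescaling puts all solutions on one fixed interval. The final time and the original parameter
now play the same role, so smoothness in both is obtained at once. -/
theorem contDiff_scaledCoeff {B : ℝ × Y → R} (hB : ContDiff ℝ ∞ B) :
    ContDiff ℝ ∞ (scaledCoeff B hB) :=
  contDiff_paramCurve _ (H := fun q : ℝ × ℝ × Y => q.2.1 • B (q.1 * q.2.1, q.2.2)) (by fun_prop)

theorem scaledCoeff_apply {B : ℝ × Y → R} (hB : ContDiff ℝ ∞ B) (z : ℝ × Y) (τ : I) :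
    scaledCoeff B hB z τ = z.1 • B (τ * z.1, z.2) := rfl

/-- The solution of the rescaled equation `du/dτ = t B (τ t, y) u`, `u 0 = 1`, on the unit interval. -/
def scaledSol (B : ℝ × Y → R) (hB : ContDiff ℝ ∞ B) (z : ℝ × Y) : C(I, R) :=
  Ring.inverse (1 - volterraMul R (scaledCoeff B hB z)) 1

/-- Invertibility of the operator gives uniqueness for the integral equation; this identifies
rescaled solutions in `scaledSol_scale`. -/
theorem eq_scaledSol {B : ℝ × Y → R} {hB : ContDiff ℝ ∞ B} {z : ℝ × Y}
    (hz : IsUnit (1 - volterraMul R (scaledCoeff B hB z))) {w : C(I, R)}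
    (hw : w = 1 + volterraMul R (scaledCoeff B hB z) w) : w = scaledSol B hB z := by
  have h : (1 - volterraMul R (scaledCoeff B hB z)) w = 1 := by
    rw [sub_apply, one_apply_eq_self, sub_eq_iff_eq_add]
    exact hw
  rw [scaledSol, ← h, ← mul_apply_eq_comp, Ring.inverse_mul_cancel _ hz,
    one_apply_eq_self]

theorem scaledSol_eq {B : ℝ × Y → R} {hB : ContDiff ℝ ∞ B} {z : ℝ × Y}
    (hz : IsUnit (1 - volterraMul R (scaledCoeff B hB z))) :
    scaledSol B hB z = 1 + volterraMul R (scaledCoeff B hB z) (scaledSol B hB z) := by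
  have h : (1 - volterraMul R (scaledCoeff B hB z)) (scaledSol B hB z) = 1 := by
    rw [scaledSol, ← mul_apply_eq_comp, Ring.mul_inverse_cancel _ hz,
      one_apply_eq_self]
  rw [sub_apply, one_apply_eq_self, sub_eq_iff_eq_add] at h
  exact h

theorem scaledSol_apply {B : ℝ × Y → R} {hB : ContDiff ℝ ∞ B} {z : ℝ × Y}
    (hz : IsUnit (1 - volterraMul R (scaledCoeff B hB z))) (τ : I) :
    scaledSol B hB z τ = 1 + ∫ s in (0 : ℝ)..τ,
      z.1 • (B (s * z.1, z.2) * scaledSol B hB z (projIcc 0 1 zero_le_one s)) := by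
  conv_lhs => rw [scaledSol_eq hz]
  rw [ContinuousMap.add_apply, ContinuousMap.one_apply, volterraMul_apply, volterra_apply]
  congr 1
  refine intervalIntegral.integral_congr fun s hs => ?_
  rw [uIcc_of_le τ.2.1] at hs
  have hs' : s ∈ Icc (0 : ℝ) 1 := ⟨hs.1, hs.2.trans τ.2.2⟩
  simp only [ContinuousMap.mul_apply, scaledCoeff_apply, projIcc_of_mem _ hs', smul_mul_assoc]

/-- A solution run at a slower speed satisfies the integral equation with the smaller final time,
after a substitution in the integral, so uniqueness applies. Hence the values at `1` for varying
final times recover the entire curve. -/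
theorem scaledSol_scale {B : ℝ × Y → R} {hB : ContDiff ℝ ∞ B} {t : ℝ} {y : Y} (τ : I)
    (hz : IsUnit (1 - volterraMul R (scaledCoeff B hB (t, y))))
    (hz' : IsUnit (1 - volterraMul R (scaledCoeff B hB (τ * t, y)))) :
    scaledSol B hB (τ * t, y) 1 = scaledSol B hB (t, y) τ := by
  let w : C(I, R) := ⟨fun s => scaledSol B hB (t, y) (τ * s), by fun_prop⟩
  have hw : w = scaledSol B hB (τ * t, y) := by
    refine eq_scaledSol hz' ?_
    ext r
    rw [ContinuousMap.add_apply, ContinuousMap.one_apply, volterraMul_apply, volterra_apply]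
    change scaledSol B hB (t, y) (τ * r) = _
    rw [scaledSol_apply hz]
    congr 1
    have := intervalIntegral.smul_integral_comp_mul_left (a := 0) (b := r)
      (fun s : ℝ => t • (B (s * t, y) * scaledSol B hB (t, y) (projIcc 0 1 zero_le_one s))) (τ : ℝ)
    rw [mul_zero] at this
    change ∫ s in (0 : ℝ)..(τ * r : ℝ), t • (B (s * t, y) * scaledSol B hB (t, y)
      (projIcc 0 1 zero_le_one s)) = _
    rw [← this, ← intervalIntegral.integral_smul]
    refine intervalIntegral.integral_congr fun s hs => ?_
    rw [uIcc_of_le r.2.1] at hs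
    have hs' : s ∈ Icc (0 : ℝ) 1 := ⟨hs.1, hs.2.trans r.2.2⟩
    have hs'' : (τ : ℝ) * s ∈ Icc (0 : ℝ) 1 := unitInterval.mul_mem τ.2 hs'
    simp only [ContinuousMap.mul_apply, scaledCoeff_apply, projIcc_of_mem _ hs',
      projIcc_of_mem _ hs'']
    rw [smul_mul_assoc, smul_smul, mul_right_comm (τ : ℝ) s t, mul_comm s]
    have e : (⟨(τ : ℝ) * s, hs''⟩ : I) = τ * ⟨s, hs'⟩ := rfl
    rw [e]
    rfl
  rw [← hw]
  change scaledSol B hB (t, y) (τ * 1) = _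
  rw [mul_one]

end Volterra

/-! ### Smooth fundamental solutions near a point -/

section Propagator

variable {R : Type*} [NormedRing R] [NormedAlgebra ℝ R] [CompleteSpace R]
  {Y : Type*} [NormedAddCommGroup Y] [NormedSpace ℝ Y] [FiniteDimensional ℝ Y]

/-- The solution of `dP/dt = B P`, `P 0 = 1` depends smoothly on time and parameters. -/
theorem exists_propagator_of_contDiff {B : ℝ × Y → R} (hB : ContDiff ℝ ∞ B) (y₀ : Y) :
    ∃ δ > 0, ∃ P : ℝ × Y → R, ContDiffOn ℝ ∞ P (Ioo (-δ) δ ×ˢ Metric.ball y₀ δ) ∧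
      (∀ y ∈ Metric.ball y₀ δ, P (0, y) = 1) ∧
      (∀ p ∈ Ioo (-δ) δ ×ˢ Metric.ball y₀ δ, IsUnit (P p)) ∧
      ∀ t ∈ Ioo (-δ) δ, ∀ y ∈ Metric.ball y₀ δ,
        HasDerivAt (fun t => P (t, y)) (B (t, y) * P (t, y)) t := by
  -- The solution is the inverse of `Q z` applied to the constant `1`, hence smooth wherever `Q z`
  -- is a unit. This holds near time `0`, because the rescaled coefficient vanishes there and `Q` is
  -- the identity.
  let Q : ℝ × Y → (C(unitInterval, R) →L[ℝ] C(unitInterval, R)) :=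
    fun z => 1 - volterraMul R (scaledCoeff B hB z)
  have hV : ContDiff ℝ ∞ fun b => volterraMul R b :=
    ContinuousLinearMap.contDiff (𝕜 := ℝ) (E := C(unitInterval, R))
      (F := C(unitInterval, R) →L[ℝ] C(unitInterval, R)) (volterraMul R)
  have hQ : ContDiff ℝ ∞ Q := contDiff_const.sub (hV.comp (contDiff_scaledCoeff hB))
  let P : ℝ × Y → R := fun z => scaledSol B hB z 1
  have hN : IsOpen {z | IsUnit (Q z)} := by
    have h := Units.isOpen (R := C(unitInterval, R) →L[ℝ] C(unitInterval, R))
    have hc : Continuous Q := hQ.continuous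
    exact h.preimage hc
  have hPs : ∀ z, IsUnit (Q z) → ContDiffAt ℝ ∞ P z := by
    intro z hz
    obtain ⟨q, hq⟩ := hz
    have h1 : ContDiffAt ℝ ∞ (fun z => Ring.inverse (Q z)) z := by
      have := contDiffAt_ringInverse (n := ∞) ℝ
        (R := C(unitInterval, R) →L[ℝ] C(unitInterval, R)) q
      rw [hq] at this
      exact this.comp z hQ.contDiffAt
    exact ((ContinuousMap.evalCLM ℝ (1 : unitInterval)).contDiff.contDiffAt).comp z
      (h1.clm_apply contDiffAt_const)
  have h0 : ∀ y, scaledCoeff B hB (0, y) = 0 := fun y => by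
    ext τ
    simp [scaledCoeff_apply]
  have hQ1 : ∀ y, Q (0, y) = 1 := fun y => by
    have h := ContinuousLinearMap.map_zero (volterraMul R)
    change 1 - volterraMul R (scaledCoeff B hB (0, y)) = 1
    rw [h0, h]
    exact sub_zero (1 : C(unitInterval, R) →L[ℝ] C(unitInterval, R))
  have hQ0 : ∀ y, IsUnit (Q (0, y)) := fun y => by
    rw [hQ1]
    exact isUnit_one
  have hP0 : ∀ y, P (0, y) = 1 := fun y => by
    change (Ring.inverse (Q (0, y)) 1) 1 = 1
    rw [hQ1, Ring.inverse_one]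
    rfl
  have hU : {z | IsUnit (Q z)} ∩ {z | IsUnit (P z)} ∈ 𝓝 ((0 : ℝ), y₀) := by
    refine inter_mem (hN.mem_nhds (hQ0 y₀)) ?_
    exact (hPs _ (hQ0 y₀)).continuousAt.preimage_mem_nhds
      (Units.isOpen.mem_nhds (by change IsUnit _; simp [hP0]))
  obtain ⟨δ, hδ, hball⟩ := Metric.mem_nhds_iff.1 hU
  have hbox : Ioo (-δ) δ ×ˢ Metric.ball y₀ δ ⊆ {z | IsUnit (Q z)} ∩ {z | IsUnit (P z)} := by
    rintro ⟨t, y⟩ ⟨ht, hy⟩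
    apply hball
    rw [← ball_prod_same]
    exact ⟨by simpa [abs_lt] using ht, hy⟩
  -- The substitution `r = s * t` together with `scaledSol_scale` turns the equation on `[0, 1]`
  -- into an integral equation in `t`. The box is stable under `t ↦ s * t`, so all operators
  -- involved are units.
  have hprim : ∀ t ∈ Ioo (-δ) δ, ∀ y ∈ Metric.ball y₀ δ,
      P (t, y) = 1 + ∫ r in (0 : ℝ)..t, B (r, y) * P (r, y) := by
    intro t ht y hy
    have hz : IsUnit (Q (t, y)) := (hbox ⟨ht, hy⟩).1
    change scaledSol B hB (t, y) 1 = _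
    rw [scaledSol_apply hz]
    congr 1
    have := intervalIntegral.smul_integral_comp_mul_right (a := 0) (b := 1)
      (fun r : ℝ => B (r, y) * P (r, y)) t
    rw [zero_mul, one_mul] at this
    rw [← this, ← intervalIntegral.integral_smul]
    change ∫ s in (0 : ℝ)..1, _ = _
    refine intervalIntegral.integral_congr fun s hs => ?_
    rw [uIcc_of_le zero_le_one] at hs
    have hst : s * t ∈ Ioo (-δ) δ := by
      rw [mem_Ioo, ← abs_lt, abs_mul, abs_of_nonneg hs.1]
      exact (mul_le_of_le_one_left (abs_nonneg t) hs.2).trans_lt (abs_lt.2 ht)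
    have := scaledSol_scale (hB := hB) (⟨s, hs⟩ : unitInterval) hz (hbox (a := (s * t, y)) ⟨hst, hy⟩).1
    simp only [projIcc_of_mem _ hs]
    rw [← this]
  refine ⟨δ, hδ, P, fun z hz => (hPs z (hbox hz).1).contDiffWithinAt, fun y _ => hP0 y,
    fun z hz => (hbox hz).2, fun t ht y hy => ?_⟩
  have hc : ContinuousOn (fun r => B (r, y) * P (r, y)) (Ioo (-δ) δ) := by
    refine (hB.continuous.comp (by fun_prop)).continuousOn.mul fun r hr => ?_
    have := (hPs (r, y) (hbox ⟨hr, hy⟩).1).continuousAt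
    exact (this.comp (f := fun r : ℝ => (r, y)) (by fun_prop)).continuousWithinAt
  have h0m : (0 : ℝ) ∈ Ioo (-δ) δ := ⟨by linarith, hδ⟩
  have hd := intervalIntegral.integral_hasDerivAt_right
    (f := fun r => B (r, y) * P (r, y)) (a := 0) (b := t)
    ((hc.mono (ordConnected_Ioo.uIcc_subset h0m ht)).intervalIntegrable)
    (hc.stronglyMeasurableAtFilter isOpen_Ioo t ht) (hc.continuousAt (isOpen_Ioo.mem_nhds ht))
  refine (hd.const_add 1).congr_of_eventuallyEq ?_
  filter_upwards [isOpen_Ioo.mem_nhds ht] with r hr using hprim r hr y hy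

/-- A bump function extends the coefficient to the whole space and a translation moves the initial
time to `0`. Where the bump function equals `1` the equation is the original one. -/
theorem exists_propagator {B : ℝ × Y → R} {O : Set (ℝ × Y)} (hO : IsOpen O)
    (hB : ContDiffOn ℝ ∞ B O) {t₀ : ℝ} {y₀ : Y} (h₀ : (t₀, y₀) ∈ O) :
    ∃ δ > 0, Ioo (t₀ - δ) (t₀ + δ) ×ˢ Metric.ball y₀ δ ⊆ O ∧
      ∃ P : ℝ × Y → R, ContDiffOn ℝ ∞ P (Ioo (t₀ - δ) (t₀ + δ) ×ˢ Metric.ball y₀ δ) ∧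
      (∀ p ∈ Ioo (t₀ - δ) (t₀ + δ) ×ˢ Metric.ball y₀ δ, IsUnit (P p)) ∧
      ∀ t ∈ Ioo (t₀ - δ) (t₀ + δ), ∀ y ∈ Metric.ball y₀ δ,
        HasDerivAt (fun t => P (t, y)) (B (t, y) * P (t, y)) t := by
  obtain ⟨f, hf, hf1⟩ : ∃ f : ContDiffBump (t₀, y₀), Metric.closedBall (t₀, y₀) f.rOut ⊆ O ∧
      0 < f.rIn := by
    obtain ⟨ε, hε, hεO⟩ := Metric.nhds_basis_closedBall.mem_iff.1 (hO.mem_nhds h₀)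
    exact ⟨⟨ε / 2, ε, by positivity, by linarith⟩, hεO, by positivity⟩
  let B' : ℝ × Y → R := fun p => f p • B p
  have hB' : ContDiff ℝ ∞ B' := by
    rw [contDiff_iff_contDiffAt]
    intro p
    by_cases hp : p ∈ tsupport f
    · rw [f.tsupport_eq] at hp
      exact f.contDiff.contDiffAt.smul (hB.contDiffAt (hO.mem_nhds (hf hp)))
    · refine contDiffAt_const (c := 0) |>.congr_of_eventuallyEq ?_
      filter_upwards [(isClosed_tsupport f).isOpen_compl.mem_nhds hp] with q hq
      simp [B', image_eq_zero_of_notMem_tsupport hq]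
  obtain ⟨δ, hδ, P, hP, -, hPu, hPd⟩ := exists_propagator_of_contDiff
    (B := fun p : ℝ × Y => B' (t₀ + p.1, p.2)) (by fun_prop) y₀
  have hδ' : 0 < min δ f.rIn := lt_min hδ hf1
  have hbox : Ioo (t₀ - min δ f.rIn) (t₀ + min δ f.rIn) ×ˢ Metric.ball y₀ (min δ f.rIn) ⊆
      Metric.ball (t₀, y₀) f.rIn := by
    rw [← ball_prod_same, ← Real.ball_eq_Ioo]
    exact prod_mono (Metric.ball_subset_ball (min_le_right _ _))
      (Metric.ball_subset_ball (min_le_right _ _))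
  have hmaps : ∀ p ∈ Ioo (t₀ - min δ f.rIn) (t₀ + min δ f.rIn) ×ˢ Metric.ball y₀ (min δ f.rIn),
      (p.1 - t₀, p.2) ∈ Ioo (-δ) δ ×ˢ Metric.ball y₀ δ := by
    rintro ⟨t, y⟩ ⟨⟨h1, h2⟩, hy⟩
    have := min_le_left δ f.rIn
    exact ⟨⟨by simp only at *; linarith, by simp only at *; linarith⟩,
      Metric.ball_subset_ball this hy⟩
  refine ⟨min δ f.rIn, hδ', fun p hp => hf (Metric.ball_subset_closedBall
    (Metric.ball_subset_ball f.rIn_lt_rOut.le (hbox hp))), fun p => P (p.1 - t₀, p.2), ?_, ?_, ?_⟩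
  · exact hP.comp (by fun_prop) hmaps
  · exact fun p hp => hPu _ (hmaps p hp)
  · intro t ht y hy
    have h := hPd (t - t₀) (hmaps (t, y) ⟨ht, hy⟩).1 y (hmaps (t, y) ⟨ht, hy⟩).2
    have h2 := h.scomp t ((hasDerivAt_id t).sub_const t₀)
    have h3 : f (t, y) = 1 := f.one_of_mem_closedBall
      (Metric.ball_subset_closedBall (hbox ⟨ht, hy⟩))
    have h4 : B' (t₀ + (t - t₀), y) = B (t, y) := by
      simp [B', h3]
    simp only [h4, one_smul] at h2
    exact h2

end Propagator

/-! ### Inhomogeneous linear equations: existence with parameters, and uniqueness -/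

section LinearODE

variable {G : Type*} [NormedAddCommGroup G] [NormedSpace ℝ G] [CompleteSpace G]
  {Y : Type*} [NormedAddCommGroup Y] [NormedSpace ℝ Y] [FiniteDimensional ℝ Y]

/-- Near every point, the linear equation `du/dt = B u + c` with smooth coefficients has solutions with
arbitrary smooth initial values, defined on an interval that does not depend on them, and these
solutions are smooth in time and parameters. -/
theorem exists_linear_ode_solution {B : ℝ × Y → G →L[ℝ] G} {c : ℝ × Y → G} {O : Set (ℝ × Y)}
    (hO : IsOpen O) (hB : ContDiffOn ℝ ∞ B O) (hc : ContDiffOn ℝ ∞ c O) {t₀ : ℝ} {y₀ : Y}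
    (h₀ : (t₀, y₀) ∈ O) :
    ∃ δ > 0, Ioo (t₀ - δ) (t₀ + δ) ×ˢ Metric.ball y₀ δ ⊆ O ∧
      ∀ t₁ ∈ Ioo (t₀ - δ) (t₀ + δ), ∀ W ⊆ Metric.ball y₀ δ, ∀ u₁ : Y → G,
        ContDiffOn ℝ ∞ u₁ W → ∃ u : ℝ × Y → G,
          ContDiffOn ℝ ∞ u (Ioo (t₀ - δ) (t₀ + δ) ×ˢ W) ∧ (∀ y ∈ W, u (t₁, y) = u₁ y) ∧
          ∀ t ∈ Ioo (t₀ - δ) (t₀ + δ), ∀ y ∈ W,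
            HasDerivAt (fun t => u (t, y)) (B (t, y) (u (t, y)) + c (t, y)) t := by
  -- An extra scalar component with zero derivative absorbs the inhomogeneity: while it equals `1`,
  -- the first component solves the given equation.
  let B' : ℝ × Y → (G × ℝ) →L[ℝ] (G × ℝ) := fun p =>
    (ContinuousLinearMap.inl ℝ G ℝ).comp ((B p).comp (ContinuousLinearMap.fst ℝ G ℝ) +
      (ContinuousLinearMap.snd ℝ G ℝ).smulRight (c p))
  have hB' : ContDiffOn ℝ ∞ B' O := by
    refine contDiffOn_const.clm_comp ((hB.clm_comp contDiffOn_const).add ?_)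
    exact contDiffOn_const.smulRight hc
  obtain ⟨δ, hδ, hbox, P, hP, hPu, hPd⟩ := exists_propagator hO hB' h₀
  refine ⟨δ, hδ, hbox, fun t₁ ht₁ W hW u₁ hu₁ => ?_⟩
  -- Composing with the inverse of `P` at `t₁` moves the initial time to `t₁` without shrinking the
  -- interval.
  let z : ℝ × Y → G × ℝ := fun p => P p (Ring.inverse (P (t₁, p.2)) (u₁ p.2, 1))
  have hz : ContDiffOn ℝ ∞ z (Ioo (t₀ - δ) (t₀ + δ) ×ˢ W) := by
    refine (hP.mono (prod_mono_right hW)).clm_apply (ContDiffOn.clm_apply ?_ ?_)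
    · intro p hp
      obtain ⟨q, hq⟩ := hPu (t₁, p.2) ⟨ht₁, hW hp.2⟩
      have h1 := contDiffAt_ringInverse (n := ∞) ℝ q
      rw [hq] at h1
      refine h1.comp_contDiffWithinAt (f := fun p : ℝ × Y => P (t₁, p.2)) p ?_
      exact ((hP.comp (f := fun p : ℝ × Y => (t₁, p.2)) (by fun_prop)
        (fun p hp => ⟨ht₁, hW hp.2⟩)) p hp)
    · exact (hu₁.comp contDiffOn_snd fun p hp => hp.2).prodMk contDiffOn_const
  have hzd : ∀ t ∈ Ioo (t₀ - δ) (t₀ + δ), ∀ y ∈ W,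
      HasDerivAt (fun t => z (t, y)) (B' (t, y) (z (t, y))) t := by
    intro t ht y hy
    exact ((hPd t ht y (hW hy)).clm_apply
      (hasDerivAt_const t (Ring.inverse (P (t₁, y)) (u₁ y, (1 : ℝ))))).congr_deriv (by simp [z])
  have hz1 : ∀ y ∈ W, z (t₁, y) = (u₁ y, 1) := by
    intro y hy
    change (P (t₁, y) * Ring.inverse (P (t₁, y))) (u₁ y, 1) = _
    rw [Ring.mul_inverse_cancel _ (hPu (t₁, y) ⟨ht₁, hW hy⟩), one_apply_eq_self]
  have hz2 : ∀ t ∈ Ioo (t₀ - δ) (t₀ + δ), ∀ y ∈ W, (z (t, y)).2 = 1 := by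
    intro t ht y hy
    have hd : ∀ s ∈ Ioo (t₀ - δ) (t₀ + δ), HasDerivAt (fun t => (z (t, y)).2) 0 s := by
      intro s hs
      exact (hasFDerivAt_snd.comp_hasDerivAt s (hzd s hs y hy)).congr_deriv (by simp [B'])
    have := isOpen_Ioo.is_const_of_deriv_eq_zero isPreconnected_Ioo
      (fun s hs => (hd s hs).differentiableAt.differentiableWithinAt)
      (fun s hs => (hd s hs).deriv) ht ht₁
    rw [this, hz1 y hy]
  refine ⟨fun p => (z p).1, hz.fst, fun y hy => congrArg Prod.fst (hz1 y hy), fun t ht y hy => ?_⟩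
  refine (hasFDerivAt_fst.comp_hasDerivAt t (hzd t ht y hy)).congr_deriv ?_
  simp [B', hz2 t ht y hy]

/-- A solution of a homogeneous linear equation that vanishes at one time vanishes. -/
theorem eq_zero_of_linear_ode {B : ℝ → G →L[ℝ] G} {u : ℝ → G} {J : Set ℝ} (hJ : IsOpen J)
    (hJc : IsPreconnected J) (hB : ContinuousOn B J)
    (hu : ∀ t ∈ J, HasDerivAt u (B t (u t)) t) {t₀ : ℝ} (ht₀ : t₀ ∈ J) (h₀ : u t₀ = 0) :
    ∀ t ∈ J, u t = 0 := by
  have hcont : ContinuousOn u J := fun t ht => (hu t ht).continuousAt.continuousWithinAt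
  have hloc : ∀ t ∈ J, u t = 0 → ∀ᶠ s in 𝓝 t, u s = 0 := by
    intro t ht h
    have h1 : ∀ᶠ s in 𝓝 t, ‖B s‖ < ‖B t‖ + 1 :=
      ((hB.continuousAt (hJ.mem_nhds ht)).norm).eventually_lt continuousAt_const (by simp)
    have := ODE_solution_unique_of_eventually (v := fun s x => B s x) (s := fun _ => univ)
      (K := ⟨‖B t‖ + 1, by positivity⟩) (f := u) (g := fun _ => 0) (t₀ := t) ?_ ?_ ?_ h
    · exact this
    · filter_upwards [h1] with s hs
      refine LipschitzWith.lipschitzOnWith ?_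
      refine (B s).lipschitz.weaken ?_
      exact_mod_cast hs.le
    · filter_upwards [hJ.mem_nhds ht] with s hs using ⟨hu s hs, mem_univ _⟩
    · exact .of_forall fun s => ⟨by simpa using hasDerivAt_const s (0 : G), mem_univ _⟩
  -- The times near which `u` vanishes form an open set. A limit of such times in `J` is a zero by
  -- continuity, hence again such a time by local uniqueness, and `J` is connected.
  have hsub : J ⊆ {t | ∀ᶠ s in 𝓝 t, u s = 0} := by
    refine hJc.subset_of_closure_inter_subset isOpen_setOfPred_eventually_nhds
      ⟨t₀, ht₀, hloc t₀ ht₀ h₀⟩ ?_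
    rintro t ⟨ht, htJ⟩
    refine hloc t htJ ?_
    have h2 : (𝓝[{t | ∀ᶠ s in 𝓝 t, u s = 0}] t).NeBot := mem_closure_iff_nhdsWithin_neBot.1 ht
    have h3 : Tendsto u (𝓝[{t | ∀ᶠ s in 𝓝 t, u s = 0}] t) (𝓝 (u t)) :=
      ((hu t htJ).continuousAt).mono_left nhdsWithin_le_nhds
    refine tendsto_nhds_unique h3 (tendsto_const_nhds.congr' ?_)
    filter_upwards [self_mem_nhdsWithin] with s hs using hs.self_of_nhds.symm
  exact fun t ht => (hsub ht).self_of_nhds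

end LinearODE

/-! ### Structure functions and the bracket of sections along a map -/

section LocalModel

variable {E : Type*} [NormedAddCommGroup E] [NormedSpace ℝ E]
  {F : Type*} [NormedAddCommGroup F] [NormedSpace ℝ F]
  {P : Type*} [NormedAddCommGroup P] [NormedSpace ℝ P]
  {G : Type*} [NormedAddCommGroup G] [NormedSpace ℝ G]
  {H : Type*} [NormedAddCommGroup H] [NormedSpace ℝ H]

/-- The structure functions of a Lie algebroid on the trivial bundle `Ω × F` over an open subset of a
vector space: the anchor `ρ` and the bracket `C` of constant sections. -/
structure IsAlgebroidModel (Ω : Set E) (ρ : E → F →L[ℝ] E) (C : E → F →L[ℝ] F →L[ℝ] F) :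
    Prop where
  isOpen : IsOpen Ω
  contDiffOn_anchor : ContDiffOn ℝ ∞ ρ Ω
  contDiffOn_bracket : ContDiffOn ℝ ∞ C Ω
  skew : ∀ x ∈ Ω, ∀ u v, C x u v = -C x v u
  anchor : ∀ x ∈ Ω, ∀ u v,
    ρ x (C x u v) = fderiv ℝ ρ x (ρ x u) v - fderiv ℝ ρ x (ρ x v) u
  jacobi : ∀ x ∈ Ω, ∀ u v w,
    fderiv ℝ C x (ρ x u) v w - fderiv ℝ C x (ρ x v) u w + fderiv ℝ C x (ρ x w) u v
      + C x u (C x v w) - C x (C x u v) w - C x v (C x u w) = 0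

/-- The bracket of two sections along `f` that cover the constant vector fields `v` and `w`. -/
def bracketAlong (C : E → F →L[ℝ] F →L[ℝ] F) (f : P → E) (v : P) (s : P → F) (w : P) (s' : P → F)
    (p : P) : F :=
  fderiv ℝ s' p v - fderiv ℝ s p w + C (f p) (s p) (s' p)

theorem bracketAlong_congr {C : E → F →L[ℝ] F →L[ℝ] F} {f g : P → E} {v w : P}
    {s t s' t' : P → F} {p : P} (hf : f =ᶠ[𝓝 p] g) (hs : s =ᶠ[𝓝 p] t) (hs' : s' =ᶠ[𝓝 p] t') :
    bracketAlong C f v s w s' p = bracketAlong C g v t w t' p := by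
  rw [bracketAlong, bracketAlong, hs.fderiv_eq, hs'.fderiv_eq, hf.self_of_nhds, hs.self_of_nhds,
    hs'.self_of_nhds]

theorem fderiv_clm_comp_apply {κ : E → G →L[ℝ] H} {f : P → E} {s : P → G} {p : P}
    (hκ : DifferentiableAt ℝ κ (f p)) (hf : DifferentiableAt ℝ f p) (hs : DifferentiableAt ℝ s p)
    (v : P) :
    fderiv ℝ (fun q => κ (f q) (s q)) p v =
      fderiv ℝ κ (f p) (fderiv ℝ f p v) (s p) + κ (f p) (fderiv ℝ s p v) := by
  have h1 : HasFDerivAt (fun q => κ (f q)) ((fderiv ℝ κ (f p)).comp (fderiv ℝ f p)) p :=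
    hκ.hasFDerivAt.comp p hf.hasFDerivAt
  rw [(h1.clm_apply hs.hasFDerivAt).fderiv]
  simp [add_comm]

theorem differentiableAt_clm_comp_apply {κ : E → G →L[ℝ] H} {f : P → E} {s : P → G} {p : P}
    (hκ : DifferentiableAt ℝ κ (f p)) (hf : DifferentiableAt ℝ f p)
    (hs : DifferentiableAt ℝ s p) : DifferentiableAt ℝ (fun q => κ (f q) (s q)) p :=
  (hκ.comp p hf).clm_apply hs

theorem differentiableAt_bilin_comp_apply {C : E → F →L[ℝ] F →L[ℝ] F} {f : P → E} {s s' : P → F}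
    {p : P} (hC : DifferentiableAt ℝ C (f p)) (hf : DifferentiableAt ℝ f p)
    (hs : DifferentiableAt ℝ s p) (hs' : DifferentiableAt ℝ s' p) :
    DifferentiableAt ℝ (fun q => C (f q) (s q) (s' q)) p :=
  (differentiableAt_clm_comp_apply hC hf hs).clm_apply hs'

theorem fderiv_bilin_comp_apply {C : E → F →L[ℝ] F →L[ℝ] F} {f : P → E} {s s' : P → F} {p : P}
    (hC : DifferentiableAt ℝ C (f p)) (hf : DifferentiableAt ℝ f p) (hs : DifferentiableAt ℝ s p)
    (hs' : DifferentiableAt ℝ s' p) (v : P) :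
    fderiv ℝ (fun q => C (f q) (s q) (s' q)) p v =
      fderiv ℝ C (f p) (fderiv ℝ f p v) (s p) (s' p) + C (f p) (fderiv ℝ s p v) (s' p)
        + C (f p) (s p) (fderiv ℝ s' p v) := by
  have h1 := differentiableAt_clm_comp_apply hC hf hs
  have h2 := fderiv_clm_comp_apply (κ := fun T : F →L[ℝ] F => T) (s := s')
    differentiableAt_id h1 hs' v
  rw [h2, fderiv_fun_id, ContinuousLinearMap.id_apply, fderiv_clm_comp_apply hC hf hs]
  rfl

theorem fderiv_fderiv_apply_comm {s : P → G} {p : P} (hs : ContDiffAt ℝ ∞ s p) (v w : P) :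
    fderiv ℝ (fun q => fderiv ℝ s q w) p v = fderiv ℝ (fun q => fderiv ℝ s q v) p w := by
  have hd : DifferentiableAt ℝ (fderiv ℝ s) p :=
    (hs.fderiv_right (m := ∞) (by simp)).differentiableAt (by simp)
  have h : ∀ v w : P, fderiv ℝ (fun q => fderiv ℝ s q w) p v = fderiv ℝ (fderiv ℝ s) p v w := by
    intro v w
    rw [(hd.hasFDerivAt.clm_apply (hasFDerivAt_const w p)).fderiv]
    simp
  rw [h, h]
  have := hs.isSymmSndFDerivAt (by
    simpa using (mod_cast le_top : ((2 : ℕ∞) : WithTop ℕ∞) ≤ ∞))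
  exact this v w

theorem differentiableAt_fderiv_apply {s : P → G} {p : P} (hs : ContDiffAt ℝ ∞ s p) (w : P) :
    DifferentiableAt ℝ (fun q => fderiv ℝ s q w) p :=
  ((hs.fderiv_right (m := ∞) (by simp)).differentiableAt (by simp)).clm_apply
    (differentiableAt_const w)

namespace IsAlgebroidModel

variable {Ω : Set E} {ρ : E → F →L[ℝ] E} {C : E → F →L[ℝ] F →L[ℝ] F}

theorem differentiableAt_anchor (h : IsAlgebroidModel Ω ρ C) {x : E} (hx : x ∈ Ω) :
    DifferentiableAt ℝ ρ x :=
  (h.contDiffOn_anchor.contDiffAt (h.isOpen.mem_nhds hx)).differentiableAt (by simp)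

theorem differentiableAt_bracket (h : IsAlgebroidModel Ω ρ C) {x : E} (hx : x ∈ Ω) :
    DifferentiableAt ℝ C x :=
  (h.contDiffOn_bracket.contDiffAt (h.isOpen.mem_nhds hx)).differentiableAt (by simp)

/-- The bracket of two sections that commute with a third one commutes with it. -/
theorem bracketAlong_bracketAlong (h : IsAlgebroidModel Ω ρ C) {f : P → E} {s₀ s s' : P → F}
    {v₀ v w p : P} (hp : f p ∈ Ω) (hf : ContDiffAt ℝ ∞ f p) (hs₀ : ContDiffAt ℝ ∞ s₀ p)
    (hs : ContDiffAt ℝ ∞ s p) (hs' : ContDiffAt ℝ ∞ s' p)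
    (hv₀ : ρ (f p) (s₀ p) = fderiv ℝ f p v₀) (hv : ρ (f p) (s p) = fderiv ℝ f p v)
    (hw : ρ (f p) (s' p) = fderiv ℝ f p w)
    (hb : ∀ᶠ q in 𝓝 p, bracketAlong C f v₀ s₀ v s q = 0)
    (hb' : ∀ᶠ q in 𝓝 p, bracketAlong C f v₀ s₀ w s' q = 0) :
    fderiv ℝ (bracketAlong C f v s w s') p v₀
      + C (f p) (s₀ p) (bracketAlong C f v s w s' p) = 0 := by
  have hC := h.differentiableAt_bracket hp
  have hfd := hf.differentiableAt (by simp)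
  have hsd₀ := hs₀.differentiableAt (by simp)
  have hsd := hs.differentiableAt (by simp)
  have hsd' := hs'.differentiableAt (by simp)
  have hCd : ∀ {s s' : P → F}, DifferentiableAt ℝ s p → DifferentiableAt ℝ s' p →
      DifferentiableAt ℝ (fun q => C (f q) (s q) (s' q)) p := fun h1 h2 =>
    differentiableAt_bilin_comp_apply hC hfd h1 h2
  -- The commutation relation is solved for the derivative along `v₀`. It holds near `p`, so it can
  -- be differentiated once more.
  have e1 : (fun q => fderiv ℝ s q v₀) =ᶠ[𝓝 p]
      fun q => fderiv ℝ s₀ q v - C (f q) (s₀ q) (s q) := by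
    filter_upwards [hb] with q hq
    rw [bracketAlong] at hq
    have := sub_eq_zero.2 hq
    rw [← sub_eq_zero, ← hq]
    abel
  have e2 : (fun q => fderiv ℝ s' q v₀) =ᶠ[𝓝 p]
      fun q => fderiv ℝ s₀ q w - C (f q) (s₀ q) (s' q) := by
    filter_upwards [hb'] with q hq
    rw [bracketAlong] at hq
    have := sub_eq_zero.2 hq
    rw [← sub_eq_zero, ← hq]
    abel
  -- Symmetry of second derivatives moves `v₀` inside, where the commutation relation eliminates it.
  have d1 : fderiv ℝ (fun q => fderiv ℝ s' q v) p v₀ =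
      fderiv ℝ (fun q => fderiv ℝ s₀ q w) p v - (fderiv ℝ C (f p) (fderiv ℝ f p v) (s₀ p) (s' p)
        + C (f p) (fderiv ℝ s₀ p v) (s' p) + C (f p) (s₀ p) (fderiv ℝ s' p v)) := by
    rw [fderiv_fderiv_apply_comm hs', e2.fderiv_eq,
      fderiv_fun_sub (differentiableAt_fderiv_apply hs₀ w) (hCd hsd₀ hsd'), sub_apply,
      fderiv_bilin_comp_apply hC hfd hsd₀ hsd']
  have d2 : fderiv ℝ (fun q => fderiv ℝ s q w) p v₀ =
      fderiv ℝ (fun q => fderiv ℝ s₀ q w) p v - (fderiv ℝ C (f p) (fderiv ℝ f p w) (s₀ p) (s p)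
        + C (f p) (fderiv ℝ s₀ p w) (s p) + C (f p) (s₀ p) (fderiv ℝ s p w)) := by
    rw [fderiv_fderiv_apply_comm hs, e1.fderiv_eq,
      fderiv_fun_sub (differentiableAt_fderiv_apply hs₀ v) (hCd hsd₀ hsd), sub_apply,
      fderiv_bilin_comp_apply hC hfd hsd₀ hsd, fderiv_fderiv_apply_comm hs₀]
  have d3 := fderiv_bilin_comp_apply hC hfd hsd hsd' v₀
  have hS : fderiv ℝ (bracketAlong C f v s w s') p v₀ =
      fderiv ℝ (fun q => fderiv ℝ s' q v) p v₀ - fderiv ℝ (fun q => fderiv ℝ s q w) p v₀ +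
        fderiv ℝ (fun q => C (f q) (s q) (s' q)) p v₀ := by
    have := fderiv_fun_add ((differentiableAt_fderiv_apply hs' v).sub
      (differentiableAt_fderiv_apply hs w)) (hCd hsd hsd')
    have h2 := fderiv_fun_sub (differentiableAt_fderiv_apply hs' v)
      (differentiableAt_fderiv_apply hs w)
    change fderiv ℝ (fun q => fderiv ℝ s' q v - fderiv ℝ s q w + C (f q) (s q) (s' q)) p v₀ = _
    erw [this]
    rw [add_apply]
    erw [h2]
    rw [sub_apply]
  -- The second derivatives of `s₀` cancel. What remains is the Jacobi identity of the structure
  -- functions, in which the lifting conditions turn the anchors into derivatives of `f`.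
  have hj := h.jacobi _ hp (s₀ p) (s p) (s' p)
  rw [hv₀, hv, hw] at hj
  have k1 := h.skew _ hp (fderiv ℝ s₀ p w) (s p)
  have e1' : fderiv ℝ s p v₀ = fderiv ℝ s₀ p v - C (f p) (s₀ p) (s p) := e1.self_of_nhds
  have e2' : fderiv ℝ s' p v₀ = fderiv ℝ s₀ p w - C (f p) (s₀ p) (s' p) := e2.self_of_nhds
  rw [hS, d1, d2, d3, e1', e2', bracketAlong, ← hj, k1]
  simp only [map_add, map_sub, sub_apply]
  abel

end IsAlgebroidModel

/-- The bracket along a map is covariant under changes of coordinates and frames. -/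
theorem bracketAlong_frameChange {ρ : E → F →L[ℝ] E} {C C' : E → F →L[ℝ] F →L[ℝ] F}
    {g : E → F →L[ℝ] F} {f f' : P → E} {s s' t t' : P → F} {v w p : P}
    (hg : DifferentiableAt ℝ g (f p)) (hf : DifferentiableAt ℝ f p)
    (hs : DifferentiableAt ℝ s p) (hs' : DifferentiableAt ℝ s' p)
    (hv : ρ (f p) (s p) = fderiv ℝ f p v) (hw : ρ (f p) (s' p) = fderiv ℝ f p w)
    (ht : ∀ᶠ q in 𝓝 p, t q = g (f q) (s q)) (ht' : ∀ᶠ q in 𝓝 p, t' q = g (f q) (s' q))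
    (hC : ∀ u u', C' (f' p) (g (f p) u) (g (f p) u') = g (f p) (C (f p) u u')
      - fderiv ℝ g (f p) (ρ (f p) u) u' + fderiv ℝ g (f p) (ρ (f p) u') u) :
    bracketAlong C' f' v t w t' p = g (f p) (bracketAlong C f v s w s' p) := by
  -- The derivatives of `g` produced by the product rule are taken along the anchors of `s` and
  -- `s'`, by `hv` and `hw`, and cancel against the inhomogeneous terms of `hC`.
  rw [bracketAlong, bracketAlong, EventuallyEq.fderiv_eq ht, EventuallyEq.fderiv_eq ht',
    fderiv_clm_comp_apply hg hf hs', fderiv_clm_comp_apply hg hf hs, ht.self_of_nhds,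
    ht'.self_of_nhds, hC, hv, hw, map_add, map_sub]
  abel

end LocalModel

/-! ### Derivatives of functions on a manifold in a chart -/

section ChartCalculus

variable {E : Type*} [NormedAddCommGroup E] [NormedSpace ℝ E]
  {M : Type*} [TopologicalSpace M] [ChartedSpace E M] [IsManifold 𝓘(ℝ, E) ∞ M]
  {G : Type*} [NormedAddCommGroup G] [NormedSpace ℝ G]

theorem contMDiffAt_extChartAt_symm {x₀ : M} {y : E} (hy : y ∈ (extChartAt 𝓘(ℝ, E) x₀).target) :
    ContMDiffAt 𝓘(ℝ, E) 𝓘(ℝ, E) ∞ (extChartAt 𝓘(ℝ, E) x₀).symm y :=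
  (contMDiffOn_extChartAt_symm x₀).contMDiffAt ((isOpen_extChartAt_target x₀).mem_nhds hy)

theorem eventually_extChartAt_left_inv {x₀ x : M} (hx : x ∈ (chartAt E x₀).source) :
    ∀ᶠ y in 𝓝 x, (extChartAt 𝓘(ℝ, E) x₀).symm (extChartAt 𝓘(ℝ, E) x₀ y) = y := by
  filter_upwards [(chartAt E x₀).open_source.mem_nhds hx] with y hy
  exact (extChartAt 𝓘(ℝ, E) x₀).left_inv (by simpa using hy)

theorem ContMDiffAt.contDiffAt_comp_extChartAt_symm {x₀ x : M} {h : M → G}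
    (hx : x ∈ (chartAt E x₀).source) (hh : ContMDiffAt 𝓘(ℝ, E) 𝓘(ℝ, G) ∞ h x) :
    ContDiffAt ℝ ∞ (fun y => h ((extChartAt 𝓘(ℝ, E) x₀).symm y)) (extChartAt 𝓘(ℝ, E) x₀ x) := by
  have hs : x ∈ (extChartAt 𝓘(ℝ, E) x₀).source := by simpa using hx
  have h1 := contMDiffAt_extChartAt_symm ((extChartAt 𝓘(ℝ, E) x₀).map_source hs)
  rw [← contMDiffAt_iff_contDiffAt]
  refine ContMDiffAt.comp _ ?_ h1
  rwa [(extChartAt 𝓘(ℝ, E) x₀).left_inv hs]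

variable (E) in
/-- The derivative at `x` of the preferred chart at `x₀`. -/
def chartDeriv (x₀ x : M) : TangentSpace 𝓘(ℝ, E) x →L[ℝ] E :=
  mfderiv 𝓘(ℝ, E) 𝓘(ℝ, E) (extChartAt 𝓘(ℝ, E) x₀) x

theorem fderiv_clm_apply_const {H : Type*} [NormedAddCommGroup H] [NormedSpace ℝ H]
    {κ : E → G →L[ℝ] H} {y : E} (hκ : DifferentiableAt ℝ κ y) (u : G) (e : E) :
    fderiv ℝ (fun z => κ z u) y e = fderiv ℝ κ y e u := by
  rw [HasFDerivAt.fderiv (hκ.hasFDerivAt.clm_apply (hasFDerivAt_const u y))]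
  simp

/-- A family of linear maps on a finite-dimensional space is smooth if all its applications are. -/
theorem contDiffAt_clm_of_apply {H : Type*} [NormedAddCommGroup H] [NormedSpace ℝ H]
    [FiniteDimensional ℝ G] {κ : E → G →L[ℝ] H} {y : E}
    (h : ∀ u, ContDiffAt ℝ ∞ (fun z => κ z u) y) : ContDiffAt ℝ ∞ κ y := by
  have hd : Module.finrank ℝ G = Module.finrank ℝ (Fin (Module.finrank ℝ G) → ℝ) := by simp
  let e₁ := ContinuousLinearEquiv.ofFinrankEq hd
  let e₂ := (e₁.arrowCongr (1 : H ≃L[ℝ] H)).trans (ContinuousLinearEquiv.piRing _)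
  rw [← Function.id_comp κ, ← e₂.symm_comp_self]
  exact e₂.symm.contDiff.contDiffAt.comp y (contDiffAt_pi.mpr fun i => h _)

/-- The derivative of a function on a manifold, computed in a chart. -/
theorem mvfderiv_eq_fderiv_chart {x₀ x : M} {h : M → G} (hx : x ∈ (chartAt E x₀).source)
    (hh : ContMDiffAt 𝓘(ℝ, E) 𝓘(ℝ, G) ∞ h x) (v : TangentSpace 𝓘(ℝ, E) x) :
    mvfderiv 𝓘(ℝ, E) h x v =
      fderiv ℝ (fun y => h ((extChartAt 𝓘(ℝ, E) x₀).symm y)) (extChartAt 𝓘(ℝ, E) x₀ x)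
        (chartDeriv E x₀ x v) := by
  have h1 := (hh.contDiffAt_comp_extChartAt_symm hx).differentiableAt (by simp)
  have h2 := mfderiv_comp x h1.mdifferentiableAt (mdifferentiableAt_extChartAt (I := 𝓘(ℝ, E)) hx)
  rw [mfderiv_eq_fderiv] at h2
  have h3 : ((fun y => h ((extChartAt 𝓘(ℝ, E) x₀).symm y)) ∘ extChartAt 𝓘(ℝ, E) x₀) =ᶠ[𝓝 x] h := by
    filter_upwards [eventually_extChartAt_left_inv hx] with y hy
    rw [Function.comp_apply, hy]
  change mfderiv 𝓘(ℝ, E) 𝓘(ℝ, G) h x v = _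
  rw [← h3.mfderiv_eq, h2]
  rfl

end ChartCalculus

namespace LieAlgebroid

/-! ### Local frames and the bracket with a section vanishing at a point -/

section Frames

variable {E : Type*} [NormedAddCommGroup E] [NormedSpace ℝ E] [FiniteDimensional ℝ E]
  {M : Type*} [TopologicalSpace M] [T2Space M] [ChartedSpace E M] [IsManifold 𝓘(ℝ, E) ∞ M]
  {F : Type*} [NormedAddCommGroup F] [NormedSpace ℝ F] [FiniteDimensional ℝ F]
  {A : M → Type*} [TopologicalSpace (TotalSpace F A)]
  [∀ x, AddCommGroup (A x)] [∀ x, Module ℝ (A x)] [∀ x, TopologicalSpace (A x)]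
  [FiberBundle F A] [VectorBundle ℝ F A] [ContMDiffVectorBundle ∞ F A 𝓘(ℝ, E)]

variable (F A) in
/-- The coordinates of vectors of `A` in the preferred frame at `x₀`. -/
abbrev coordAt (x₀ x : M) : A x →L[ℝ] F := (trivializationAt F A x₀).continuousLinearMapAt ℝ x

variable (F A) in
/-- The vector of `A` with given coordinates in the preferred frame at `x₀`. -/
abbrev frameAt (x₀ x : M) : F →L[ℝ] A x := (trivializationAt F A x₀).symmL ℝ x

variable (E F A) in
/-- The common domain of the preferred chart and the preferred frame at `x₀`. -/
def frameSource (x₀ : M) : Set M := (chartAt E x₀).source ∩ (trivializationAt F A x₀).baseSet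

variable (E F A) in
/-- The image of `frameSource` in the chart. -/
def frameDomain (x₀ : M) : Set E :=
  (extChartAt 𝓘(ℝ, E) x₀).target ∩ (extChartAt 𝓘(ℝ, E) x₀).symm ⁻¹' (trivializationAt F A x₀).baseSet

theorem isOpen_frameSource (x₀ : M) : IsOpen (frameSource E F A x₀) :=
  (chartAt E x₀).open_source.inter (trivializationAt F A x₀).open_baseSet

theorem mem_frameSource (x₀ : M) : x₀ ∈ frameSource E F A x₀ :=
  ⟨mem_chart_source E x₀, FiberBundle.mem_baseSet_trivializationAt F A x₀⟩

theorem isOpen_frameDomain (x₀ : M) : IsOpen (frameDomain E F A x₀) :=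
  (continuousOn_extChartAt_symm (I := 𝓘(ℝ, E)) x₀).isOpen_inter_preimage
    (isOpen_extChartAt_target x₀) (trivializationAt F A x₀).open_baseSet

theorem left_inv_of_mem_frameSource {x₀ x : M} (hx : x ∈ frameSource E F A x₀) :
    (extChartAt 𝓘(ℝ, E) x₀).symm (extChartAt 𝓘(ℝ, E) x₀ x) = x :=
  (extChartAt 𝓘(ℝ, E) x₀).left_inv (by simpa using hx.1)

theorem map_mem_frameDomain {x₀ x : M} (hx : x ∈ frameSource E F A x₀) :
    extChartAt 𝓘(ℝ, E) x₀ x ∈ frameDomain E F A x₀ :=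
  ⟨(extChartAt 𝓘(ℝ, E) x₀).map_source (by simpa using hx.1), by
    rw [mem_preimage, left_inv_of_mem_frameSource hx]
    exact hx.2⟩

theorem map_symm_mem_frameSource {x₀ : M} {y : E} (hy : y ∈ frameDomain E F A x₀) :
    (extChartAt 𝓘(ℝ, E) x₀).symm y ∈ frameSource E F A x₀ :=
  ⟨by simpa using (extChartAt 𝓘(ℝ, E) x₀).map_target hy.1, hy.2⟩

theorem coordAt_apply {x₀ x : M} (hx : x ∈ (trivializationAt F A x₀).baseSet) (v : A x) :
    coordAt F A x₀ x v = (trivializationAt F A x₀ ⟨x, v⟩).2 :=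
  (trivializationAt F A x₀).continuousLinearMapAt_apply_of_mem ℝ hx v

theorem coordAt_frameAt {x₀ x : M} (hx : x ∈ (trivializationAt F A x₀).baseSet) (u : F) :
    coordAt F A x₀ x (frameAt F A x₀ x u) = u :=
  (trivializationAt F A x₀).continuousLinearMapAt_symmL hx u

theorem frameAt_coordAt {x₀ x : M} (hx : x ∈ (trivializationAt F A x₀).baseSet) (v : A x) :
    frameAt F A x₀ x (coordAt F A x₀ x v) = v :=
  (trivializationAt F A x₀).symmL_continuousLinearMapAt hx v

/-- Smoothness of a section along an arbitrary map can be tested in any frame defined at the point,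
not only in the preferred one. This allows all later smoothness proofs to keep `x₀` fixed. -/
theorem contMDiffAt_iff_coordAt {P : Type*} [NormedAddCommGroup P] [NormedSpace ℝ P]
    {HP : Type*} [TopologicalSpace HP] {J : ModelWithCorners ℝ P HP} {N : Type*}
    [TopologicalSpace N] [ChartedSpace HP N] {f : N → M} {s : ∀ p, A (f p)} {p : N} {x₀ : M}
    (hp : f p ∈ (trivializationAt F A x₀).baseSet) :
    ContMDiffAt J (𝓘(ℝ, E).prod 𝓘(ℝ, F)) ∞ (fun q => (⟨f q, s q⟩ : TotalSpace F A)) p ↔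
      ContMDiffAt J 𝓘(ℝ, E) ∞ f p ∧
        ContMDiffAt J 𝓘(ℝ, F) ∞ (fun q => coordAt F A x₀ (f q) (s q)) p := by
  rw [(trivializationAt F A x₀).contMDiffAt_iff (by simpa [Trivialization.mem_source] using hp)]
  refine and_congr_right fun hf => ?_
  have : ∀ᶠ q in 𝓝 p, coordAt F A x₀ (f q) (s q) = (trivializationAt F A x₀ ⟨f q, s q⟩).2 := by
    filter_upwards [hf.continuousAt.preimage_mem_nhds
      ((trivializationAt F A x₀).open_baseSet.mem_nhds hp)] with q hq using coordAt_apply hq _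
  exact ⟨fun h => h.congr_of_eventuallyEq this,
    fun h => h.congr_of_eventuallyEq (this.mono fun _ h => h.symm)⟩

theorem contMDiffAt_coordAt {x₀ x : M} (hx : x ∈ (trivializationAt F A x₀).baseSet)
    (σ : Cₛ^∞⟮𝓘(ℝ, E); F, A⟯) :
    ContMDiffAt 𝓘(ℝ, E) 𝓘(ℝ, F) ∞ (fun y => coordAt F A x₀ y (σ y)) x :=
  ((contMDiffAt_iff_coordAt (f := fun y => y) hx).1 (σ.contMDiff x)).2

theorem exists_constant_section {x₀ x : M} (hx : x ∈ frameSource E F A x₀) (u : F) :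
    ∃ σ : Cₛ^∞⟮𝓘(ℝ, E); F, A⟯, ∀ᶠ y in 𝓝 x, σ y = frameAt F A x₀ y u := by
  refine exists_section_eventuallyEq (trivializationAt F A x₀).open_baseSet hx.2 fun y hy => ?_
  refine ((contMDiffAt_iff_coordAt (f := fun y => y) hy).2
    ⟨contMDiffAt_id, ?_⟩).contMDiffWithinAt
  refine (contMDiffAt_const (c := u)).congr_of_eventuallyEq ?_
  filter_upwards [(trivializationAt F A x₀).open_baseSet.mem_nhds hy] with z hz
  exact coordAt_frameAt hz u

variable (E) in
open Classical in
/-- A section of `A` that is constant near `x` in the preferred frame at `x₀`. -/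
def constSection (x₀ x : M) (u : F) : Cₛ^∞⟮𝓘(ℝ, E); F, A⟯ :=
  if hx : x ∈ frameSource E F A x₀ then (exists_constant_section hx u).choose else 0

theorem constSection_eventuallyEq {x₀ x : M} (hx : x ∈ frameSource E F A x₀) (u : F) :
    ∀ᶠ y in 𝓝 x, constSection E x₀ x u y = frameAt F A x₀ y u := by
  rw [constSection, dif_pos hx]
  exact (exists_constant_section hx u).choose_spec

theorem coordAt_constSection_eventuallyEq {x₀ x : M} (hx : x ∈ frameSource E F A x₀) (u : F) :
    ∀ᶠ y in 𝓝 x, coordAt F A x₀ y (constSection E x₀ x u y) = u := by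
  filter_upwards [constSection_eventuallyEq hx u,
    (trivializationAt F A x₀).open_baseSet.mem_nhds hx.2] with y hy hy'
  rw [hy, coordAt_frameAt hy']

variable (L : LieAlgebroid E F A)

/-- The bracket with a section that vanishes at a point is given by its derivative. -/
theorem coordAt_bracket_of_eq_zero {x₀ x : M} (hx : x ∈ frameSource E F A x₀)
    (σ : Cₛ^∞⟮𝓘(ℝ, E); F, A⟯) {τ : Cₛ^∞⟮𝓘(ℝ, E); F, A⟯} (hτ : τ x = 0) :
    coordAt F A x₀ x (L.bracket σ τ x) =
      mvfderiv 𝓘(ℝ, E) (fun y => coordAt F A x₀ y (τ y)) x (L.anchor x (σ x)) := by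
  let t := trivializationAt F A x₀
  have x_mem : x ∈ t.baseSet := hx.2
  let b := Module.finBasis ℝ F
  have hc : ∀ i, ∃ f : C^∞⟮𝓘(ℝ, E), M; ℝ⟯,
      ∀ᶠ y in 𝓝 x, f y = b.coord i (coordAt F A x₀ y (τ y)) := fun i => by
    refine exists_function_eventuallyEq (E := E) t.open_baseSet x_mem fun y hy => ?_
    exact (((b.coord i).toContinuousLinearMap.contMDiff.contMDiffAt).comp y
      (contMDiffAt_coordAt hy τ)).contMDiffWithinAt
  choose f hf using hc
  have hsum : ∀ᶠ y in 𝓝 x, coordAt F A x₀ y (τ y) = ∑ i, f i y • b i := by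
    filter_upwards [eventually_all.2 hf] with y hy
    simp only [hy]
    exact (b.sum_repr _).symm
  have key : ∀ᶠ y in 𝓝 x,
      τ y = (∑ i, ContMDiffSection.funSMul (f i) (constSection E x₀ x (b i) :
        Cₛ^∞⟮𝓘(ℝ, E); F, A⟯)) y := by
    filter_upwards [hsum, eventually_all.2 fun i =>
      constSection_eventuallyEq (E := E) (F := F) (A := A) hx (b i),
      t.open_baseSet.mem_nhds x_mem] with y h1 h2 h3
    rw [ContMDiffSection.sum_apply, ← frameAt_coordAt h3 (τ y), h1, map_sum]
    refine Finset.sum_congr rfl fun i _ => ?_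
    change _ = f i y • (constSection E x₀ x (b i) : Cₛ^∞⟮𝓘(ℝ, E); F, A⟯) y
    rw [h2 i, map_smul]
  -- The frame coefficients of `τ` vanish at `x`, so the Leibniz rule leaves only their derivatives
  -- along the anchor.
  have hf0 : ∀ i, f i x = 0 := fun i => by
    rw [(hf i).self_of_nhds, hτ, map_zero, map_zero]
  rw [L.bracket_congr (.of_forall fun _ => rfl) key, map_sum, ContMDiffSection.sum_apply, map_sum]
  have h1 : ∀ i, coordAt F A x₀ x (L.bracket σ
      (ContMDiffSection.funSMul (f i) (constSection E x₀ x (b i))) x) =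
      mvfderiv 𝓘(ℝ, E) (f i) x (L.anchor x (σ x)) • b i := fun i => by
    rw [L.leibniz, hf0, zero_smul, zero_add, map_smul,
      (coordAt_constSection_eventuallyEq hx (b i)).self_of_nhds]
  simp only [h1]
  have hd : HasMFDerivAt 𝓘(ℝ, E) 𝓘(ℝ, F) (fun y => ∑ i, f i y • b i) x
      (∑ i, ((mvfderiv 𝓘(ℝ, E) (f i) x).smulRight (b i))) := by
    have h2 : ∀ i, HasMFDerivAt 𝓘(ℝ, E) 𝓘(ℝ, F) (fun y => f i y • b i) x
        ((mvfderiv 𝓘(ℝ, E) (f i) x).smulRight (b i)) := fun i => by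
      have h3 := ((ContinuousLinearMap.id ℝ ℝ).smulRight (b i)).hasMFDerivAt (x := f i x)
      exact h3.comp x ((f i).mdifferentiableAt (x := x)).hasMFDerivAt
    have h3 : (fun y => ∑ i, f i y • b i) = ∑ i, fun y => f i y • b i := by
      funext y
      simp
    rw [h3]
    exact HasMFDerivAt.sum (t := Finset.univ) (f := fun i y => f i y • b i)
      (f' := fun i => (mvfderiv 𝓘(ℝ, E) (f i) x).smulRight (b i)) (fun i _ => h2 i)
  have h4 : mvfderiv 𝓘(ℝ, E) (fun y => coordAt F A x₀ y (τ y)) x =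
      ∑ i, ((mvfderiv 𝓘(ℝ, E) (f i) x).smulRight (b i)) :=
    (EventuallyEq.mfderiv_eq hsum).trans hd.mfderiv
  rw [h4]
  simp

end Frames

end LieAlgebroid

namespace LieAlgebroid

/-! ### Structure functions of a Lie algebroid in a chart and a frame -/

section Representatives

variable {E : Type*} [NormedAddCommGroup E] [NormedSpace ℝ E] [FiniteDimensional ℝ E]
  {M : Type*} [TopologicalSpace M] [T2Space M] [ChartedSpace E M] [IsManifold 𝓘(ℝ, E) ∞ M]
  {F : Type*} [NormedAddCommGroup F] [NormedSpace ℝ F] [FiniteDimensional ℝ F]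
  {A : M → Type*} [TopologicalSpace (TotalSpace F A)]
  [∀ x, AddCommGroup (A x)] [∀ x, Module ℝ (A x)] [∀ x, TopologicalSpace (A x)]
  [FiberBundle F A] [VectorBundle ℝ F A] [ContMDiffVectorBundle ∞ F A 𝓘(ℝ, E)]

/-- The representative of a section in the preferred chart and frame at `x₀`. -/
def sectionRep (x₀ : M) (σ : Cₛ^∞⟮𝓘(ℝ, E); F, A⟯) (y : E) : F :=
  coordAt F A x₀ ((extChartAt 𝓘(ℝ, E) x₀).symm y) (σ ((extChartAt 𝓘(ℝ, E) x₀).symm y))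

theorem sectionRep_apply {x₀ x : M} (hx : x ∈ frameSource E F A x₀)
    (σ : Cₛ^∞⟮𝓘(ℝ, E); F, A⟯) :
    sectionRep x₀ σ (extChartAt 𝓘(ℝ, E) x₀ x) = coordAt F A x₀ x (σ x) := by
  rw [sectionRep, left_inv_of_mem_frameSource hx]

theorem contDiffOn_sectionRep (x₀ : M) (σ : Cₛ^∞⟮𝓘(ℝ, E); F, A⟯) :
    ContDiffOn ℝ ∞ (sectionRep x₀ σ) (frameDomain E F A x₀) := fun y hy => by
  have h := (contMDiffAt_coordAt (map_symm_mem_frameSource hy).2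
    σ).contDiffAt_comp_extChartAt_symm (map_symm_mem_frameSource hy).1
  rw [(extChartAt 𝓘(ℝ, E) x₀).right_inv hy.1] at h
  exact h.contDiffWithinAt

theorem eventually_symm_of_eventually {x₀ x : M} (hx : x ∈ frameSource E F A x₀) {p : M → Prop}
    (h : ∀ᶠ z in 𝓝 x, p z) :
    ∀ᶠ y in 𝓝 (extChartAt 𝓘(ℝ, E) x₀ x), p ((extChartAt 𝓘(ℝ, E) x₀).symm y) := by
  have h1 := (contMDiffAt_extChartAt_symm (map_mem_frameDomain hx).1).continuousAt
  refine h1.eventually ?_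
  rwa [left_inv_of_mem_frameSource hx]

theorem sectionRep_constSection_eventuallyEq {x₀ x : M} (hx : x ∈ frameSource E F A x₀) (u : F) :
    sectionRep x₀ (constSection E x₀ x u : Cₛ^∞⟮𝓘(ℝ, E); F, A⟯)
      =ᶠ[𝓝 (extChartAt 𝓘(ℝ, E) x₀ x)] fun _ => u :=
  eventually_symm_of_eventually hx (coordAt_constSection_eventuallyEq hx u)

theorem mvfderiv_coordAt {x₀ x : M} (hx : x ∈ frameSource E F A x₀) (σ : Cₛ^∞⟮𝓘(ℝ, E); F, A⟯)
    (v : TangentSpace 𝓘(ℝ, E) x) :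
    mvfderiv 𝓘(ℝ, E) (fun y => coordAt F A x₀ y (σ y)) x v =
      fderiv ℝ (sectionRep x₀ σ) (extChartAt 𝓘(ℝ, E) x₀ x)
        (chartDeriv E x₀ x v) :=
  mvfderiv_eq_fderiv_chart hx.1 (contMDiffAt_coordAt hx.2 σ) v

theorem mvfderiv_coordAt_constSection {x₀ x : M} (hx : x ∈ frameSource E F A x₀) (u : F) :
    mvfderiv 𝓘(ℝ, E) (fun y => coordAt F A x₀ y
      ((constSection E x₀ x u : Cₛ^∞⟮𝓘(ℝ, E); F, A⟯) y)) x = 0 := by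
  have h := coordAt_constSection_eventuallyEq (E := E) (F := F) (A := A) hx u
  exact (EventuallyEq.mfderiv_eq h).trans mfderiv_const

/-- The global sections come from a choice, so they depend linearly on the vector only as germs at
`x`. Since the bracket is local, this is enough to make `bracketRep` bilinear. -/
theorem constSection_add {x₀ x : M} (hx : x ∈ frameSource E F A x₀) (u v : F) :
    ∀ᶠ y in 𝓝 x, (constSection E x₀ x (u + v) : Cₛ^∞⟮𝓘(ℝ, E); F, A⟯) y =
      (constSection E x₀ x u + constSection E x₀ x v : Cₛ^∞⟮𝓘(ℝ, E); F, A⟯) y := by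
  filter_upwards [constSection_eventuallyEq (E := E) (F := F) (A := A) hx u,
    constSection_eventuallyEq (E := E) (F := F) (A := A) hx v,
    constSection_eventuallyEq (E := E) (F := F) (A := A) hx (u + v)] with y h1 h2 h3
  rw [h3, ContMDiffSection.coe_add, Pi.add_apply, h1, h2, map_add]

theorem constSection_smul {x₀ x : M} (hx : x ∈ frameSource E F A x₀) (c : ℝ) (u : F) :
    ∀ᶠ y in 𝓝 x, (constSection E x₀ x (c • u) : Cₛ^∞⟮𝓘(ℝ, E); F, A⟯) y =
      (c • constSection E x₀ x u : Cₛ^∞⟮𝓘(ℝ, E); F, A⟯) y := by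
  filter_upwards [constSection_eventuallyEq (E := E) (F := F) (A := A) hx u,
    constSection_eventuallyEq (E := E) (F := F) (A := A) hx (c • u)] with y h1 h3
  rw [h3, ContMDiffSection.coe_smul, Pi.smul_apply, h1, map_smul]

variable (L : LieAlgebroid E F A)

/-- The anchor in the preferred chart and frame at `x₀`. -/
def anchorRep (x₀ : M) (y : E) : F →L[ℝ] E :=
  (chartDeriv E x₀ ((extChartAt 𝓘(ℝ, E) x₀).symm y)).comp
    ((L.anchor ((extChartAt 𝓘(ℝ, E) x₀).symm y)).comp
      (frameAt F A x₀ ((extChartAt 𝓘(ℝ, E) x₀).symm y)))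

theorem anchorRep_apply {x₀ x : M} (hx : x ∈ frameSource E F A x₀) (u : F) :
    L.anchorRep x₀ (extChartAt 𝓘(ℝ, E) x₀ x) u =
      chartDeriv E x₀ x (L.anchor x (frameAt F A x₀ x u)) := by
  rw [anchorRep, left_inv_of_mem_frameSource hx]
  rfl

theorem anchorRep_coordAt {x₀ x : M} (hx : x ∈ frameSource E F A x₀) (v : A x) :
    L.anchorRep x₀ (extChartAt 𝓘(ℝ, E) x₀ x) (coordAt F A x₀ x v) =
      chartDeriv E x₀ x (L.anchor x v) := by
  rw [L.anchorRep_apply hx, frameAt_coordAt hx.2]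

theorem contDiffOn_anchorRep (x₀ : M) :
    ContDiffOn ℝ ∞ (L.anchorRep x₀) (frameDomain E F A x₀) := by
  rw [contDiffOn_clm_apply]
  intro u y hy
  refine ContDiffAt.contDiffWithinAt ?_
  rw [← contMDiffAt_iff_contDiffAt]
  have hs := map_symm_mem_frameSource hy
  have h0 := contMDiffAt_extChartAt_symm hy.1
  have h1 : ContMDiffAt 𝓘(ℝ, E) (𝓘(ℝ, E).prod 𝓘(ℝ, F)) ∞
      (fun z => (⟨(extChartAt 𝓘(ℝ, E) x₀).symm z,
        frameAt F A x₀ ((extChartAt 𝓘(ℝ, E) x₀).symm z) u⟩ : TotalSpace F A)) y := by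
    refine (contMDiffAt_iff_coordAt hs.2).2 ⟨h0, ?_⟩
    refine (contMDiffAt_const (c := u)).congr_of_eventuallyEq ?_
    filter_upwards [h0.continuousAt.preimage_mem_nhds
      ((trivializationAt F A x₀).open_baseSet.mem_nhds hs.2)] with z hz
    exact coordAt_frameAt hz u
  have h2 := (L.contMDiff_anchor _).comp y h1
  have h3 := ((contMDiffAt_iff_coordAt (F := E) (A := (TangentSpace 𝓘(ℝ, E) : M → Type _))
    (x₀ := x₀) (by simpa using hs.1)).1 h2).2
  refine h3.congr_of_eventuallyEq ?_
  filter_upwards [h0.continuousAt.preimage_mem_nhds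
      ((chartAt E x₀).open_source.mem_nhds hs.1)] with z hz
  rw [coordAt, TangentBundle.continuousLinearMapAt_trivializationAt hz]
  rfl

open Classical in
/-- The bracket of constant sections in the preferred chart and frame at `x₀`. -/
def bracketRep (x₀ : M) (y : E) : F →L[ℝ] F →L[ℝ] F :=
  if hy : y ∈ frameDomain E F A x₀ then
    (LinearMap.mk₂ ℝ (fun u v : F => coordAt F A x₀ ((extChartAt 𝓘(ℝ, E) x₀).symm y)
      (L.bracket (constSection E x₀ ((extChartAt 𝓘(ℝ, E) x₀).symm y) u)
        (constSection E x₀ ((extChartAt 𝓘(ℝ, E) x₀).symm y) v)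
        ((extChartAt 𝓘(ℝ, E) x₀).symm y)))
      (fun u u' v => by
        rw [L.bracket_congr (constSection_add (map_symm_mem_frameSource hy) u u')
          (.of_forall fun _ => rfl), map_add, LinearMap.add_apply, ContMDiffSection.coe_add,
          Pi.add_apply, map_add])
      (fun c u v => by
        rw [L.bracket_congr (constSection_smul (map_symm_mem_frameSource hy) c u)
          (.of_forall fun _ => rfl), map_smul, LinearMap.smul_apply, ContMDiffSection.coe_smul,
          Pi.smul_apply, map_smul])
      (fun u v v' => by
        rw [L.bracket_congr (.of_forall fun _ => rfl)
          (constSection_add (map_symm_mem_frameSource hy) v v'), map_add,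
          ContMDiffSection.coe_add, Pi.add_apply, map_add])
      (fun c u v => by
        rw [L.bracket_congr (.of_forall fun _ => rfl)
          (constSection_smul (map_symm_mem_frameSource hy) c v), map_smul,
          ContMDiffSection.coe_smul, Pi.smul_apply, map_smul])).toContinuousBilinearMap
  else 0

theorem bracketRep_apply {x₀ x : M} (hx : x ∈ frameSource E F A x₀) (u v : F) :
    L.bracketRep x₀ (extChartAt 𝓘(ℝ, E) x₀ x) u v =
      coordAt F A x₀ x (L.bracket (constSection E x₀ x u) (constSection E x₀ x v) x) := by
  rw [bracketRep, dif_pos (map_mem_frameDomain hx), LinearMap.toContinuousBilinearMap_apply,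
    LinearMap.mk₂_apply, left_inv_of_mem_frameSource hx]

/-- The bracket of sections in terms of the bracket of constant sections. -/
theorem coordAt_bracket {x₀ x : M} (hx : x ∈ frameSource E F A x₀)
    (σ τ : Cₛ^∞⟮𝓘(ℝ, E); F, A⟯) :
    coordAt F A x₀ x (L.bracket σ τ x) =
      mvfderiv 𝓘(ℝ, E) (fun y => coordAt F A x₀ y (τ y)) x (L.anchor x (σ x)) -
        mvfderiv 𝓘(ℝ, E) (fun y => coordAt F A x₀ y (σ y)) x (L.anchor x (τ x)) +
        L.bracketRep x₀ (extChartAt 𝓘(ℝ, E) x₀ x) (coordAt F A x₀ x (σ x))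
          (coordAt F A x₀ x (τ x)) := by
  let c : Cₛ^∞⟮𝓘(ℝ, E); F, A⟯ → Cₛ^∞⟮𝓘(ℝ, E); F, A⟯ := fun σ =>
    constSection E x₀ x (coordAt F A x₀ x (σ x))
  have hc : ∀ σ, c σ x = σ x := fun σ => by
    rw [(constSection_eventuallyEq hx _).self_of_nhds, frameAt_coordAt hx.2]
  have hd : ∀ σ v, mvfderiv 𝓘(ℝ, E) (fun y => coordAt F A x₀ y ((σ - c σ) y)) x v =
      mvfderiv 𝓘(ℝ, E) (fun y => coordAt F A x₀ y (σ y)) x v := fun σ v => by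
    have h1 := mvfderiv_sub (I := 𝓘(ℝ, E)) (x := x)
      ((contMDiffAt_coordAt hx.2 σ).mdifferentiableAt (by simp))
      ((contMDiffAt_coordAt hx.2 (c σ)).mdifferentiableAt (by simp))
    rw [mvfderiv_coordAt_constSection hx, sub_zero] at h1
    rw [← h1]
    congr 1
    refine congrArg (fun f => mvfderiv 𝓘(ℝ, E) f x) ?_
    funext y
    simp
  have h1 := L.coordAt_bracket_of_eq_zero hx σ (τ := τ - c τ) (by simp [hc])
  have h2 := L.coordAt_bracket_of_eq_zero hx (c τ) (τ := σ - c σ) (by simp [hc])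
  rw [hd] at h1 h2
  rw [hc] at h2
  rw [L.bracketRep_apply hx, ← h1, ← h2, ← map_sub, ← map_add]
  congr 1
  -- Each section is split into a constant one and one that vanishes at `x`. The brackets with the
  -- vanishing parts give the derivative terms, and the constant parts give `bracketRep`.
  have h3 : L.bracket σ τ = L.bracket σ (τ - c τ) - L.bracket (c τ) (σ - c σ)
      + L.bracket (c σ) (c τ) := by
    rw [map_sub, map_sub, L.bracket_skew (c τ) σ, L.bracket_skew (c τ) (c σ)]
    abel
  rw [h3]
  rfl

/-- The bracket of sections in the preferred chart and frame at `x₀`. -/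
theorem sectionRep_bracket {x₀ : M} {y : E} (hy : y ∈ frameDomain E F A x₀)
    (σ τ : Cₛ^∞⟮𝓘(ℝ, E); F, A⟯) :
    sectionRep x₀ (L.bracket σ τ) y =
      fderiv ℝ (sectionRep x₀ τ) y (L.anchorRep x₀ y (sectionRep x₀ σ y)) -
        fderiv ℝ (sectionRep x₀ σ) y (L.anchorRep x₀ y (sectionRep x₀ τ y)) +
        L.bracketRep x₀ y (sectionRep x₀ σ y) (sectionRep x₀ τ y) := by
  have hx := map_symm_mem_frameSource hy
  have h := L.coordAt_bracket hx σ τ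
  rw [mvfderiv_coordAt hx, mvfderiv_coordAt hx, ← L.anchorRep_coordAt hx,
    ← L.anchorRep_coordAt hx, (extChartAt 𝓘(ℝ, E) x₀).right_inv hy.1] at h
  exact h

theorem bracketRep_skew {x₀ : M} {y : E} (hy : y ∈ frameDomain E F A x₀) (u v : F) :
    L.bracketRep x₀ y u v = -L.bracketRep x₀ y v u := by
  have hx := map_symm_mem_frameSource hy
  rw [← (extChartAt 𝓘(ℝ, E) x₀).right_inv hy.1, L.bracketRep_apply hx, L.bracketRep_apply hx,
    L.bracket_skew, ContMDiffSection.coe_neg, Pi.neg_apply, map_neg]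

/-- The value of `bracketRep` at a nearby point is defined by sections constant near that other
point. The coordinate formula for brackets shows that sections constant near `x` give the same
result, so `bracketRep` inherits smoothness and can be differentiated. -/
theorem bracketRep_eventuallyEq {x₀ x : M} (hx : x ∈ frameSource E F A x₀) (u v : F) :
    sectionRep x₀ (L.bracket (constSection E x₀ x u) (constSection E x₀ x v))
      =ᶠ[𝓝 (extChartAt 𝓘(ℝ, E) x₀ x)] fun y => L.bracketRep x₀ y u v := by
  filter_upwards [(sectionRep_constSection_eventuallyEq (A := A) hx u).eventuallyEq_nhds,
    (sectionRep_constSection_eventuallyEq (A := A) hx v).eventuallyEq_nhds,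
    (isOpen_frameDomain x₀).mem_nhds (map_mem_frameDomain hx)] with y h1 h2 h3
  rw [L.sectionRep_bracket h3, h1.fderiv_eq, h2.fderiv_eq, h1.self_of_nhds, h2.self_of_nhds]
  simp

theorem contDiffOn_bracketRep (x₀ : M) :
    ContDiffOn ℝ ∞ (L.bracketRep x₀) (frameDomain E F A x₀) := by
  rw [contDiffOn_clm_apply]
  intro u
  rw [contDiffOn_clm_apply]
  intro v y hy
  have h := L.bracketRep_eventuallyEq (map_symm_mem_frameSource hy) u v
  rw [(extChartAt 𝓘(ℝ, E) x₀).right_inv hy.1] at h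
  exact (((contDiffOn_sectionRep x₀ _).contDiffAt ((isOpen_frameDomain x₀).mem_nhds
    hy)).congr_of_eventuallyEq h.symm).contDiffWithinAt

/-- The anchor takes brackets to commutators of derivations. Applied to functions that are linear in
the chart near the point, this becomes an identity between vectors, because linear functionals
separate points. -/
theorem anchorRep_bracketRep {x₀ : M} {y : E} (hy : y ∈ frameDomain E F A x₀) (u v : F) :
    L.anchorRep x₀ y (L.bracketRep x₀ y u v) =
      fderiv ℝ (L.anchorRep x₀) y (L.anchorRep x₀ y u) v -
        fderiv ℝ (L.anchorRep x₀) y (L.anchorRep x₀ y v) u := by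
  have hx := map_symm_mem_frameSource hy
  set x := (extChartAt 𝓘(ℝ, E) x₀).symm y with hxy
  have hyx : extChartAt 𝓘(ℝ, E) x₀ x = y := (extChartAt 𝓘(ℝ, E) x₀).right_inv hy.1
  have hρ : DifferentiableAt ℝ (L.anchorRep x₀) y :=
    ((L.contDiffOn_anchorRep x₀).contDiffAt ((isOpen_frameDomain x₀).mem_nhds
      hy)).differentiableAt (by simp)
  rw [← sub_eq_zero]
  by_contra hne
  obtain ⟨ℓ, hℓ⟩ := SeparatingDual.exists_ne_zero (R := ℝ) hne
  apply hℓ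
  obtain ⟨f, hf⟩ := exists_function_eventuallyEq (E := E) (x := x) (chartAt E x₀).open_source
    hx.1 (s := fun z => ℓ (extChartAt 𝓘(ℝ, E) x₀ z))
    (ℓ.contMDiff.comp_contMDiffOn contMDiffOn_extChartAt)
  have hdf : ∀ᶠ z in 𝓝 x, ∀ w : TangentSpace 𝓘(ℝ, E) z, mvfderiv 𝓘(ℝ, E) f z w =
      ℓ (chartDeriv E x₀ z w) := by
    filter_upwards [hf.eventually_nhds, (chartAt E x₀).open_source.mem_nhds hx.1] with z h1 h2 w
    refine Eq.trans ?_ (mvfderiv_clm_comp ℓ (mdifferentiableAt_extChartAt h2) w)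
    exact congrArg (fun T : E →L[ℝ] ℝ => T w) (EventuallyEq.mfderiv_eq h1)
  have hld : ∀ u : F, ∀ᶠ z in 𝓝 x, L.lieDeriv (constSection E x₀ x u) f z =
      ℓ (L.anchorRep x₀ (extChartAt 𝓘(ℝ, E) x₀ z) u) := fun u => by
    filter_upwards [hdf, constSection_eventuallyEq (E := E) (F := F) (A := A) hx u,
      (isOpen_frameSource x₀).mem_nhds hx] with z h1 h2 h3
    change mvfderiv 𝓘(ℝ, E) f z (L.anchor z (constSection E x₀ x u z)) = _
    rw [h1, h2, L.anchorRep_apply h3]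
  have hdd : ∀ (u : F) (w : TangentSpace 𝓘(ℝ, E) x),
      mvfderiv 𝓘(ℝ, E) (L.lieDeriv (constSection E x₀ x u) f) x w =
      ℓ (fderiv ℝ (L.anchorRep x₀) y
        (chartDeriv E x₀ x w) u) := fun u w => by
    rw [mvfderiv_eq_fderiv_chart hx.1 (L.lieDeriv _ f).contMDiff.contMDiffAt, hyx]
    have h1 : (fun z => L.lieDeriv (constSection E x₀ x u) f ((extChartAt 𝓘(ℝ, E) x₀).symm z))
        =ᶠ[𝓝 y] fun z => ℓ (L.anchorRep x₀ z u) := by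
      have h2 := eventually_symm_of_eventually hx (hld u)
      rw [hyx] at h2
      filter_upwards [h2, (isOpen_frameDomain x₀).mem_nhds hy] with z h3 h4
      rw [h3, (extChartAt 𝓘(ℝ, E) x₀).right_inv h4.1]
    have h2 : DifferentiableAt ℝ (fun z => L.anchorRep x₀ z u) y :=
      hρ.clm_apply (differentiableAt_const u)
    have h3 := (ℓ.hasFDerivAt.comp y h2.hasFDerivAt).fderiv
    rw [h1.fderiv_eq, ← fderiv_clm_apply_const hρ]
    exact congrArg (fun T : E →L[ℝ] ℝ => T (chartDeriv E x₀ x w)) h3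
  have key := L.mvfderiv_anchor_bracket (constSection E x₀ x u) (constSection E x₀ x v) f x
  rw [hdf.self_of_nhds, hdd, hdd, ← L.anchorRep_coordAt hx, ← L.anchorRep_coordAt hx,
    ← L.anchorRep_coordAt hx, ← L.bracketRep_apply hx,
    (coordAt_constSection_eventuallyEq hx u).self_of_nhds,
    (coordAt_constSection_eventuallyEq hx v).self_of_nhds, hyx] at key
  rw [map_sub, map_sub, sub_eq_zero]
  exact key

/-- This is the Jacobi identity for three constant sections. The inner brackets need not be
constant, and their variation along the anchor produces the derivatives of `bracketRep`. -/
theorem bracketRep_jacobi {x₀ : M} {y : E} (hy : y ∈ frameDomain E F A x₀) (u v w : F) :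
    fderiv ℝ (L.bracketRep x₀) y (L.anchorRep x₀ y u) v w
      - fderiv ℝ (L.bracketRep x₀) y (L.anchorRep x₀ y v) u w
      + fderiv ℝ (L.bracketRep x₀) y (L.anchorRep x₀ y w) u v
      + L.bracketRep x₀ y u (L.bracketRep x₀ y v w)
      - L.bracketRep x₀ y (L.bracketRep x₀ y u v) w
      - L.bracketRep x₀ y v (L.bracketRep x₀ y u w) = 0 := by
  have hx := map_symm_mem_frameSource hy
  set x := (extChartAt 𝓘(ℝ, E) x₀).symm y with hxy
  have hyx : extChartAt 𝓘(ℝ, E) x₀ x = y := (extChartAt 𝓘(ℝ, E) x₀).right_inv hy.1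
  have hC : DifferentiableAt ℝ (L.bracketRep x₀) y :=
    ((L.contDiffOn_bracketRep x₀).contDiffAt ((isOpen_frameDomain x₀).mem_nhds
      hy)).differentiableAt (by simp)
  have hb : ∀ u v : F, sectionRep x₀ (L.bracket (constSection E x₀ x u) (constSection E x₀ x v))
      =ᶠ[𝓝 y] fun y => L.bracketRep x₀ y u v := fun u v => by
    simpa only [hyx] using L.bracketRep_eventuallyEq hx u v
  have hs : ∀ u : F, sectionRep x₀ (constSection E x₀ x u : Cₛ^∞⟮𝓘(ℝ, E); F, A⟯)
      =ᶠ[𝓝 y] fun _ => u := fun u => by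
    simpa only [hyx] using sectionRep_constSection_eventuallyEq (A := A) hx u
  have hd : ∀ (u v : F) (e : E), fderiv ℝ (fun y => L.bracketRep x₀ y u v) y e =
      fderiv ℝ (L.bracketRep x₀) y e u v := fun u v e => by
    have h := fderiv_bilin_comp_apply (f := fun z : E => z) (s := fun _ => u) (s' := fun _ => v)
      hC differentiableAt_id (differentiableAt_const u) (differentiableAt_const v) e
    simpa using h
  have h1 : ∀ u v w : F, sectionRep x₀ (L.bracket (constSection E x₀ x u)
      (L.bracket (constSection E x₀ x v) (constSection E x₀ x w))) y =
      fderiv ℝ (L.bracketRep x₀) y (L.anchorRep x₀ y u) v w +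
        L.bracketRep x₀ y u (L.bracketRep x₀ y v w) := fun u v w => by
    rw [L.sectionRep_bracket hy, (hb v w).fderiv_eq, (hs u).fderiv_eq, (hs u).self_of_nhds,
      (hb v w).self_of_nhds, hd]
    simp
  have h2 := congrArg (fun σ => sectionRep x₀ σ y)
    (L.jacobi (constSection E x₀ x u) (constSection E x₀ x v) (constSection E x₀ x w))
  have h3 : ∀ σ τ : Cₛ^∞⟮𝓘(ℝ, E); F, A⟯,
      sectionRep x₀ (σ + τ) y = sectionRep x₀ σ y + sectionRep x₀ τ y := fun σ τ => by
    simp only [sectionRep, ContMDiffSection.coe_add, Pi.add_apply, map_add]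
  have h4 : ∀ σ : Cₛ^∞⟮𝓘(ℝ, E); F, A⟯, sectionRep x₀ (-σ) y = -sectionRep x₀ σ y := fun σ => by
    simp only [sectionRep, ContMDiffSection.coe_neg, Pi.neg_apply, map_neg]
  beta_reduce at h2
  -- Skew symmetry moves the inner bracket to the right, so that `h1` computes all three terms.
  rw [h3, L.bracket_skew (L.bracket _ _) (constSection E x₀ x w), h4, h1, h1, h1,
    L.bracketRep_skew hy w] at h2
  rw [← sub_eq_zero] at h2
  rw [← h2]
  abel

theorem isAlgebroidModel (x₀ : M) :
    IsAlgebroidModel (frameDomain E F A x₀) (L.anchorRep x₀) (L.bracketRep x₀) where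
  isOpen := isOpen_frameDomain x₀
  contDiffOn_anchor := L.contDiffOn_anchorRep x₀
  contDiffOn_bracket := L.contDiffOn_bracketRep x₀
  skew _ hy := L.bracketRep_skew hy
  anchor _ hy := L.anchorRep_bracketRep hy
  jacobi _ hy := L.bracketRep_jacobi hy

variable (E F A) in
/-- The change of frame from `x₀` to `x₁`, in the chart at `x₀`. -/
def frameChange (x₀ x₁ : M) (y : E) : F →L[ℝ] F :=
  (coordAt F A x₁ ((extChartAt 𝓘(ℝ, E) x₀).symm y)).comp
    (frameAt F A x₀ ((extChartAt 𝓘(ℝ, E) x₀).symm y))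

theorem frameChange_coordAt {x₀ x₁ x : M} (hx : x ∈ frameSource E F A x₀) (v : A x) :
    frameChange E F A x₀ x₁ (extChartAt 𝓘(ℝ, E) x₀ x) (coordAt F A x₀ x v) =
      coordAt F A x₁ x v := by
  rw [frameChange, left_inv_of_mem_frameSource hx, ContinuousLinearMap.comp_apply,
    frameAt_coordAt hx.2]

theorem frameChange_eventuallyEq {x₀ x₁ x : M} (hx : x ∈ frameSource E F A x₀) (u : F) :
    (fun y => coordAt F A x₁ ((extChartAt 𝓘(ℝ, E) x₀).symm y)
      ((constSection E x₀ x u : Cₛ^∞⟮𝓘(ℝ, E); F, A⟯) ((extChartAt 𝓘(ℝ, E) x₀).symm y)))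
      =ᶠ[𝓝 (extChartAt 𝓘(ℝ, E) x₀ x)] fun y => frameChange E F A x₀ x₁ y u := by
  filter_upwards [eventually_symm_of_eventually hx
    (constSection_eventuallyEq (E := E) (F := F) (A := A) hx u)] with y hy
  rw [hy]
  rfl

theorem contDiffAt_frameChange {x₀ x₁ x : M} (hx : x ∈ frameSource E F A x₀)
    (hx₁ : x ∈ frameSource E F A x₁) :
    ContDiffAt ℝ ∞ (frameChange E F A x₀ x₁) (extChartAt 𝓘(ℝ, E) x₀ x) := by
  refine contDiffAt_clm_of_apply fun u => ?_
  exact ((contMDiffAt_coordAt hx₁.2 (constSection E x₀ x u)).contDiffAt_comp_extChartAt_symm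
    hx.1).congr_of_eventuallyEq (frameChange_eventuallyEq hx u).symm

/-- The transformation of the structure functions under a change of frame. -/
theorem bracketRep_frameChange {x₀ x₁ x : M} (hx : x ∈ frameSource E F A x₀)
    (hx₁ : x ∈ frameSource E F A x₁) (u v : F) :
    L.bracketRep x₁ (extChartAt 𝓘(ℝ, E) x₁ x)
        (frameChange E F A x₀ x₁ (extChartAt 𝓘(ℝ, E) x₀ x) u)
        (frameChange E F A x₀ x₁ (extChartAt 𝓘(ℝ, E) x₀ x) v) =
      frameChange E F A x₀ x₁ (extChartAt 𝓘(ℝ, E) x₀ x)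
        (L.bracketRep x₀ (extChartAt 𝓘(ℝ, E) x₀ x) u v)
      - fderiv ℝ (frameChange E F A x₀ x₁) (extChartAt 𝓘(ℝ, E) x₀ x)
        (L.anchorRep x₀ (extChartAt 𝓘(ℝ, E) x₀ x) u) v
      + fderiv ℝ (frameChange E F A x₀ x₁) (extChartAt 𝓘(ℝ, E) x₀ x)
        (L.anchorRep x₀ (extChartAt 𝓘(ℝ, E) x₀ x) v) u := by
  -- Sections constant in the frame at `x₀` are bracketed in the frame at `x₁`. There they are
  -- represented by the columns of `frameChange`, whose derivatives give the inhomogeneous terms.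
  have h := L.coordAt_bracket hx₁ (constSection E x₀ x u) (constSection E x₀ x v)
  have h1 : ∀ (u : F) (w : TangentSpace 𝓘(ℝ, E) x), mvfderiv 𝓘(ℝ, E) (fun y => coordAt F A x₁ y
      ((constSection E x₀ x u : Cₛ^∞⟮𝓘(ℝ, E); F, A⟯) y)) x w =
      fderiv ℝ (frameChange E F A x₀ x₁) (extChartAt 𝓘(ℝ, E) x₀ x)
        (chartDeriv E x₀ x w) u := fun u w => by
    rw [mvfderiv_eq_fderiv_chart hx.1 (contMDiffAt_coordAt hx₁.2 _),
      (frameChange_eventuallyEq hx u).fderiv_eq]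
    exact fderiv_clm_apply_const ((contDiffAt_frameChange hx hx₁).differentiableAt (by simp)) u _
  have h2 : ∀ u : F, frameChange E F A x₀ x₁ (extChartAt 𝓘(ℝ, E) x₀ x) u =
      coordAt F A x₁ x ((constSection E x₀ x u : Cₛ^∞⟮𝓘(ℝ, E); F, A⟯) x) := fun u => by
    rw [(constSection_eventuallyEq hx u).self_of_nhds, frameChange, left_inv_of_mem_frameSource hx]
    rfl
  rw [h1, h1, ← L.anchorRep_coordAt hx, ← L.anchorRep_coordAt hx,
    (coordAt_constSection_eventuallyEq hx u).self_of_nhds,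
    (coordAt_constSection_eventuallyEq hx v).self_of_nhds, ← h2, ← h2] at h
  rw [L.bracketRep_apply hx, frameChange_coordAt hx, h]
  abel

end Representatives

end LieAlgebroid

/-! ### Maps into a manifold in charts, and smooth right inverses -/

section ChartComp

variable {E : Type*} [NormedAddCommGroup E] [NormedSpace ℝ E]
  {M : Type*} [TopologicalSpace M] [ChartedSpace E M] [IsManifold 𝓘(ℝ, E) ∞ M]
  {P : Type*} [NormedAddCommGroup P] [NormedSpace ℝ P]

theorem contDiffAt_extChartAt_comp {f : P → M} {p : P} {x₀ : M}
    (hf : ContMDiffAt 𝓘(ℝ, P) 𝓘(ℝ, E) ∞ f p) (hp : f p ∈ (chartAt E x₀).source) :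
    ContDiffAt ℝ ∞ (fun q => extChartAt 𝓘(ℝ, E) x₀ (f q)) p := by
  rw [← contMDiffAt_iff_contDiffAt]
  exact (contMDiffAt_extChartAt' hp).comp p hf

theorem fderiv_extChartAt_comp {f : P → M} {p : P} {x₀ : M}
    (hf : ContMDiffAt 𝓘(ℝ, P) 𝓘(ℝ, E) ∞ f p) (hp : f p ∈ (chartAt E x₀).source) (w : P) :
    fderiv ℝ (fun q => extChartAt 𝓘(ℝ, E) x₀ (f q)) p w =
      chartDeriv E x₀ (f p) (mfderiv 𝓘(ℝ, P) 𝓘(ℝ, E) f p w) := by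
  have h := mfderiv_comp p (mdifferentiableAt_extChartAt (I := 𝓘(ℝ, E)) hp)
    (hf.mdifferentiableAt (by simp))
  rw [mfderiv_eq_fderiv] at h
  exact congrArg (fun T : P →L[ℝ] E => T w) h

theorem chartDeriv_injective {x₀ x : M} (hx : x ∈ (chartAt E x₀).source) :
    Function.Injective (chartDeriv E x₀ x) :=
  (isInvertible_mfderiv_extChartAt (I := 𝓘(ℝ, E)) (by simpa using hx)).injective

end ChartComp

/-- A family of surjective linear maps has a smooth local right inverse. -/
theorem exists_contDiffAt_rightInverse {Y G H : Type*} [NormedAddCommGroup Y] [NormedSpace ℝ Y]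
    [NormedAddCommGroup G] [NormedSpace ℝ G] [NormedAddCommGroup H] [NormedSpace ℝ H]
    [FiniteDimensional ℝ H] {ρ : Y → G →L[ℝ] H} {y : Y} (hρ : ∀ᶠ z in 𝓝 y, ContDiffAt ℝ ∞ ρ z)
    (hs : Function.Surjective (ρ y)) :
    ∃ s : Y → H →L[ℝ] G, ∀ᶠ z in 𝓝 y, ContDiffAt ℝ ∞ s z ∧ ∀ h, ρ z (s z h) = h := by
  have : CompleteSpace H := FiniteDimensional.complete ℝ H
  obtain ⟨s₀, hs₀⟩ := (ρ y).toLinearMap.exists_rightInverse_of_surjective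
    (LinearMap.range_eq_top.2 hs)
  -- A right inverse at the single point `y` stays a right inverse nearby after correction by the
  -- inverse of `ρ z ∘ S`, which is close to the identity.
  let S : H →L[ℝ] G := s₀.toContinuousLinearMap
  let N : Y → H →L[ℝ] H := fun z => (ρ z).comp S
  have hN : ∀ᶠ z in 𝓝 y, ContDiffAt ℝ ∞ N z := hρ.mono fun z hz => hz.clm_comp contDiffAt_const
  have hN1 : N y = 1 := ContinuousLinearMap.ext fun h => congrArg (fun T => T h) hs₀
  have hu : ∀ᶠ z in 𝓝 y, IsUnit (N z) := by
    refine hN.self_of_nhds.continuousAt.eventually ?_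
    rw [hN1]
    exact Units.isOpen.mem_nhds isUnit_one
  refine ⟨fun z => S.comp (Ring.inverse (N z)), ?_⟩
  filter_upwards [hN, hu] with z hz hz'
  refine ⟨contDiffAt_const.clm_comp (ContDiffAt.comp (g := Ring.inverse) z ?_ hz), fun h => ?_⟩
  · obtain ⟨w, hw⟩ := hz'
    rw [← hw]
    exact contDiffAt_ringInverse ℝ w
  · exact congrArg (fun T : H →L[ℝ] H => T h) (Ring.mul_inverse_cancel (N z) hz')

/-! ### Lifting the velocity of a contraction -/

namespace LieAlgebroid

variable {E : Type*} [NormedAddCommGroup E] [NormedSpace ℝ E] [FiniteDimensional ℝ E]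
  {M : Type*} [TopologicalSpace M] [T2Space M] [ChartedSpace E M] [IsManifold 𝓘(ℝ, E) ∞ M]
  {F : Type*} [NormedAddCommGroup F] [NormedSpace ℝ F] [FiniteDimensional ℝ F]
  {A : M → Type*} [TopologicalSpace (TotalSpace F A)]
  [∀ x, AddCommGroup (A x)] [∀ x, Module ℝ (A x)] [∀ x, TopologicalSpace (A x)]
  [FiberBundle F A] [VectorBundle ℝ F A] [ContMDiffVectorBundle ∞ F A 𝓘(ℝ, E)]

variable (A) in
/-- The additive group structure on the fibres of a pullback bundle. -/
abbrev pullbackAddCommGroup {N : Type*} (f : N → M) (q : N) : AddCommGroup ((f *ᵖ A) q) :=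
  inferInstanceAs (AddCommGroup (A (f q)))

/-- The lifts of a given vector form a convex set, which is the hypothesis needed for gluing local
lifts by a partition of unity. -/
theorem _root_.LinearMap.map_convexCombination {V W : Type*} [AddCommGroup V] [Module ℝ V]
    [AddCommGroup W] [Module ℝ W] (T : V →ₗ[ℝ] W) {a b : V} {w : W} (ha : T a = w) (hb : T b = w)
    {c d : ℝ} (hcd : c + d = 1) : T (c • a + d • b) = w := by
  rw [map_add, map_smul, map_smul, ha, hb, ← add_smul, hcd, one_smul]

/-- A smooth contraction of `M` to `m₀`, together with a lift of its velocity to `A`. -/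
structure LiftedContraction (L : LieAlgebroid E F A) (m₀ : M) where
  map : ℝ × M → M
  contMDiff_map : ContMDiff (𝓘(ℝ, ℝ).prod 𝓘(ℝ, E)) 𝓘(ℝ, E) ∞ map
  map_zero : ∀ x, map (0, x) = m₀
  map_one : ∀ x, map (1, x) = x
  vel : ∀ q, A (map q)
  contMDiff_vel : ContMDiff (𝓘(ℝ, ℝ).prod 𝓘(ℝ, E)) (𝓘(ℝ, E).prod 𝓘(ℝ, F)) ∞
    (fun q => (⟨map q, vel q⟩ : TotalSpace F A))
  anchor_vel : ∀ q, L.anchor (map q) (vel q) =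
    mfderiv 𝓘(ℝ, ℝ) 𝓘(ℝ, E) (fun t => map (t, q.2)) q.1 (1 : ℝ)

variable (E) in
/-- The product of the identity of `ℝ` and the inverse of the preferred chart at `m`. -/
def chartParam (m : M) (p : ℝ × E) : ℝ × M := (p.1, (extChartAt 𝓘(ℝ, E) m).symm p.2)

theorem contMDiffAt_chartParam {m : M} {p : ℝ × E} (hp : p.2 ∈ (extChartAt 𝓘(ℝ, E) m).target) :
    ContMDiffAt 𝓘(ℝ, ℝ × E) (𝓘(ℝ, ℝ).prod 𝓘(ℝ, E)) ∞ (chartParam E m) p :=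
  contDiff_fst.contMDiff.contMDiffAt.prodMk
    ((contMDiffAt_extChartAt_symm hp).comp p contDiff_snd.contMDiff.contMDiffAt)

theorem mfderiv_comp_chartParam_time {φ : ℝ × M → M}
    (hφ : ContMDiff (𝓘(ℝ, ℝ).prod 𝓘(ℝ, E)) 𝓘(ℝ, E) ∞ φ) {m : M} {p : ℝ × E}
    (hp : p.2 ∈ (extChartAt 𝓘(ℝ, E) m).target) :
    mfderiv 𝓘(ℝ, ℝ × E) 𝓘(ℝ, E) (fun q => φ (chartParam E m q)) p ((1, 0) : ℝ × E) =
      mfderiv 𝓘(ℝ, ℝ) 𝓘(ℝ, E) (fun t => φ (t, (chartParam E m p).2)) p.1 (1 : ℝ) := by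
  have h1 : ContMDiffAt 𝓘(ℝ, ℝ × E) 𝓘(ℝ, E) ∞ (fun q => φ (chartParam E m q)) p :=
    hφ.contMDiffAt.comp p (contMDiffAt_chartParam hp)
  have h2 : HasFDerivAt (fun t : ℝ => ((t, p.2) : ℝ × E))
      ((ContinuousLinearMap.id ℝ ℝ).prod 0) p.1 :=
    (hasFDerivAt_id p.1).prodMk (hasFDerivAt_const p.2 p.1)
  have h3 := mfderiv_comp p.1 (g := fun q => φ (chartParam E m q))
    (h1.mdifferentiableAt (by simp)) h2.hasMFDerivAt.mdifferentiableAt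
  rw [h2.hasMFDerivAt.mfderiv] at h3
  exact (congrArg (fun T : ℝ →L[ℝ] E => T 1) h3).symm

/-- In a frame at `φ q₀` the anchor is a smooth family of linear maps, surjective at that point by
transitivity. A smooth right inverse applied to the coordinate velocity gives the lift. -/
theorem exists_local_velocity_lift (L : LieAlgebroid E F A) (hL : L.IsTransitive)
    {φ : ℝ × M → M} (hφ : ContMDiff (𝓘(ℝ, ℝ).prod 𝓘(ℝ, E)) 𝓘(ℝ, E) ∞ φ) (q₀ : ℝ × M) :
    ∃ s : ∀ q, A (φ q), ∀ᶠ q in 𝓝 q₀,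
      ContMDiffAt (𝓘(ℝ, ℝ).prod 𝓘(ℝ, E)) (𝓘(ℝ, E).prod 𝓘(ℝ, F)) ∞
        (fun q => (⟨φ q, s q⟩ : TotalSpace F A)) q ∧
      L.anchor (φ q) (s q) = mfderiv 𝓘(ℝ, ℝ) 𝓘(ℝ, E) (fun t => φ (t, q.2)) q.1 (1 : ℝ) := by
  set x₀ := φ q₀ with hx₀
  have hx : x₀ ∈ frameSource E F A x₀ := mem_frameSource x₀
  have hsurj : Function.Surjective (L.anchorRep x₀ (extChartAt 𝓘(ℝ, E) x₀ x₀)) := fun e => by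
    obtain ⟨v, hv⟩ := (isInvertible_mfderiv_extChartAt (I := 𝓘(ℝ, E))
      (mem_extChartAt_source x₀)).surjective e
    obtain ⟨a, ha⟩ := hL x₀ v
    exact ⟨coordAt F A x₀ x₀ a, by rw [L.anchorRep_coordAt hx, ha]; exact hv⟩
  have hsm : ∀ᶠ y in 𝓝 (extChartAt 𝓘(ℝ, E) x₀ x₀), ContDiffAt ℝ ∞ (L.anchorRep x₀) y := by
    filter_upwards [(isOpen_frameDomain x₀).mem_nhds (map_mem_frameDomain hx)] with y hy
    exact (L.contDiffOn_anchorRep x₀).contDiffAt ((isOpen_frameDomain x₀).mem_nhds hy)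
  obtain ⟨r, hr⟩ := exists_contDiffAt_rightInverse hsm hsurj
  let m := q₀.2
  -- The coordinate velocity is written as a partial derivative of a map between vector spaces,
  -- which makes its smoothness in `q` available.
  let b : ℝ × M → E := fun q => fderiv ℝ
    (fun p => extChartAt 𝓘(ℝ, E) x₀ (φ (chartParam E m p))) (q.1, extChartAt 𝓘(ℝ, E) m q.2) (1, 0)
  refine ⟨fun q => frameAt F A x₀ (φ q) (r (extChartAt 𝓘(ℝ, E) x₀ (φ q)) (b q)), ?_⟩
  have hφc : ContinuousAt φ q₀ := hφ.continuous.continuousAt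
  have hc : ContinuousAt (fun q => extChartAt 𝓘(ℝ, E) x₀ (φ q)) q₀ :=
    ContinuousAt.comp (continuousAt_extChartAt x₀) hφc
  filter_upwards [hφc.preimage_mem_nhds ((isOpen_frameSource x₀).mem_nhds hx),
    hc.eventually hr, continuousAt_snd.preimage_mem_nhds
      ((chartAt E m).open_source.mem_nhds (mem_chart_source E m))] with q h1 ⟨h3, h2⟩ h4
  have hm : q.2 ∈ (extChartAt 𝓘(ℝ, E) m).source := by simpa using h4
  have hκ : chartParam E m (q.1, extChartAt 𝓘(ℝ, E) m q.2) = q :=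
    Prod.ext rfl ((extChartAt 𝓘(ℝ, E) m).left_inv hm)
  have hp : (q.1, extChartAt 𝓘(ℝ, E) m q.2).2 ∈ (extChartAt 𝓘(ℝ, E) m).target :=
    (extChartAt 𝓘(ℝ, E) m).map_source hm
  have hf : ContMDiffAt 𝓘(ℝ, ℝ × E) 𝓘(ℝ, E) ∞ (fun p => φ (chartParam E m p))
      (q.1, extChartAt 𝓘(ℝ, E) m q.2) := hφ.contMDiffAt.comp _ (contMDiffAt_chartParam hp)
  have hbq : b q = chartDeriv E x₀ (φ q)
      (mfderiv 𝓘(ℝ, ℝ) 𝓘(ℝ, E) (fun t => φ (t, q.2)) q.1 (1 : ℝ)) := by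
    have h5 := fderiv_extChartAt_comp hf (by rw [hκ]; exact h1.1) (1, 0)
    rw [mfderiv_comp_chartParam_time hφ hp] at h5
    have h6 : ∀ q', q' = q → chartDeriv E x₀ (φ q')
        (mfderiv 𝓘(ℝ, ℝ) 𝓘(ℝ, E) (fun t => φ (t, q'.2)) q'.1 (1 : ℝ)) = chartDeriv E x₀ (φ q)
        (mfderiv 𝓘(ℝ, ℝ) 𝓘(ℝ, E) (fun t => φ (t, q.2)) q.1 (1 : ℝ)) := by
      rintro _ rfl
      rfl
    exact h5.trans (h6 _ hκ)
  constructor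
  · refine (contMDiffAt_iff_coordAt h1.2).2 ⟨hφ q, ?_⟩
    have hb : ContMDiffAt (𝓘(ℝ, ℝ).prod 𝓘(ℝ, E)) 𝓘(ℝ, E) ∞ b q := by
      have h5 := contDiffAt_extChartAt_comp hf (by rw [hκ]; exact h1.1)
      have h6 := ((h5.fderiv_right (m := ∞) (by simp)).clm_apply
        (contDiffAt_const (c := ((1, 0) : ℝ × E)))).contMDiffAt
      have h7 : ContMDiffAt (𝓘(ℝ, ℝ).prod 𝓘(ℝ, E)) 𝓘(ℝ, ℝ × E) ∞
          (fun q : ℝ × M => (q.1, extChartAt 𝓘(ℝ, E) m q.2)) q := by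
        rw [modelWithCornersSelf_prod, ← chartedSpaceSelf_prod]
        exact contMDiffAt_fst.prodMk ((contMDiffAt_extChartAt' h4).comp q contMDiffAt_snd)
      exact h6.comp q h7
    have hr2 : ContMDiffAt (𝓘(ℝ, ℝ).prod 𝓘(ℝ, E)) 𝓘(ℝ, E →L[ℝ] F) ∞
        (fun q => r (extChartAt 𝓘(ℝ, E) x₀ (φ q))) q :=
      h3.contMDiffAt.comp q ((contMDiffAt_extChartAt' h1.1).comp q (hφ q))
    refine (hr2.clm_apply hb).congr_of_eventuallyEq ?_
    filter_upwards [hφ.continuous.continuousAt.preimage_mem_nhds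
      ((trivializationAt F A x₀).open_baseSet.mem_nhds h1.2)] with z hz
    exact coordAt_frameAt hz _
  · apply chartDeriv_injective h1.1
    rw [← L.anchorRep_apply h1, h2, hbq]

/-- A lift is a section of the pullback bundle over `ℝ × M` subject to a convex condition on each
fibre, so local lifts glue. -/
theorem exists_velocity_lift [SecondCountableTopology M] (L : LieAlgebroid E F A)
    (hL : L.IsTransitive) {φ : ℝ × M → M}
    (hφ : ContMDiff (𝓘(ℝ, ℝ).prod 𝓘(ℝ, E)) 𝓘(ℝ, E) ∞ φ) :
    ∃ s : ∀ q, A (φ q), ContMDiff (𝓘(ℝ, ℝ).prod 𝓘(ℝ, E)) (𝓘(ℝ, E).prod 𝓘(ℝ, F)) ∞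
        (fun q => (⟨φ q, s q⟩ : TotalSpace F A)) ∧
      ∀ q, L.anchor (φ q) (s q) =
        mfderiv 𝓘(ℝ, ℝ) 𝓘(ℝ, E) (fun t => φ (t, q.2)) q.1 (1 : ℝ) := by
  have : LocallyCompactSpace M := Manifold.locallyCompact_of_finiteDimensional 𝓘(ℝ, E)
  let f : C^∞⟮𝓘(ℝ, ℝ).prod 𝓘(ℝ, E), ℝ × M; 𝓘(ℝ, E), M⟯ := ⟨φ, hφ⟩
  have hiff : ∀ (s : ∀ q, A (φ q)) (q : ℝ × M),
      ContMDiffAt (𝓘(ℝ, ℝ).prod 𝓘(ℝ, E)) ((𝓘(ℝ, ℝ).prod 𝓘(ℝ, E)).prod 𝓘(ℝ, F)) ∞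
        (fun q => (⟨q, s q⟩ : TotalSpace F ((f : ℝ × M → M) *ᵖ A))) q ↔
      ContMDiffAt (𝓘(ℝ, ℝ).prod 𝓘(ℝ, E)) (𝓘(ℝ, E).prod 𝓘(ℝ, F)) ∞
        (fun q => (⟨φ q, s q⟩ : TotalSpace F A)) q := fun s q => by
    refine (contMDiffAt_section (E := (f : ℝ × M → M) *ᵖ A) q).trans ?_
    rw [contMDiffAt_totalSpace]
    exact (and_iff_right (hφ q)).symm
  let _ : ∀ q, AddCommGroup (((f : ℝ × M → M) *ᵖ A) q) := pullbackAddCommGroup A f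
  obtain ⟨s, hs⟩ := exists_contMDiffSection_forall_mem_convex_of_local
    (𝓘(ℝ, ℝ).prod 𝓘(ℝ, E)) (n := ⊤) (F_fiber := F) ((f : ℝ × M → M) *ᵖ A)
    (fun q => {a : A (φ q) | L.anchor (φ q) a =
      mfderiv 𝓘(ℝ, ℝ) 𝓘(ℝ, E) (fun t => φ (t, q.2)) q.1 (1 : ℝ)})
    (fun q a ha b hb c d _ _ hcd => by
      refine (L.anchor (φ q)).toLinearMap.map_convexCombination ha hb hcd)
    (fun q₀ => by
      obtain ⟨s, hs⟩ := L.exists_local_velocity_lift hL hφ q₀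
      exact ⟨_, hs, s, fun q hq => ((hiff s q).2 hq.1).contMDiffWithinAt, fun q hq => hq.2⟩)
  exact ⟨s, fun q => (hiff _ q).1 (s.contMDiff q), hs⟩

/-- Composition with a smooth step function gives a contraction smooth for all real times. Transport
can then be carried out on open intervals around `[0, 1]`, without one-sided derivatives at the
ends. -/
theorem exists_liftedContraction [SecondCountableTopology M] (L : LieAlgebroid E F A)
    (hL : L.IsTransitive) {m₀ : M} {φ : ℝ × M → M}
    (hφ : ContMDiffOn (𝓘(ℝ, ℝ).prod 𝓘(ℝ, E)) 𝓘(ℝ, E) ∞ φ (Icc (0 : ℝ) 1 ×ˢ univ))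
    (h₀ : ∀ x, φ (0, x) = m₀) (h₁ : ∀ x, φ (1, x) = x) : Nonempty (L.LiftedContraction m₀) := by
  have h : ContMDiff (𝓘(ℝ, ℝ).prod 𝓘(ℝ, E)) (𝓘(ℝ, ℝ).prod 𝓘(ℝ, E)) ∞
      (fun q : ℝ × M => (Real.smoothTransition q.1, q.2)) :=
    (Real.smoothTransition.contDiff.contMDiff.comp contMDiff_fst).prodMk contMDiff_snd
  have h2 : ContMDiff (𝓘(ℝ, ℝ).prod 𝓘(ℝ, E)) 𝓘(ℝ, E) ∞
      (fun q : ℝ × M => φ (Real.smoothTransition q.1, q.2)) := by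
    rw [← contMDiffOn_univ]
    exact hφ.comp h.contMDiffOn fun q _ =>
      ⟨⟨Real.smoothTransition.nonneg _, Real.smoothTransition.le_one _⟩, mem_univ _⟩
  obtain ⟨s, hs, hs'⟩ := L.exists_velocity_lift hL h2
  exact ⟨⟨_, h2, fun x => by simp [h₀], fun x => by simp [h₁], s, hs, hs'⟩⟩

end LieAlgebroid

/-! ### Time derivatives and the defect of the lifting property -/

section TimeCalculus

variable {E : Type*} [NormedAddCommGroup E] [NormedSpace ℝ E]
  {F : Type*} [NormedAddCommGroup F] [NormedSpace ℝ F]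

theorem hasDerivAt_time {h : ℝ × E → F} {t : ℝ} {y : E} (hh : DifferentiableAt ℝ h (t, y)) :
    HasDerivAt (fun τ => h (τ, y)) (fderiv ℝ h (t, y) (1, 0)) t := by
  have h2 : HasDerivAt (fun τ : ℝ => ((τ, y) : ℝ × E)) (1, 0) t :=
    (hasDerivAt_id t).prodMk (hasDerivAt_const t y)
  exact hh.hasFDerivAt.comp_hasDerivAt t h2

theorem fderiv_space {h : ℝ × E → F} {t : ℝ} {y : E} (hh : DifferentiableAt ℝ h (t, y)) (X : E) :
    fderiv ℝ (fun z => h (t, z)) y X = fderiv ℝ h (t, y) (0, X) := by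
  have h2 : HasFDerivAt (fun z : E => ((t, z) : ℝ × E)) (ContinuousLinearMap.inr ℝ ℝ E) y :=
    hasFDerivAt_prodMk_right t y
  exact congrArg (fun T : E →L[ℝ] F => T X) (hh.hasFDerivAt.comp y h2).fderiv

/-- The defect of the lifting property of a solution of the transport equation satisfies a linear
differential equation. -/
theorem IsAlgebroidModel.hasDerivAt_lift_defect {Ω : Set E} {ρ : E → F →L[ℝ] E}
    {C : E → F →L[ℝ] F →L[ℝ] F} (hM : IsAlgebroidModel Ω ρ C) {f : ℝ × E → E} {a u : ℝ × E → F}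
    {t : ℝ} {y X : E} (hp : f (t, y) ∈ Ω) (hf : ContDiffAt ℝ ∞ f (t, y))
    (ha : ContDiffAt ℝ ∞ a (t, y)) (hu : ContDiffAt ℝ ∞ u (t, y))
    (hv : ∀ᶠ q in 𝓝 (t, y), ρ (f q) (a q) = fderiv ℝ f q (1, 0))
    (hb : bracketAlong C f (1, 0) a (0, X) u (t, y) = 0) :
    HasDerivAt (fun τ => ρ (f (τ, y)) (u (τ, y)) - fderiv ℝ f (τ, y) (0, X))
      ((fderiv ℝ ρ (f (t, y))).flip (a (t, y))
        (ρ (f (t, y)) (u (t, y)) - fderiv ℝ f (t, y) (0, X))) t := by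
  have hfd := hf.differentiableAt (by simp)
  have had := ha.differentiableAt (by simp)
  have hud := hu.differentiableAt (by simp)
  have hρ := hM.differentiableAt_anchor hp
  have h1 := differentiableAt_clm_comp_apply hρ hfd hud
  have h2 := differentiableAt_fderiv_apply hf ((0, X) : ℝ × E)
  have h3 := hasDerivAt_time (h1.fun_sub h2)
  convert h3 using 1
  -- The lifting property of the velocity is differentiated in the direction `X`.
  have h4 : fderiv ℝ (fun q => fderiv ℝ f q (1, 0)) (t, y) (0, X) =
      fderiv ℝ ρ (f (t, y)) (fderiv ℝ f (t, y) (0, X)) (a (t, y))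
        + ρ (f (t, y)) (fderiv ℝ a (t, y) (0, X)) := by
    rw [← fderiv_clm_comp_apply hρ hfd had]
    exact congrArg (fun T : ℝ × E →L[ℝ] E => T (0, X)) (EventuallyEq.fderiv_eq hv).symm
  have h5 : fderiv ℝ u (t, y) (1, 0) =
      fderiv ℝ a (t, y) (0, X) - C (f (t, y)) (a (t, y)) (u (t, y)) := by
    rw [← sub_eq_zero, ← hb, bracketAlong]
    abel
  -- The anchor identity replaces `ρ (C a u)` by derivatives of `ρ`. The terms with `∂_X a` and
  -- those along the velocity cancel, leaving the derivative of `ρ` along the defect, applied to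
  -- `a`.
  rw [fderiv_fun_sub h1 h2, sub_apply, fderiv_clm_comp_apply hρ hfd hud,
    fderiv_fderiv_apply_comm hf, h4, h5, ContinuousLinearMap.map_sub (ρ _), hM.anchor _ hp,
    ← hv.self_of_nhds, ContinuousLinearMap.flip_apply, map_sub, sub_apply]
  abel

end TimeCalculus

/-! ### Sections along a contraction, their brackets, and the transport conditions -/

namespace LieAlgebroid

variable {E : Type*} [NormedAddCommGroup E] [NormedSpace ℝ E] [FiniteDimensional ℝ E]
  {M : Type*} [TopologicalSpace M] [T2Space M] [ChartedSpace E M] [IsManifold 𝓘(ℝ, E) ∞ M]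
  {F : Type*} [NormedAddCommGroup F] [NormedSpace ℝ F] [FiniteDimensional ℝ F]
  {A : M → Type*} [TopologicalSpace (TotalSpace F A)]
  [∀ x, AddCommGroup (A x)] [∀ x, Module ℝ (A x)] [∀ x, TopologicalSpace (A x)]
  [FiberBundle F A] [VectorBundle ℝ F A] [ContMDiffVectorBundle ∞ F A 𝓘(ℝ, E)]

theorem chartParam_extChartAt {m : M} {q : ℝ × M} (hq : q.2 ∈ (chartAt E m).source) :
    chartParam E m (q.1, extChartAt 𝓘(ℝ, E) m q.2) = q :=
  Prod.ext rfl ((extChartAt 𝓘(ℝ, E) m).left_inv (by simpa using hq))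

theorem chartParam_snd_mem {m : M} {p : ℝ × E} (hp : p.2 ∈ (extChartAt 𝓘(ℝ, E) m).target) :
    (chartParam E m p).2 ∈ (chartAt E m).source := by
  simpa [chartParam] using (extChartAt 𝓘(ℝ, E) m).map_target hp

theorem continuousAt_chartParam {m : M} {p : ℝ × E}
    (hp : p.2 ∈ (extChartAt 𝓘(ℝ, E) m).target) : ContinuousAt (chartParam E m) p :=
  (contMDiffAt_chartParam hp).continuousAt

variable (E) in
/-- The inverse of `chartParam`. -/
def chartCoord (m : M) (q : ℝ × M) : ℝ × E := (q.1, extChartAt 𝓘(ℝ, E) m q.2)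

theorem contMDiffAt_chartCoord {m : M} {q : ℝ × M} (hq : q.2 ∈ (chartAt E m).source) :
    ContMDiffAt (𝓘(ℝ, ℝ).prod 𝓘(ℝ, E)) 𝓘(ℝ, ℝ × E) ∞ (chartCoord E m) q := by
  rw [modelWithCornersSelf_prod, ← chartedSpaceSelf_prod]
  exact contMDiffAt_fst.prodMk ((contMDiffAt_extChartAt' hq).comp q contMDiffAt_snd)

theorem chartCoord_chartParam {m : M} {p : ℝ × E}
    (hp : p.2 ∈ (extChartAt 𝓘(ℝ, E) m).target) : chartCoord E m (chartParam E m p) = p :=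
  Prod.ext rfl ((extChartAt 𝓘(ℝ, E) m).right_inv hp)

theorem chartParam_chartCoord {m : M} {q : ℝ × M} (hq : q.2 ∈ (chartAt E m).source) :
    chartParam E m (chartCoord E m q) = q := chartParam_extChartAt hq

theorem chartCoord_mem {m : M} {q : ℝ × M} (hq : q.2 ∈ (chartAt E m).source) :
    (chartCoord E m q).2 ∈ (extChartAt 𝓘(ℝ, E) m).target :=
  (extChartAt 𝓘(ℝ, E) m).map_source (by simpa using hq)

namespace LiftedContraction

variable {L : LieAlgebroid E F A} {m₀ : M} (H : L.LiftedContraction m₀)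

/-- Smoothness at `q` of a section of `A` along the contraction. -/
def SmoothAt (s : ∀ q, A (H.map q)) (q : ℝ × M) : Prop :=
  ContMDiffAt (𝓘(ℝ, ℝ).prod 𝓘(ℝ, E)) (𝓘(ℝ, E).prod 𝓘(ℝ, F)) ∞
    (fun q => (⟨H.map q, s q⟩ : TotalSpace F A)) q

/-- The contraction in the chart at `m` on the source and the chart at `x₀` on the target. -/
def base (m x₀ : M) (p : ℝ × E) : E := extChartAt 𝓘(ℝ, E) x₀ (H.map (chartParam E m p))

/-- A section along the contraction in the chart at `m` and the frame at `x₀`. -/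
def rep (m x₀ : M) (s : ∀ q, A (H.map q)) (p : ℝ × E) : F :=
  coordAt F A x₀ (H.map (chartParam E m p)) (s (chartParam E m p))

/-- The domain of `H.base m x₀` and `H.rep m x₀ s`. -/
def repDomain (m x₀ : M) : Set (ℝ × E) :=
  {p | p.2 ∈ (extChartAt 𝓘(ℝ, E) m).target ∧ H.map (chartParam E m p) ∈ frameSource E F A x₀}

variable {H} {m x₀ x₁ : M} {s s' : ∀ q, A (H.map q)} {v w p : ℝ × E}

theorem isOpen_repDomain : IsOpen (H.repDomain m x₀) := by
  rw [isOpen_iff_mem_nhds]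
  intro p hp
  refine inter_mem (continuousAt_snd.preimage_mem_nhds
    ((isOpen_extChartAt_target m).mem_nhds hp.1)) ?_
  exact (H.contMDiff_map.continuous.continuousAt.comp
    (continuousAt_chartParam hp.1)).preimage_mem_nhds ((isOpen_frameSource x₀).mem_nhds hp.2)

theorem contMDiffAt_map_chartParam (hp : p.2 ∈ (extChartAt 𝓘(ℝ, E) m).target) :
    ContMDiffAt 𝓘(ℝ, ℝ × E) 𝓘(ℝ, E) ∞ (fun q => H.map (chartParam E m q)) p :=
  H.contMDiff_map.contMDiffAt.comp _ (contMDiffAt_chartParam hp)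

theorem base_mem (hp : p ∈ H.repDomain m x₀) : H.base m x₀ p ∈ frameDomain E F A x₀ :=
  map_mem_frameDomain hp.2

theorem contDiffAt_base (hp : p ∈ H.repDomain m x₀) : ContDiffAt ℝ ∞ (H.base m x₀) p :=
  contDiffAt_extChartAt_comp (contMDiffAt_map_chartParam hp.1) hp.2.1

theorem contDiffAt_rep (hp : p ∈ H.repDomain m x₀) (hs : H.SmoothAt s (chartParam E m p)) :
    ContDiffAt ℝ ∞ (H.rep m x₀ s) p := by
  rw [← contMDiffAt_iff_contDiffAt]
  exact ((contMDiffAt_iff_coordAt (f := fun q => H.map (chartParam E m q))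
    (s := fun q => s (chartParam E m q)) hp.2.2).1 (ContMDiffAt.comp p hs (contMDiffAt_chartParam hp.1))).2

theorem smoothAt_of_contDiffAt_rep (hp : p ∈ H.repDomain m x₀)
    (hs : ContDiffAt ℝ ∞ (H.rep m x₀ s) p) : H.SmoothAt s (chartParam E m p) := by
  refine (contMDiffAt_iff_coordAt hp.2.2).2 ⟨H.contMDiff_map _, ?_⟩
  have h1 : ContMDiffAt (𝓘(ℝ, ℝ).prod 𝓘(ℝ, E)) 𝓘(ℝ, F) ∞
      (fun q => H.rep m x₀ s (chartCoord E m q)) (chartParam E m p) := by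
    have h2 : ContMDiffAt 𝓘(ℝ, ℝ × E) 𝓘(ℝ, F) ∞ (H.rep m x₀ s)
        (chartCoord E m (chartParam E m p)) := by
      rw [chartCoord_chartParam hp.1]
      exact hs.contMDiffAt
    exact h2.comp _ (contMDiffAt_chartCoord (chartParam_snd_mem hp.1))
  refine h1.congr_of_eventuallyEq ?_
  filter_upwards [continuousAt_snd.preimage_mem_nhds ((chartAt E m).open_source.mem_nhds
    (chartParam_snd_mem hp.1))] with q hq
  rw [rep, chartParam_chartCoord hq]

variable (H) in
/-- The section `s` along the contraction lifts the constant vector field `w` at the point `p` of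
the chart at `m`. -/
def LiftsAt (m : M) (s : ∀ q, A (H.map q)) (w p : ℝ × E) : Prop :=
  L.anchor _ (s (chartParam E m p)) =
    mfderiv 𝓘(ℝ, ℝ × E) 𝓘(ℝ, E) (fun q => H.map (chartParam E m q)) p w

/-- The derivative of a chart is injective, so the condition in one frame loses nothing.
Computations use the coordinate form; changes of frame pass through the invariant one. -/
theorem liftsAt_iff (hp : p ∈ H.repDomain m x₀) : H.LiftsAt m s w p ↔
    L.anchorRep x₀ (H.base m x₀ p) (H.rep m x₀ s p) = fderiv ℝ (H.base m x₀) p w := by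
  have h1 : fderiv ℝ (H.base m x₀) p w = _ :=
    fderiv_extChartAt_comp (contMDiffAt_map_chartParam hp.1) hp.2.1 w
  have h2 : L.anchorRep x₀ (H.base m x₀ p) (H.rep m x₀ s p) = _ :=
    L.anchorRep_coordAt hp.2 (s (chartParam E m p))
  rw [h1, h2, (chartDeriv_injective hp.2.1).eq_iff]
  rfl

theorem liftsAt_vel (hp : p.2 ∈ (extChartAt 𝓘(ℝ, E) m).target) :
    H.LiftsAt m H.vel (1, 0) p := by
  rw [LiftsAt, H.anchor_vel, mfderiv_comp_chartParam_time H.contMDiff_map hp]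
  rfl

theorem smoothAt_vel (q : ℝ × M) : H.SmoothAt H.vel q := H.contMDiff_vel q

variable (H) in
/-- The bracket of two sections along the contraction in the chart at `m` and the frame at `x₀`. -/
def bracketIn (m x₀ : M) (v : ℝ × E) (s : ∀ q, A (H.map q)) (w : ℝ × E) (s' : ∀ q, A (H.map q))
    (p : ℝ × E) : F :=
  bracketAlong (L.bracketRep x₀) (H.base m x₀) v (H.rep m x₀ s) w (H.rep m x₀ s') p

theorem frameChange_rep (hp : p ∈ H.repDomain m x₀) :
    frameChange E F A x₀ x₁ (H.base m x₀ p) (H.rep m x₀ s p) = H.rep m x₁ s p :=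
  frameChange_coordAt hp.2 _

/-- The bracket of sections along the contraction that lift constant vector fields does not depend
on the frame. -/
theorem frameChange_bracketIn (hp : p ∈ H.repDomain m x₀) (hp₁ : p ∈ H.repDomain m x₁)
    (hs : H.SmoothAt s (chartParam E m p)) (hs' : H.SmoothAt s' (chartParam E m p))
    (hv : H.LiftsAt m s v p) (hw : H.LiftsAt m s' w p) :
    H.bracketIn m x₁ v s w s' p =
      frameChange E F A x₀ x₁ (H.base m x₀ p) (H.bracketIn m x₀ v s w s' p) := by
  have h1 : ∀ s : ∀ q, A (H.map q), ∀ᶠ q in 𝓝 p,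
      H.rep m x₁ s q = frameChange E F A x₀ x₁ (H.base m x₀ q) (H.rep m x₀ s q) := fun s => by
    filter_upwards [isOpen_repDomain.mem_nhds hp] with q hq using (frameChange_rep hq).symm
  exact bracketAlong_frameChange ((contDiffAt_frameChange hp.2 hp₁.2).differentiableAt (by simp))
    ((contDiffAt_base hp).differentiableAt (by simp))
    ((contDiffAt_rep hp hs).differentiableAt (by simp))
    ((contDiffAt_rep hp hs').differentiableAt (by simp)) ((liftsAt_iff hp).1 hv)
    ((liftsAt_iff hp).1 hw) (h1 s) (h1 s') (L.bracketRep_frameChange hp.2 hp₁.2)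

variable (H) in
/-- The section `u` along the contraction lifts the constant vector field `X` on `M` and commutes
with the velocity, near the point `p` of the chart at `m`. -/
structure IsTransportedAt (m : M) (X : E) (u : ∀ q, A (H.map q)) (p : ℝ × E) : Prop where
  mem : p.2 ∈ (extChartAt 𝓘(ℝ, E) m).target
  smooth : H.SmoothAt u (chartParam E m p)
  lifts : H.LiftsAt m u (0, X) p
  comm : ∀ x₀, p ∈ H.repDomain m x₀ → H.bracketIn m x₀ (1, 0) H.vel (0, X) u p = 0

/-- One frame suffices: for sections that lift vector fields, the bracket in another frame is the
image of this one under a linear map, and zero goes to zero. -/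
theorem IsTransportedAt.of_frame {X : E} {u : ∀ q, A (H.map q)} (hp : p ∈ H.repDomain m x₀)
    (hs : ContDiffAt ℝ ∞ (H.rep m x₀ u) p)
    (hl : L.anchorRep x₀ (H.base m x₀ p) (H.rep m x₀ u p) = fderiv ℝ (H.base m x₀) p (0, X))
    (hb : H.bracketIn m x₀ (1, 0) H.vel (0, X) u p = 0) : H.IsTransportedAt m X u p where
  mem := hp.1
  smooth := smoothAt_of_contDiffAt_rep hp hs
  lifts := (liftsAt_iff hp).2 hl
  comm x₁ hp₁ := by
    rw [frameChange_bracketIn hp hp₁ (smoothAt_vel _) (smoothAt_of_contDiffAt_rep hp hs)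
      (liftsAt_vel hp.1) ((liftsAt_iff hp).2 hl), hb, _root_.map_zero]

theorem rep_eventuallyEq (hp : p.2 ∈ (extChartAt 𝓘(ℝ, E) m).target)
    (h : ∀ᶠ q in 𝓝 (chartParam E m p), s q = s' q) (x₀ : M) :
    H.rep m x₀ s =ᶠ[𝓝 p] H.rep m x₀ s' := by
  filter_upwards [(continuousAt_chartParam hp).eventually h] with q hq
  rw [rep, rep, hq]

theorem IsTransportedAt.congr {X : E} {u u' : ∀ q, A (H.map q)} (h : H.IsTransportedAt m X u p)
    (hu : ∀ᶠ q in 𝓝 (chartParam E m p), u' q = u q) : H.IsTransportedAt m X u' p := by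
  have hp : p ∈ H.repDomain m (H.map (chartParam E m p)) := ⟨h.mem, mem_frameSource _⟩
  have h1 := rep_eventuallyEq h.mem hu (H.map (chartParam E m p))
  refine .of_frame hp ((contDiffAt_rep hp h.smooth).congr_of_eventuallyEq h1) ?_ ?_
  · rw [h1.self_of_nhds]
    exact (liftsAt_iff hp).1 h.lifts
  · rw [← h.comm _ hp]
    exact bracketAlong_congr EventuallyEq.rfl EventuallyEq.rfl h1

/-- All transport conditions are jointly linear in `X` and `u`. With the next lemmas, this reduces
transport of a whole vector space to transport of a finite basis. -/
theorem IsTransportedAt.add {X X' : E} {u u' : ∀ q, A (H.map q)} (h : H.IsTransportedAt m X u p)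
    (h' : H.IsTransportedAt m X' u' p) : H.IsTransportedAt m (X + X') (u + u') p := by
  have hp : p ∈ H.repDomain m (H.map (chartParam E m p)) := ⟨h.mem, mem_frameSource _⟩
  have h1 : ∀ x₀, H.rep m x₀ (u + u') = fun p => H.rep m x₀ u p + H.rep m x₀ u' p := fun x₀ => by
    funext p
    simp only [rep, Pi.add_apply, map_add]
  have h2 : ((0, X + X') : ℝ × E) = (0, X) + (0, X') := by simp
  have h3 := contDiffAt_rep hp h.smooth
  have h4 := contDiffAt_rep hp h'.smooth
  refine .of_frame hp ?_ ?_ ?_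
  · rw [h1]
    exact h3.add h4
  · rw [h1, h2, map_add, map_add, (liftsAt_iff hp).1 h.lifts, (liftsAt_iff hp).1 h'.lifts]
  · have h5 := h.comm _ hp
    have h6 := h'.comm _ hp
    rw [bracketIn, bracketAlong] at h5 h6 ⊢
    rw [h1, h2, map_add, map_add, fderiv_fun_add (h3.differentiableAt (by simp))
      (h4.differentiableAt (by simp)), add_apply, ← add_zero (0 : F)]
    nth_rewrite 2 [← h5]
    rw [← h6]
    abel

theorem IsTransportedAt.smul {X : E} {u : ∀ q, A (H.map q)} (h : H.IsTransportedAt m X u p)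
    (c : ℝ) : H.IsTransportedAt m (c • X) (c • u) p := by
  have hp : p ∈ H.repDomain m (H.map (chartParam E m p)) := ⟨h.mem, mem_frameSource _⟩
  have h1 : ∀ x₀, H.rep m x₀ (c • u) = fun p => c • H.rep m x₀ u p := fun x₀ => by
    funext p
    simp only [rep, Pi.smul_apply, map_smul]
  have h2 : ((0, c • X) : ℝ × E) = c • (0, X) := by simp
  have h3 := contDiffAt_rep hp h.smooth
  refine .of_frame hp ?_ ?_ ?_
  · rw [h1]
    exact contDiffAt_const.smul h3
  · rw [h1, h2, map_smul, map_smul, (liftsAt_iff hp).1 h.lifts]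
  · have h5 := h.comm _ hp
    rw [bracketIn, bracketAlong] at h5 ⊢
    rw [h1, h2, map_smul, map_smul, fderiv_fun_const_smul (h3.differentiableAt (by simp)),
      smul_apply, ← smul_sub, ← smul_add, h5, smul_zero]

theorem isTransportedAt_zero (hp : p.2 ∈ (extChartAt 𝓘(ℝ, E) m).target) :
    H.IsTransportedAt m 0 0 p := by
  have hp : p ∈ H.repDomain m (H.map (chartParam E m p)) := ⟨hp, mem_frameSource _⟩
  have h1 : ∀ x₀, H.rep m x₀ 0 = fun p => 0 := fun x₀ => by
    funext p
    simp only [rep, Pi.zero_apply, _root_.map_zero]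
  have h2 : ((0, 0) : ℝ × E) = 0 := rfl
  refine .of_frame hp ?_ ?_ ?_
  · rw [h1]
    exact contDiffAt_const
  · rw [h1, h2, _root_.map_zero, _root_.map_zero]
  · rw [bracketIn, bracketAlong, h1, h2]
    simp

theorem IsTransportedAt.sum {ι : Type*} (I : Finset ι) {X : ι → E} {u : ι → ∀ q, A (H.map q)}
    (hp : p.2 ∈ (extChartAt 𝓘(ℝ, E) m).target) (h : ∀ i, H.IsTransportedAt m (X i) (u i) p) :
    H.IsTransportedAt m (∑ i ∈ I, X i) (∑ i ∈ I, u i) p := by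
  classical
  induction I using Finset.induction_on with
  | empty => simpa using isTransportedAt_zero hp
  | insert i I hi ih =>
    rw [Finset.sum_insert hi, Finset.sum_insert hi]
    exact (h i).add ih

end LiftedContraction

end LieAlgebroid

theorem ContDiffAt.clm_flip_apply {P G₁ G₂ G₃ : Type*} [NormedAddCommGroup P] [NormedSpace ℝ P]
    [NormedAddCommGroup G₁] [NormedSpace ℝ G₁] [NormedAddCommGroup G₂] [NormedSpace ℝ G₂]
    [NormedAddCommGroup G₃] [NormedSpace ℝ G₃] {κ : P → G₁ →L[ℝ] G₂ →L[ℝ] G₃} {a : P → G₂} {p : P}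
    (hκ : ContDiffAt ℝ ∞ κ p) (ha : ContDiffAt ℝ ∞ a p) :
    ContDiffAt ℝ ∞ (fun p => (κ p).flip (a p)) p := by
  have h1 : (fun p => (κ p).flip (a p)) =
      fun p => (ContinuousLinearMap.apply ℝ G₃ (a p)).comp (κ p) := rfl
  rw [h1]
  exact ((ContinuousLinearMap.apply ℝ G₃ (E := G₂)).contDiff.contDiffAt.comp p ha).clm_comp hκ

/-! ### The transport equation along a path: uniqueness and local existence -/

namespace LieAlgebroid

variable {E : Type*} [NormedAddCommGroup E] [NormedSpace ℝ E] [FiniteDimensional ℝ E]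
  {M : Type*} [TopologicalSpace M] [T2Space M] [ChartedSpace E M] [IsManifold 𝓘(ℝ, E) ∞ M]
  {F : Type*} [NormedAddCommGroup F] [NormedSpace ℝ F] [FiniteDimensional ℝ F]
  {A : M → Type*} [TopologicalSpace (TotalSpace F A)]
  [∀ x, AddCommGroup (A x)] [∀ x, Module ℝ (A x)] [∀ x, TopologicalSpace (A x)]
  [FiberBundle F A] [VectorBundle ℝ F A] [ContMDiffVectorBundle ∞ F A 𝓘(ℝ, E)]

namespace LiftedContraction

variable {L : LieAlgebroid E F A} {m₀ : M} (H : L.LiftedContraction m₀)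

/-- The transport equation at time `t` for a section `w` along the path of `x` under the contraction
that lifts the image of the tangent vector `v`. -/
def IsParallelAt (x : M) (v : TangentSpace 𝓘(ℝ, E) x) (w : ∀ t : ℝ, A (H.map (t, x))) (t : ℝ) :
    Prop :=
  ∀ x₀, H.map (t, x) ∈ frameSource E F A x₀ →
    HasDerivAt (fun τ => coordAt F A x₀ (H.map (τ, x)) (w τ))
      (mvfderiv 𝓘(ℝ, E) (fun z => coordAt F A x₀ (H.map (t, z)) (H.vel (t, z))) x v -
        L.bracketRep x₀ (extChartAt 𝓘(ℝ, E) x₀ (H.map (t, x)))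
          (coordAt F A x₀ (H.map (t, x)) (H.vel (t, x)))
          (coordAt F A x₀ (H.map (t, x)) (w t))) t

variable {H} {m x₀ : M}

theorem contMDiffAt_coordAt_vel {q : ℝ × M} (hq : H.map q ∈ (trivializationAt F A x₀).baseSet) :
    ContMDiffAt (𝓘(ℝ, ℝ).prod 𝓘(ℝ, E)) 𝓘(ℝ, F) ∞
      (fun q => coordAt F A x₀ (H.map q) (H.vel q)) q :=
  ((contMDiffAt_iff_coordAt (f := H.map) hq).1 (H.contMDiff_vel q)).2

theorem rep_extChartAt {s : ∀ q, A (H.map q)} {x : M} (hx : x ∈ (chartAt E m).source) (t : ℝ) :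
    H.rep m x₀ s (t, extChartAt 𝓘(ℝ, E) m x) = coordAt F A x₀ (H.map (t, x)) (s (t, x)) := by
  rw [rep, chartParam_extChartAt (q := (t, x)) hx]

theorem base_extChartAt {x : M} (hx : x ∈ (chartAt E m).source) (t : ℝ) :
    H.base m x₀ (t, extChartAt 𝓘(ℝ, E) m x) = extChartAt 𝓘(ℝ, E) x₀ (H.map (t, x)) := by
  rw [base, chartParam_extChartAt (q := (t, x)) hx]

theorem mem_repDomain {x : M} (hx : x ∈ (chartAt E m).source) {t : ℝ}
    (hx₀ : H.map (t, x) ∈ frameSource E F A x₀) :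
    (t, extChartAt 𝓘(ℝ, E) m x) ∈ H.repDomain m x₀ :=
  ⟨chartCoord_mem (q := (t, x)) hx, by rwa [chartParam_extChartAt (q := (t, x)) hx]⟩

theorem fderiv_rep_vel {x : M} (hx : x ∈ (chartAt E m).source) {t : ℝ}
    (hx₀ : H.map (t, x) ∈ frameSource E F A x₀) (v : TangentSpace 𝓘(ℝ, E) x) :
    mvfderiv 𝓘(ℝ, E) (fun z => coordAt F A x₀ (H.map (t, z)) (H.vel (t, z))) x v =
      fderiv ℝ (H.rep m x₀ H.vel) (t, extChartAt 𝓘(ℝ, E) m x) (0, chartDeriv E m x v) := by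
  have h1 := contDiffAt_rep (mem_repDomain hx hx₀) (smoothAt_vel _)
  rw [← fderiv_space (h1.differentiableAt (by simp))]
  have h2 : ContMDiffAt 𝓘(ℝ, E) (𝓘(ℝ, ℝ).prod 𝓘(ℝ, E)) ∞ (fun z : M => (t, z)) x :=
    contMDiffAt_const.prodMk contMDiffAt_id
  exact mvfderiv_eq_fderiv_chart hx ((contMDiffAt_coordAt_vel (q := (t, x)) hx₀.2).comp x h2) v

/-- The chart at `m` disappears from the equation: only the path of `x` and the tangent vector `v`
remain. Solutions constructed in different charts thereby become comparable. -/
theorem IsTransportedAt.isParallelAt {X : E} {u : ∀ q, A (H.map q)} {x : M} {t : ℝ}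
    (hx : x ∈ (chartAt E m).source) {v : TangentSpace 𝓘(ℝ, E) x} (hv : chartDeriv E m x v = X)
    (h : H.IsTransportedAt m X u (t, extChartAt 𝓘(ℝ, E) m x)) :
    H.IsParallelAt x v (fun t => u (t, x)) t := by
  intro x₀ hx₀
  have hp := mem_repDomain hx hx₀
  have h1 := hasDerivAt_time ((contDiffAt_rep hp h.smooth).differentiableAt (by simp))
  simp only [rep_extChartAt hx] at h1
  convert h1 using 1
  have h2 := h.comm _ hp
  rw [bracketIn, bracketAlong, rep_extChartAt hx, rep_extChartAt hx, base_extChartAt hx, ← hv,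
    ← fderiv_rep_vel hx hx₀] at h2
  rw [sub_add_eq_add_sub, sub_eq_zero] at h2
  rw [← h2]
  abel

theorem continuousOn_bracketRep_vel {x : M} {J : Set ℝ}
    (hJ : ∀ t ∈ J, H.map (t, x) ∈ frameSource E F A x₀) :
    ContinuousOn (fun t => -L.bracketRep x₀ (extChartAt 𝓘(ℝ, E) x₀ (H.map (t, x)))
      (coordAt F A x₀ (H.map (t, x)) (H.vel (t, x)))) J := by
  intro t ht
  refine ContinuousAt.continuousWithinAt (ContinuousAt.neg ?_)
  have h1 : ContinuousAt (fun t : ℝ => (t, x)) t := (continuous_id.prodMk continuous_const).continuousAt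
  have h2 : ContinuousAt (fun t => H.map (t, x)) t :=
    H.contMDiff_map.continuous.continuousAt.comp h1
  have h3 : ContinuousAt (fun t => extChartAt 𝓘(ℝ, E) x₀ (H.map (t, x))) t :=
    ContinuousAt.comp (continuousAt_extChartAt' (by simpa using (hJ t ht).1)) h2
  have h4 : ContinuousAt (L.bracketRep x₀) (extChartAt 𝓘(ℝ, E) x₀ (H.map (t, x))) :=
    (L.contDiffOn_bracketRep x₀).continuousOn.continuousAt
      ((isOpen_frameDomain x₀).mem_nhds (map_mem_frameDomain (hJ t ht)))
  have h5 : ContinuousAt (fun t => coordAt F A x₀ (H.map (t, x)) (H.vel (t, x))) t :=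
    ContinuousAt.comp (f := fun t : ℝ => (t, x))
      (contMDiffAt_coordAt_vel (q := (t, x)) (hJ t ht).2).continuousAt h1
  exact (ContinuousAt.comp (f := fun t => extChartAt 𝓘(ℝ, E) x₀ (H.map (t, x))) h4 h3).clm_apply h5

/-- Uniqueness of solutions of the transport equation. -/
theorem eq_of_isParallelAt {x : M} {v : TangentSpace 𝓘(ℝ, E) x} {w w' : ∀ t : ℝ, A (H.map (t, x))}
    {J : Set ℝ} (hJ : IsOpen J) (hJc : IsPreconnected J) (h : ∀ t ∈ J, H.IsParallelAt x v w t)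
    (h' : ∀ t ∈ J, H.IsParallelAt x v w' t) {t₀ : ℝ} (ht₀ : t₀ ∈ J) (heq : w t₀ = w' t₀) :
    ∀ t ∈ J, w t = w' t := by
  -- While the path stays in one frame, the difference of the solutions satisfies a homogeneous
  -- linear equation, since the source terms cancel. Equality is thus a locally constant property of
  -- time, and connectedness removes the dependence on the frame.
  have hloc : ∀ t ∈ J, ∀ᶠ s in 𝓝[J] t, (w t = w' t ↔ w s = w' s) := by
    intro t ht
    set x₀ := H.map (t, x)
    have h2 : ContinuousAt (fun t => H.map (t, x)) t :=
      (H.contMDiff_map.continuous.comp (continuous_id.prodMk continuous_const)).continuousAt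
    have hn : J ∩ (fun t => H.map (t, x)) ⁻¹' frameSource E F A x₀ ∈ 𝓝 t :=
      inter_mem (hJ.mem_nhds ht)
        (h2.preimage_mem_nhds ((isOpen_frameSource x₀).mem_nhds (mem_frameSource x₀)))
    obtain ⟨δ, hδ, hball⟩ := Metric.mem_nhds_iff.1 hn
    have hkey : ∀ s ∈ Metric.ball t δ, ∀ s' ∈ Metric.ball t δ, w s = w' s → w s' = w' s' := by
      intro s hs s' hs' hws
      have h3 := eq_zero_of_linear_ode (J := Metric.ball t δ)
        (u := fun τ => coordAt F A x₀ (H.map (τ, x)) (w τ) - coordAt F A x₀ (H.map (τ, x)) (w' τ))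
        (B := fun t => -L.bracketRep x₀ (extChartAt 𝓘(ℝ, E) x₀ (H.map (t, x)))
          (coordAt F A x₀ (H.map (t, x)) (H.vel (t, x)))) Metric.isOpen_ball
        (convex_ball t δ).isPreconnected
        (continuousOn_bracketRep_vel fun τ hτ => (hball hτ).2)
        (fun τ hτ => by
          have h4 := (h τ (hball hτ).1 x₀ (hball hτ).2).fun_sub (h' τ (hball hτ).1 x₀ (hball hτ).2)
          convert h4 using 1
          rw [neg_apply, map_sub]
          abel) hs (by simp [hws]) s' hs'
      have h5 := (hball hs').2.2
      rw [← frameAt_coordAt h5 (w s'), sub_eq_zero.1 h3, frameAt_coordAt h5]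
    filter_upwards [mem_nhdsWithin_of_mem_nhds (Metric.ball_mem_nhds t hδ)] with s hs
    exact ⟨hkey t (Metric.mem_ball_self hδ) s hs, hkey s hs t (Metric.mem_ball_self hδ)⟩
  intro t ht
  exact (hJc.induction₂ (fun s t => (w s = w' s ↔ w t = w' t)) hloc
    (fun _ _ _ _ _ _ => Iff.trans) (fun _ _ _ _ => Iff.symm) ht₀ ht).1 heq

theorem eventually_liftsAt_vel {p : ℝ × E} (hp : p ∈ H.repDomain m x₀) :
    ∀ᶠ q in 𝓝 p, L.anchorRep x₀ (H.base m x₀ q) (H.rep m x₀ H.vel q) =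
      fderiv ℝ (H.base m x₀) q (1, 0) := by
  filter_upwards [isOpen_repDomain.mem_nhds hp] with q hq
  exact (liftsAt_iff hq).1 (liftsAt_vel hq.1)

/-- Local existence of transported sections. -/
theorem exists_local_transport {T : ℝ} {y₀ : E} (hp₀ : (T, y₀) ∈ H.repDomain m x₀) (X : E) :
    ∃ δ > 0, Ioo (T - δ) (T + δ) ×ˢ Metric.ball y₀ δ ⊆ H.repDomain m x₀ ∧
      ∀ t₁ ∈ Ioo (T - δ) (T + δ), ∀ V ⊆ Metric.ball y₀ δ, IsOpen V → ∀ s₁ : ∀ q, A (H.map q),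
        ContDiffOn ℝ ∞ (fun y => H.rep m x₀ s₁ (t₁, y)) V →
        (∀ y ∈ V, H.LiftsAt m s₁ (0, X) (t₁, y)) →
        ∃ u : ∀ q, A (H.map q),
          (∀ y ∈ V, u (chartParam E m (t₁, y)) = s₁ (chartParam E m (t₁, y))) ∧
          ∀ p ∈ Ioo (T - δ) (T + δ) ×ˢ V, H.IsTransportedAt m X u p := by
  have : CompleteSpace F := FiniteDimensional.complete ℝ F
  let C := L.bracketRep x₀
  let f := H.base m x₀
  let a := H.rep m x₀ H.vel
  have hM := L.isAlgebroidModel x₀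
  have hf : ∀ p ∈ H.repDomain m x₀, ContDiffAt ℝ ∞ f p := fun p hp => contDiffAt_base hp
  have ha : ∀ p ∈ H.repDomain m x₀, ContDiffAt ℝ ∞ a p := fun p hp =>
    contDiffAt_rep hp (smoothAt_vel _)
  have hC : ∀ p ∈ H.repDomain m x₀, ContDiffAt ℝ ∞ (fun p => C (f p)) p := fun p hp =>
    ContDiffAt.comp (f := f) p ((L.contDiffOn_bracketRep x₀).contDiffAt
      ((isOpen_frameDomain x₀).mem_nhds (base_mem hp))) (hf p hp)
  -- Commuting with the velocity, solved for the time derivative, reads `∂_t u = ∂_X a - C a u`. No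
  -- spatial derivative of `u` occurs, so `y` is only a parameter.
  obtain ⟨δ, hδ, hbox, hsol⟩ := exists_linear_ode_solution (B := fun p => -(C (f p) (a p)))
    (c := fun p => fderiv ℝ a p ((0, X) : ℝ × E)) (isOpen_repDomain (H := H) (m := m) (x₀ := x₀))
    (fun p hp => (((hC p hp).clm_apply (ha p hp)).neg).contDiffWithinAt)
    (fun p hp => (((ha p hp).fderiv_right (m := ∞) (by simp)).clm_apply
      contDiffAt_const).contDiffWithinAt) hp₀
  refine ⟨δ, hδ, hbox, fun t₁ ht₁ V hV hVo s₁ hs₁ hl₁ => ?_⟩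
  obtain ⟨û, hû, hû₁, hode⟩ := hsol t₁ ht₁ V hV (fun y => H.rep m x₀ s₁ (t₁, y)) hs₁
  let u : ∀ q, A (H.map q) := fun q => frameAt F A x₀ (H.map q) (û (chartCoord E m q))
  have hD : ∀ t ∈ Ioo (T - δ) (T + δ), ∀ y ∈ V, (t, y) ∈ H.repDomain m x₀ := fun t ht y hy =>
    hbox ⟨ht, hV hy⟩
  have hrep : ∀ p ∈ H.repDomain m x₀, H.rep m x₀ u p = û p := fun p hp => by
    change coordAt F A x₀ _ (frameAt F A x₀ _ (û (chartCoord E m (chartParam E m p)))) = _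
    rw [chartCoord_chartParam hp.1, coordAt_frameAt hp.2.2]
  have hrep' : ∀ p ∈ H.repDomain m x₀, H.rep m x₀ u =ᶠ[𝓝 p] û := fun p hp => by
    filter_upwards [isOpen_repDomain.mem_nhds hp] with q hq using hrep q hq
  have hus : ∀ t ∈ Ioo (T - δ) (T + δ), ∀ y ∈ V, ContDiffAt ℝ ∞ (H.rep m x₀ u) (t, y) :=
    fun t ht y hy => (hû.contDiffAt ((isOpen_Ioo.prod hVo).mem_nhds
      ⟨ht, hy⟩)).congr_of_eventuallyEq (hrep' _ (hD t ht y hy))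
  have hbr : ∀ t ∈ Ioo (T - δ) (T + δ), ∀ y ∈ V,
      H.bracketIn m x₀ (1, 0) H.vel (0, X) u (t, y) = 0 := fun t ht y hy => by
    have h1 := hasDerivAt_time ((hû.contDiffAt ((isOpen_Ioo.prod hVo).mem_nhds
      ⟨ht, hy⟩)).differentiableAt (by simp))
    have h2 := h1.unique (hode t ht y hy)
    have h3 := hrep' _ (hD t ht y hy)
    rw [bracketIn, bracketAlong, h3.fderiv_eq, h2, hrep _ (hD t ht y hy), neg_apply]
    abel
  refine ⟨u, fun y hy => ?_, ?_⟩
  · have h1 : H.rep m x₀ u (t₁, y) = H.rep m x₀ s₁ (t₁, y) := by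
      rw [hrep _ (hD t₁ ht₁ y hy), hû₁ y hy]
    have h2 := (hD t₁ ht₁ y hy).2.2
    rw [← frameAt_coordAt h2 (s₁ _), ← frameAt_coordAt h2 (u _)]
    exact congrArg _ h1
  · rintro ⟨t, y⟩ ⟨ht, hy⟩
    refine .of_frame (hD t ht y hy) (hus t ht y hy) ?_ (hbr t ht y hy)
    -- The lifting defect solves a homogeneous linear equation in time and vanishes at `t₁`.
    rw [← sub_eq_zero]
    refine eq_zero_of_linear_ode (J := Ioo (T - δ) (T + δ))
      (u := fun τ => L.anchorRep x₀ (f (τ, y)) (H.rep m x₀ u (τ, y)) - fderiv ℝ f (τ, y) (0, X))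
      (B := fun τ => (fderiv ℝ (L.anchorRep x₀) (f (τ, y))).flip (a (τ, y)))
      isOpen_Ioo isPreconnected_Ioo ?_ ?_ ht₁ ?_ t ht
    · intro τ hτ
      have hp := hD τ hτ y hy
      have h1 : ContinuousAt (fun τ : ℝ => (τ, y)) τ :=
        (continuous_id.prodMk continuous_const).continuousAt
      have h2 : ContDiffAt ℝ ∞ (fun p => (fderiv ℝ (L.anchorRep x₀) (f p)).flip (a p)) (τ, y) := by
        have h3 : ContDiffAt ℝ ∞ (fun p => fderiv ℝ (L.anchorRep x₀) (f p)) (τ, y) :=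
          ContDiffAt.comp (f := f) (τ, y) (((L.contDiffOn_anchorRep x₀).contDiffAt
            ((isOpen_frameDomain x₀).mem_nhds (base_mem hp))).fderiv_right (m := ∞) (by simp))
            (hf _ hp)
        exact h3.clm_flip_apply (ha _ hp)
      exact (h2.continuousAt.comp (f := fun τ : ℝ => (τ, y)) h1).continuousWithinAt
    · intro τ hτ
      have hp := hD τ hτ y hy
      exact hM.hasDerivAt_lift_defect (base_mem hp) (hf _ hp) (ha _ hp) (hus τ hτ y hy)
        (eventually_liftsAt_vel hp) (hbr τ hτ y hy)
    · have hp := hD t₁ ht₁ y hy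
      rw [sub_eq_zero, hrep _ hp, hû₁ y hy]
      exact (liftsAt_iff hp).1 (hl₁ y hy)

end LiftedContraction

end LieAlgebroid

/-! ### Transport from time `0` to time `1` -/

namespace LieAlgebroid

variable {E : Type*} [NormedAddCommGroup E] [NormedSpace ℝ E] [FiniteDimensional ℝ E]
  {M : Type*} [TopologicalSpace M] [T2Space M] [ChartedSpace E M] [IsManifold 𝓘(ℝ, E) ∞ M]
  {F : Type*} [NormedAddCommGroup F] [NormedSpace ℝ F] [FiniteDimensional ℝ F]
  {A : M → Type*} [TopologicalSpace (TotalSpace F A)]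
  [∀ x, AddCommGroup (A x)] [∀ x, Module ℝ (A x)] [∀ x, TopologicalSpace (A x)]
  [FiberBundle F A] [VectorBundle ℝ F A] [ContMDiffVectorBundle ∞ F A 𝓘(ℝ, E)]

theorem chartDeriv_surjective {x₀ x : M} (hx : x ∈ (chartAt E x₀).source) :
    Function.Surjective (chartDeriv E x₀ x) :=
  (isInvertible_mfderiv_extChartAt (I := 𝓘(ℝ, E)) (by simpa using hx)).surjective

namespace LiftedContraction

variable {L : LieAlgebroid E F A} {m₀ : M} {H : L.LiftedContraction m₀} {m : M}

theorem eq_of_isTransportedAt {X : E} {u u' : ∀ q, A (H.map q)} {J : Set ℝ} {y : E}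
    (hJ : IsOpen J) (hJc : IsPreconnected J) (hu : ∀ t ∈ J, H.IsTransportedAt m X u (t, y))
    (hu' : ∀ t ∈ J, H.IsTransportedAt m X u' (t, y)) {t₀ : ℝ} (ht₀ : t₀ ∈ J)
    (h : u (chartParam E m (t₀, y)) = u' (chartParam E m (t₀, y))) :
    ∀ t ∈ J, u (chartParam E m (t, y)) = u' (chartParam E m (t, y)) := by
  have hy : y ∈ (extChartAt 𝓘(ℝ, E) m).target := (hu t₀ ht₀).mem
  set x := (extChartAt 𝓘(ℝ, E) m).symm y with hxy
  have hx : x ∈ (chartAt E m).source := chartParam_snd_mem (p := (t₀, y)) hy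
  have hyx : extChartAt 𝓘(ℝ, E) m x = y := (extChartAt 𝓘(ℝ, E) m).right_inv hy
  obtain ⟨v, hv⟩ := chartDeriv_surjective hx X
  refine eq_of_isParallelAt (v := v) (w := fun t => u (t, x)) (w' := fun t => u' (t, x)) hJ hJc
    (fun t ht => ?_) (fun t ht => ?_) ht₀ h
  · exact IsTransportedAt.isParallelAt hx hv (by rw [hyx]; exact hu t ht)
  · exact IsTransportedAt.isParallelAt hx hv (by rw [hyx]; exact hu' t ht)

variable (H) in
/-- The initial condition `ξ` at time `0` for sections along the contraction. -/
def HasInitialValue (m : M) (u : ∀ q, A (H.map q)) (ξ : A m₀) (y : E) : Prop :=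
  H.rep m m₀ u (0, y) = coordAt F A m₀ m₀ ξ

variable (H) in
/-- Near `m`, there is a transported section with initial value `ξ` up to time `T`. -/
def TransportsTo (m : M) (X : E) (ξ : A m₀) (T : ℝ) : Prop :=
  ∃ ε > 0, ∃ u : ∀ q, A (H.map q),
    (∀ y ∈ Metric.ball (extChartAt 𝓘(ℝ, E) m m) ε, H.HasInitialValue m u ξ y) ∧
    ∀ p ∈ Ioo (-ε) (T + ε) ×ˢ Metric.ball (extChartAt 𝓘(ℝ, E) m m) ε, H.IsTransportedAt m X u p

theorem map_chartParam_zero (y : E) : H.map (chartParam E m (0, y)) = m₀ := H.map_zero _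

theorem mem_repDomain_zero {y : E} (hy : y ∈ (extChartAt 𝓘(ℝ, E) m).target) :
    ((0 : ℝ), y) ∈ H.repDomain m m₀ :=
  ⟨hy, by rw [map_chartParam_zero]; exact mem_frameSource m₀⟩

theorem base_zero (y : E) : H.base m m₀ (0, y) = extChartAt 𝓘(ℝ, E) m₀ m₀ := by
  rw [base, map_chartParam_zero]

/-- At time `0` the contraction is constant in space. Lifting `(0, X)` there therefore means having
zero anchor, whatever `X` is. -/
theorem fderiv_base_zero {y : E} (hy : y ∈ (extChartAt 𝓘(ℝ, E) m).target) (X : E) :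
    fderiv ℝ (H.base m m₀) (0, y) (0, X) = 0 := by
  rw [← fderiv_space ((contDiffAt_base (mem_repDomain_zero hy)).differentiableAt (by simp))]
  simp [base_zero]

/-- The initial section has the constant coordinates of `ξ`. Both sides of its lifting condition at
time `0` vanish: one because `ξ` is isotropic, the other because the contraction is constant. -/
theorem transportsTo_zero (m : M) (X : E) {ξ : A m₀} (hξ : L.anchor m₀ ξ = 0) :
    H.TransportsTo m X ξ 0 := by
  obtain ⟨δ, hδ, hbox, hsol⟩ := exists_local_transport (H := H)
    (mem_repDomain_zero (mem_extChartAt_target (I := 𝓘(ℝ, E)) m)) X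
  let s₁ : ∀ q, A (H.map q) := fun q => frameAt F A m₀ (H.map q) (coordAt F A m₀ m₀ ξ)
  have hs₁ : ∀ y, H.rep m m₀ s₁ (0, y) = coordAt F A m₀ m₀ ξ := fun y => by
    refine coordAt_frameAt ?_ _
    rw [map_chartParam_zero]
    exact (mem_frameSource (E := E) (F := F) (A := A) m₀).2
  have h0 : (0 : ℝ) ∈ Ioo (0 - δ) (0 + δ) := by simpa using hδ
  obtain ⟨u, hu, hu'⟩ := hsol 0 h0 _ subset_rfl Metric.isOpen_ball s₁
    (by simp only [hs₁]; exact contDiffOn_const) (fun y hy => by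
      have hp : ((0 : ℝ), y) ∈ H.repDomain m m₀ := hbox ⟨h0, hy⟩
      rw [liftsAt_iff hp, fderiv_base_zero hp.1, hs₁, base_zero,
        L.anchorRep_coordAt (mem_frameSource m₀), hξ, _root_.map_zero])
  refine ⟨δ, hδ, u, fun y hy => ?_, by simpa using hu'⟩
  rw [HasInitialValue, ← hs₁ y, rep, hu y hy]
  rfl

/-- For a linear equation the size of the interval of existence depends only on `T`, not on the
initial section. Transport to one time near `T` therefore extends to any other. -/
theorem TransportsTo.exists_extension (m : M) (X : E) (ξ : A m₀) (T : ℝ) :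
    ∃ δ > 0, ∀ T₁ ∈ Ioo (T - δ) (T + δ), ∀ T₂ ∈ Ioo (T - δ) (T + δ), 0 ≤ T₁ →
      H.TransportsTo m X ξ T₁ → H.TransportsTo m X ξ T₂ := by
  set y₀ := extChartAt 𝓘(ℝ, E) m m
  set x₀ := H.map (chartParam E m (T, y₀)) with hx₀
  have hp₀ : (T, y₀) ∈ H.repDomain m x₀ :=
    ⟨mem_extChartAt_target (I := 𝓘(ℝ, E)) m, mem_frameSource _⟩
  obtain ⟨δ, hδ, hbox, hsol⟩ := exists_local_transport (H := H) hp₀ X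
  refine ⟨δ / 2, half_pos hδ, fun T₁ hT₁ T₂ hT₂ hT₁0 h => ?_⟩
  obtain ⟨ε, hε, u, hu0, hu⟩ := h
  have hT₁' : T₁ ∈ Ioo (T - δ) (T + δ) := ⟨by linarith [hT₁.1], by linarith [hT₁.2]⟩
  have hT₁'' : T₁ ∈ Ioo (-ε) (T₁ + ε) := ⟨by linarith, by linarith⟩
  -- Since `T₂ < T + δ / 2`, the bound `η ≤ δ / 2` keeps all times below `T₂ + η` inside the
  -- interval of the new solution.
  set η := min ε (δ / 2) with hη
  have hη0 : 0 < η := lt_min hε (half_pos hδ)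
  have hηε : η ≤ ε := min_le_left _ _
  have hηδ : η ≤ δ / 2 := min_le_right _ _
  have hV : Metric.ball y₀ η ⊆ Metric.ball y₀ δ := Metric.ball_subset_ball (by linarith)
  have hV' : Metric.ball y₀ η ⊆ Metric.ball y₀ ε := Metric.ball_subset_ball hηε
  obtain ⟨u', hu'1, hu'⟩ := hsol T₁ hT₁' (Metric.ball y₀ η) hV Metric.isOpen_ball u
    (fun y hy => by
      have h1 := contDiffAt_rep (hbox ⟨hT₁', hV hy⟩) (hu (T₁, y) ⟨hT₁'', hV' hy⟩).smooth
      exact (ContDiffAt.comp y (f := fun y => (T₁, y)) h1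
        (contDiffAt_const.prodMk contDiffAt_id)).contDiffWithinAt)
    (fun y hy => (hu (T₁, y) ⟨hT₁'', hV' hy⟩).lifts)
  -- On this overlap, an interval around `T₁`, the old and new solutions agree by uniqueness, so the
  -- section glued at `T₁` is smooth across the seam.
  let J := Ioo (-ε) (T₁ + ε) ∩ Ioo (T - δ) (T + δ)
  have hJo : IsOpen J := isOpen_Ioo.inter isOpen_Ioo
  have hJc : IsPreconnected J := (ordConnected_Ioo.inter ordConnected_Ioo).isPreconnected
  have hagree : ∀ y ∈ Metric.ball y₀ η, ∀ t ∈ J,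
      u' (chartParam E m (t, y)) = u (chartParam E m (t, y)) := fun y hy =>
    eq_of_isTransportedAt hJo hJc (fun t ht => hu' (t, y) ⟨ht.2, hy⟩)
      (fun t ht => hu (t, y) ⟨ht.1, hV' hy⟩) ⟨hT₁'', hT₁'⟩ (hu'1 y hy)
  classical
  let w : ∀ q, A (H.map q) := fun q => if q.1 < T₁ then u q else u' q
  refine ⟨η, hη0, w, fun y hy => ?_, ?_⟩
  · have h1 : w (chartParam E m (0, y)) = u (chartParam E m (0, y)) := by
      by_cases h0 : (0 : ℝ) < T₁
      · exact if_pos h0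
      · have h00 : T₁ = 0 := le_antisymm (not_lt.1 h0) hT₁0
        refine (if_neg h0).trans ?_
        rw [h00] at hu'1
        exact hu'1 y hy
    rw [HasInitialValue, rep, h1]
    exact hu0 y (hV' hy)
  · rintro ⟨t, y⟩ ⟨ht, hy⟩
    change t ∈ _ at ht
    change y ∈ _ at hy
    rcases lt_or_ge t T₁ with htT | htT
    · refine (hu (t, y) ⟨⟨by linarith [ht.1], by linarith⟩, hV' hy⟩).congr ?_
      filter_upwards [continuousAt_fst.preimage_mem_nhds (isOpen_Iio.mem_nhds
        (show (chartParam E m (t, y)).1 ∈ Iio T₁ from htT))] with q hq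
      exact if_pos hq
    · have ht' : t ∈ Ioo (T - δ) (T + δ) := ⟨by linarith [hT₁'.1], by linarith [ht.2, hT₂.2]⟩
      have htr := hu' (t, y) ⟨ht', hy⟩
      refine htr.congr ?_
      have hsrc := chartParam_snd_mem htr.mem
      -- Points near the seam may have time below `T₁`. The lower bound keeps them in the overlap,
      -- where both solutions agree.
      have h1 : ∀ᶠ q in 𝓝 (chartParam E m (t, y)), q.1 ∈ Ioo (max (-ε) (T - δ)) (T + δ) := by
        refine continuousAt_fst.preimage_mem_nhds (isOpen_Ioo.mem_nhds ?_)
        exact ⟨max_lt (by change -ε < t; linarith) ht'.1, ht'.2⟩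
      have h2 : ∀ᶠ q in 𝓝 (chartParam E m (t, y)),
          (chartCoord E m q).2 ∈ Metric.ball y₀ η ∧ q.2 ∈ (chartAt E m).source := by
        have h3 := (contMDiffAt_chartCoord hsrc).continuousAt
        refine Eventually.and (ContinuousAt.eventually_mem (f := fun q => (chartCoord E m q).2)
          (continuousAt_snd.comp h3) ?_) (continuousAt_snd.eventually_mem ((chartAt E m).open_source.mem_nhds hsrc))
        rw [chartCoord_chartParam htr.mem]
        exact Metric.isOpen_ball.mem_nhds hy
      filter_upwards [h1, h2] with q hq1 hq2
      by_cases hq : q.1 < T₁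
      · refine (if_pos hq).trans ?_
        have := hagree _ hq2.1 q.1 ⟨⟨(le_max_left _ _).trans_lt hq1.1, by linarith⟩,
          (le_max_right _ _).trans_lt hq1.1, hq1.2⟩
        have h5 : chartParam E m (q.1, (chartCoord E m q).2) = q := chartParam_chartCoord hq2.2
        rw [h5] at this
        exact this.symm
      · exact if_neg hq

/-- The times in `[0, 1]` that can be reached form a relatively open and closed set, by
`exists_extension`, and `0` belongs to it. -/
theorem transportsTo_one (m : M) (X : E) {ξ : A m₀} (hξ : L.anchor m₀ ξ = 0) :
    H.TransportsTo m X ξ 1 := by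
  have h := (isPreconnected_Icc (a := (0 : ℝ)) (b := 1)).induction₂
    (fun s t => (H.TransportsTo m X ξ s ↔ H.TransportsTo m X ξ t)) (fun T hT => ?_)
    (fun _ _ _ _ _ _ => Iff.trans) (fun _ _ _ _ => Iff.symm) (left_mem_Icc.2 zero_le_one)
    (right_mem_Icc.2 zero_le_one)
  · exact h.1 (transportsTo_zero m X hξ)
  · obtain ⟨δ, hδ, h⟩ := TransportsTo.exists_extension (H := H) m X ξ T
    have hT' : T ∈ Ioo (T - δ) (T + δ) := ⟨by linarith, by linarith⟩
    filter_upwards [self_mem_nhdsWithin, mem_nhdsWithin_of_mem_nhds (isOpen_Ioo.mem_nhds hT')]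
      with s hs hs'
    exact ⟨h T hT' s hs' hT.1, h s hs' T hT' hs.1⟩

theorem sum_apply {ι : Type*} (I : Finset ι) (u : ι → ∀ q, A (H.map q)) (q : ℝ × M) :
    (∑ i ∈ I, u i) q = ∑ i ∈ I, u i q := Finset.sum_apply q I u

/-- Near `m`, there is a linear family of transported sections. -/
theorem exists_transport_family (H : L.LiftedContraction m₀) {𝔨 : Type*} [NormedAddCommGroup 𝔨]
    [NormedSpace ℝ 𝔨] [FiniteDimensional ℝ 𝔨] (j : 𝔨 →ₗ[ℝ] A m₀) (hj : ∀ ξ, L.anchor m₀ (j ξ) = 0)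
    (m : M) :
    ∃ ε > 0, ∃ Ψ : ∀ q, E × 𝔨 →ₗ[ℝ] A (H.map q), ∀ d,
      (∀ y ∈ Metric.ball (extChartAt 𝓘(ℝ, E) m m) ε,
        H.HasInitialValue m (fun q => Ψ q d) (j d.2) y) ∧
      ∀ p ∈ Ioo (-ε) (1 + ε) ×ˢ Metric.ball (extChartAt 𝓘(ℝ, E) m m) ε,
        H.IsTransportedAt m d.1 (fun q => Ψ q d) p := by
  -- Only basis vectors are transported. Their finitely many radii have a common positive bound, and
  -- linear extension supplies the other sections.
  let b := Module.finBasis ℝ (E × 𝔨)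
  have h1 : ∀ i, H.TransportsTo m (b i).1 (j (b i).2) 1 := fun i => transportsTo_one m _ (hj _)
  choose ε hε u hu0 hu using h1
  obtain ⟨r, hr, hball⟩ := Metric.mem_nhds_iff.1 (extChartAt_target_mem_nhds (I := 𝓘(ℝ, E)) m)
  obtain ⟨η, hη, hηr, hη'⟩ : ∃ η > 0, η ≤ r ∧ ∀ i, η ≤ ε i := by
    have h2 : ∀ᶠ η in 𝓝[>] (0 : ℝ), ∀ i, η ≤ ε i := eventually_all.2 fun i =>
      mem_nhdsWithin_of_mem_nhds (Iic_mem_nhds (hε i))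
    have h3 : ∀ᶠ η in 𝓝[>] (0 : ℝ), η ≤ r := mem_nhdsWithin_of_mem_nhds (Iic_mem_nhds hr)
    obtain ⟨η, ⟨h4, h5⟩, h6⟩ := ((h2.and h3).and self_mem_nhdsWithin).exists
    exact ⟨η, h6, h5, h4⟩
  let Ψ : ∀ q, E × 𝔨 →ₗ[ℝ] A (H.map q) := fun q => b.constr ℝ fun i => u i q
  have hΨ : ∀ d, (fun q => Ψ q d) = ∑ i, b.repr d i • u i := fun d => by
    funext q
    rw [sum_apply]
    exact b.constr_apply_fintype ℝ (fun i => u i q) d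
  have hd : ∀ d, d = ∑ i, b.repr d i • b i := fun d => (b.sum_repr d).symm
  refine ⟨η, hη, Ψ, fun d => ⟨fun y hy => ?_, fun p hp => ?_⟩⟩
  · rw [HasInitialValue, hΨ, rep, sum_apply, map_sum]
    have h2 : j d.2 = ∑ i, b.repr d i • j (b i).2 := by
      conv_lhs => rw [hd d]
      rw [Prod.snd_sum, map_sum]
      simp
    rw [h2, map_sum]
    refine Finset.sum_congr rfl fun i _ => ?_
    rw [map_smul, ← hu0 i y (Metric.ball_subset_ball (hη' i) hy)]
    exact map_smul _ _ _
  · have h3 : ∀ i, H.IsTransportedAt m (b i).1 (u i) p := fun i => hu i p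
      ⟨⟨by linarith [hp.1.1, hη' i], by linarith [hp.1.2, hη' i]⟩,
        Metric.ball_subset_ball (hη' i) hp.2⟩
    have h4 : d.1 = ∑ i, b.repr d i • (b i).1 := by
      conv_lhs => rw [hd d]
      rw [Prod.fst_sum]
      simp
    have hmem : p.2 ∈ (extChartAt 𝓘(ℝ, E) m).target :=
      hball (Metric.ball_subset_ball hηr hp.2)
    rw [hΨ, h4]
    exact IsTransportedAt.sum _ hmem fun i => (h3 i).smul _

end LiftedContraction

end LieAlgebroid

theorem differentiableAt_bracketAlong {E F P : Type*} [NormedAddCommGroup E] [NormedSpace ℝ E]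
    [NormedAddCommGroup F] [NormedSpace ℝ F] [NormedAddCommGroup P] [NormedSpace ℝ P]
    {C : E → F →L[ℝ] F →L[ℝ] F} {f : P → E} {s s' : P → F} {v w p : P}
    (hC : DifferentiableAt ℝ C (f p)) (hf : DifferentiableAt ℝ f p) (hs : ContDiffAt ℝ ∞ s p)
    (hs' : ContDiffAt ℝ ∞ s' p) : DifferentiableAt ℝ (bracketAlong C f v s w s') p :=
  ((differentiableAt_fderiv_apply hs' v).fun_sub (differentiableAt_fderiv_apply hs w)).fun_add
    (differentiableAt_bilin_comp_apply hC hf (hs.differentiableAt (by simp))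
      (hs'.differentiableAt (by simp)))

/-! ### The bracket of transported sections -/

namespace LieAlgebroid

variable {E : Type*} [NormedAddCommGroup E] [NormedSpace ℝ E] [FiniteDimensional ℝ E]
  {M : Type*} [TopologicalSpace M] [T2Space M] [ChartedSpace E M] [IsManifold 𝓘(ℝ, E) ∞ M]
  {F : Type*} [NormedAddCommGroup F] [NormedSpace ℝ F] [FiniteDimensional ℝ F]
  {A : M → Type*} [TopologicalSpace (TotalSpace F A)]
  [∀ x, AddCommGroup (A x)] [∀ x, Module ℝ (A x)] [∀ x, TopologicalSpace (A x)]
  [FiberBundle F A] [VectorBundle ℝ F A] [ContMDiffVectorBundle ∞ F A 𝓘(ℝ, E)]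
  {𝔨 : Type*} [NormedLieAlgebra 𝔨] [FiniteDimensional ℝ 𝔨]

/-- An identification of a Lie algebra with the isotropy Lie algebra at `m₀`. -/
structure IsotropyModel (L : LieAlgebroid E F A) (m₀ : M) (𝔨 : Type*) [NormedLieAlgebra 𝔨] where
  toFun : 𝔨 →ₗ[ℝ] A m₀
  injective : Function.Injective toFun
  anchor_apply : ∀ ξ, L.anchor m₀ (toFun ξ) = 0
  exists_eq : ∀ a, L.anchor m₀ a = 0 → ∃ ξ, toFun ξ = a
  bracketRep_apply : ∀ ξ η, L.bracketRep m₀ (extChartAt 𝓘(ℝ, E) m₀ m₀)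
    (coordAt F A m₀ m₀ (toFun ξ)) (coordAt F A m₀ m₀ (toFun η)) =
      coordAt F A m₀ m₀ (toFun ⁅ξ, η⁆)

namespace LiftedContraction

variable {L : LieAlgebroid E F A} {m₀ : M}

/-- A linear family of transported sections near `m`. -/
structure TransportFamily (H : L.LiftedContraction m₀) (j : IsotropyModel L m₀ 𝔨) (m : M) where
  radius : ℝ
  radius_pos : 0 < radius
  sec : ∀ q, E × 𝔨 →ₗ[ℝ] A (H.map q)
  initial : ∀ d, ∀ y ∈ Metric.ball (extChartAt 𝓘(ℝ, E) m m) radius,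
    H.HasInitialValue m (fun q => sec q d) (j.toFun d.2) y
  transported : ∀ d, ∀ p ∈ Ioo (-radius) (1 + radius) ×ˢ
    Metric.ball (extChartAt 𝓘(ℝ, E) m m) radius, H.IsTransportedAt m d.1 (fun q => sec q d) p

theorem nonempty_transportFamily (H : L.LiftedContraction m₀) (j : IsotropyModel L m₀ 𝔨) (m : M) :
    Nonempty (H.TransportFamily j m) := by
  obtain ⟨ε, hε, Ψ, h⟩ := H.exists_transport_family j.toFun j.anchor_apply m
  exact ⟨⟨ε, hε, Ψ, fun d => (h d).1, fun d => (h d).2⟩⟩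

variable {H : L.LiftedContraction m₀} {j : IsotropyModel L m₀ 𝔨} {m : M}

theorem coordAt_frameAt_eq {z x₀ : M} {y : E} {t : ℝ} (hp : (t, y) ∈ H.repDomain m z) (c : F) :
    coordAt F A x₀ (H.map (chartParam E m (t, y))) (frameAt F A z (H.map (chartParam E m (t, y))) c)
      = frameChange E F A z x₀ (H.base m z (t, y)) c := by
  rw [frameChange, base, left_inv_of_mem_frameSource hp.2]
  rfl

theorem eq_of_coordAt_eq {x₀ x : M} (hx : x ∈ (trivializationAt F A x₀).baseSet) {a b : A x}
    (h : coordAt F A x₀ x a = coordAt F A x₀ x b) : a = b := by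
  rw [← frameAt_coordAt hx a, h, frameAt_coordAt hx]

namespace TransportFamily

variable (Φ : H.TransportFamily j m)

/-- The bracket of transported sections is transported. -/
theorem bracketIn_sec {x₀ : M} {t : ℝ} {y : E} (ht : t ∈ Ioo (-Φ.radius) (1 + Φ.radius))
    (hy : y ∈ Metric.ball (extChartAt 𝓘(ℝ, E) m m) Φ.radius) (hx₀ : (t, y) ∈ H.repDomain m x₀)
    (d d' : E × 𝔨) :
    H.bracketIn m x₀ (0, d.1) (fun q => Φ.sec q d) (0, d'.1) (fun q => Φ.sec q d') (t, y) =
      H.rep m x₀ (fun q => Φ.sec q (0, ⁅d.2, d'.2⁆)) (t, y) := by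
  let J := Ioo (-Φ.radius) (1 + Φ.radius)
  have h0J : (0 : ℝ) ∈ J := ⟨by linarith [Φ.radius_pos], by linarith [Φ.radius_pos]⟩
  let box := J ×ˢ Metric.ball (extChartAt 𝓘(ℝ, E) m m) Φ.radius
  have hbox : IsOpen box := isOpen_Ioo.prod Metric.isOpen_ball
  have hmem : y ∈ (extChartAt 𝓘(ℝ, E) m).target := (Φ.transported 0 (t, y) ⟨ht, hy⟩).mem
  set x := (extChartAt 𝓘(ℝ, E) m).symm y with hxy
  have hx : x ∈ (chartAt E m).source := chartParam_snd_mem (p := (t, y)) hmem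
  have hyx : extChartAt 𝓘(ℝ, E) m x = y := (extChartAt 𝓘(ℝ, E) m).right_inv hmem
  let br : M → ℝ × E → F := fun x₀ =>
    H.bracketIn m x₀ (0, d.1) (fun q => Φ.sec q d) (0, d'.1) (fun q => Φ.sec q d')
  -- A single vector at each time represents the bracket in all frames; any frame can be used to
  -- define it, here the one centred at the point of the path.
  let w : ∀ τ : ℝ, A (H.map (τ, x)) := fun τ =>
    frameAt F A (H.map (τ, x)) (H.map (τ, x)) (br (H.map (τ, x)) (τ, y))
  have hw : ∀ τ ∈ J, ∀ z, (τ, y) ∈ H.repDomain m z →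
      coordAt F A z (H.map (τ, x)) (w τ) = br z (τ, y) := fun τ hτ z hz => by
    have h1 := Φ.transported d (τ, y) ⟨hτ, hy⟩
    have h2 := Φ.transported d' (τ, y) ⟨hτ, hy⟩
    have h3 : (τ, y) ∈ H.repDomain m (H.map (τ, x)) := ⟨hmem, mem_frameSource _⟩
    exact (coordAt_frameAt_eq h3 _).trans
      (frameChange_bracketIn h3 hz h1.smooth h2.smooth h1.lifts h2.lifts).symm
  -- Constant fields commute, so the bracket is compared with lifts of zero and the source term
  -- drops out. The equation is the Jacobi consequence `bracketAlong_bracketAlong`.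
  have hpar : ∀ τ ∈ J, H.IsParallelAt x 0 w τ := fun τ hτ z hz => by
    have hp : (τ, y) ∈ H.repDomain m z := ⟨hmem, hz⟩
    have h1 := Φ.transported d (τ, y) ⟨hτ, hy⟩
    have h2 := Φ.transported d' (τ, y) ⟨hτ, hy⟩
    have hM := L.isAlgebroidModel z
    have h3 := hasDerivAt_time (differentiableAt_bracketAlong (v := ((0, d.1) : ℝ × E))
      (w := ((0, d'.1) : ℝ × E)) (hM.differentiableAt_bracket (base_mem hp))
      ((contDiffAt_base hp).differentiableAt (by simp)) (contDiffAt_rep hp h1.smooth)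
      (contDiffAt_rep hp h2.smooth))
    have hev : ∀ d, ∀ᶠ q in 𝓝 (τ, y), bracketAlong (L.bracketRep z) (H.base m z) (1, 0)
        (H.rep m z H.vel) (0, d.1) (H.rep m z fun q => Φ.sec q d) q = 0 := fun d => by
      filter_upwards [hbox.mem_nhds (show (τ, y) ∈ box from ⟨hτ, hy⟩),
        isOpen_repDomain.mem_nhds hp] with q hq hq'
      exact (Φ.transported d q hq).comm z hq'
    have h4 := hM.bracketAlong_bracketAlong (base_mem hp) (contDiffAt_base hp)
      (contDiffAt_rep hp (smoothAt_vel _)) (contDiffAt_rep hp h1.smooth)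
      (contDiffAt_rep hp h2.smooth) ((liftsAt_iff hp).1 (liftsAt_vel hmem))
      ((liftsAt_iff hp).1 h1.lifts) ((liftsAt_iff hp).1 h2.lifts) (hev d) (hev d')
    have h5 : (fun τ => coordAt F A z (H.map (τ, x)) (w τ)) =ᶠ[𝓝 τ] fun τ => br z (τ, y) := by
      have h6 : ∀ᶠ σ in 𝓝 τ, (σ, y) ∈ H.repDomain m z :=
        ((continuous_id.prodMk continuous_const).continuousAt).eventually_mem
          (isOpen_repDomain.mem_nhds hp)
      filter_upwards [h6, isOpen_Ioo.mem_nhds hτ] with σ hσ hσ' using hw σ hσ' z hσ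
    refine (HasDerivAt.congr_deriv h3 ?_).congr_of_eventuallyEq h5
    symm
    rw [_root_.map_zero, zero_sub, neg_eq_iff_add_eq_zero, add_comm, hw τ hτ z hp]
    exact h4
  have hpar' : ∀ τ ∈ J, H.IsParallelAt x 0 (fun τ => Φ.sec (τ, x) (0, ⁅d.2, d'.2⁆)) τ :=
    fun τ hτ => IsTransportedAt.isParallelAt hx (_root_.map_zero _)
      (by rw [hyx]; exact Φ.transported (0, ⁅d.2, d'.2⁆) (τ, y) ⟨hτ, hy⟩)
  have hp0 : ((0 : ℝ), y) ∈ H.repDomain m m₀ := mem_repDomain_zero hmem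
  -- The initial values do not depend on `y`, so their spatial derivatives vanish.
  have hconst : ∀ (d : E × 𝔨) (X : E),
      fderiv ℝ (H.rep m m₀ fun q => Φ.sec q d) (0, y) (0, X) = 0 := fun d X => by
    rw [← fderiv_space ((contDiffAt_rep hp0 (Φ.transported d (0, y)
      ⟨h0J, hy⟩).smooth).differentiableAt (by simp))]
    have h1 : (fun z => H.rep m m₀ (fun q => Φ.sec q d) (0, z)) =ᶠ[𝓝 y]
        fun _ => coordAt F A m₀ m₀ (j.toFun d.2) := by
      filter_upwards [Metric.isOpen_ball.mem_nhds hy] with z hz using Φ.initial d z hz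
    rw [h1.fderiv_eq]
    simp
  -- At time `0` only the algebraic term of the bracket is left, and on isotropy vectors it is the
  -- bracket of `𝔨`.
  have hinit : w 0 = Φ.sec (0, x) (0, ⁅d.2, d'.2⁆) := by
    refine eq_of_coordAt_eq (x₀ := m₀) hp0.2.2 ((hw 0 h0J m₀ hp0).trans ?_)
    have h1 := Φ.initial d y hy
    have h2 := Φ.initial d' y hy
    have h3 := Φ.initial (0, ⁅d.2, d'.2⁆) y hy
    rw [HasInitialValue] at h1 h2 h3
    change bracketAlong _ _ _ _ _ _ _ = _
    rw [bracketAlong, hconst, hconst, h1, h2, base_zero, sub_zero, zero_add, j.bracketRep_apply]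
    exact h3.symm
  have hfin := eq_of_isParallelAt isOpen_Ioo isPreconnected_Ioo hpar hpar' h0J hinit t ht
  refine (hw t ht x₀ hx₀).symm.trans ?_
  rw [hfin]
  rfl

end TransportFamily

end LiftedContraction

end LieAlgebroid

/-! ### From a frame satisfying the structure equation to an isomorphism -/

namespace LieAlgebroid

variable {E : Type*} [NormedAddCommGroup E] [NormedSpace ℝ E] [FiniteDimensional ℝ E]
  {M : Type*} [TopologicalSpace M] [T2Space M] [ChartedSpace E M] [IsManifold 𝓘(ℝ, E) ∞ M]
  {F : Type*} [NormedAddCommGroup F] [NormedSpace ℝ F] [FiniteDimensional ℝ F]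
  {A : M → Type*} [TopologicalSpace (TotalSpace F A)]
  [∀ x, AddCommGroup (A x)] [∀ x, Module ℝ (A x)] [∀ x, TopologicalSpace (A x)]
  [FiberBundle F A] [VectorBundle ℝ F A] [ContMDiffVectorBundle ∞ F A 𝓘(ℝ, E)]
  {𝔨 : Type*} [NormedLieAlgebra 𝔨] [FiniteDimensional ℝ 𝔨]

theorem mem_baseSet_trivialBundle {m x : M} (hx : x ∈ (chartAt E m).source) :
    x ∈ (trivializationAt (E × 𝔨) (TrivialBundle E M 𝔨) m).baseSet :=
  ⟨hx, mem_univ x⟩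

theorem coordAt_trivialBundle {m x : M} (hx : x ∈ (chartAt E m).source)
    (w : TrivialBundle E M 𝔨 x) :
    coordAt (E × 𝔨) (TrivialBundle E M 𝔨) m x w = (chartDeriv E m x w.1, w.2) := by
  rw [coordAt_apply (mem_baseSet_trivialBundle hx)]
  refine Prod.ext ?_ rfl
  rw [chartDeriv, ← TangentBundle.continuousLinearMapAt_trivializationAt hx]
  exact (coordAt_apply (A := (TangentSpace 𝓘(ℝ, E) : M → Type _)) (x₀ := m) hx w.1).symm

/-- A fibrewise linear isomorphism `TM × 𝔨 → A` over `M`, smooth in local coordinates, that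
intertwines the anchors and satisfies the structure equation for the brackets. -/
structure TrivialFrame (L : LieAlgebroid E F A) (𝔨 : Type*) [NormedLieAlgebra 𝔨] where
  toFun : ∀ x, TrivialBundle E M 𝔨 x →ₗ[ℝ] A x
  bijective : ∀ x, Function.Bijective (toFun x)
  anchor_apply : ∀ x d, L.anchor x (toFun x d) = d.1
  rep : M → E → E × 𝔨 →L[ℝ] F
  contDiffAt_rep : ∀ m, ContDiffAt ℝ ∞ (rep m) (extChartAt 𝓘(ℝ, E) m m)
  coordAt_apply : ∀ m, ∀ᶠ x in 𝓝 m, ∀ d : TrivialBundle E M 𝔨 x,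
    coordAt F A m x (toFun x d) = rep m (extChartAt 𝓘(ℝ, E) m x) (chartDeriv E m x d.1, d.2)
  structure_eq : ∀ m (d d' : E × 𝔨),
    fderiv ℝ (rep m) (extChartAt 𝓘(ℝ, E) m m) d.1 d' -
      fderiv ℝ (rep m) (extChartAt 𝓘(ℝ, E) m m) d'.1 d +
      L.bracketRep m (extChartAt 𝓘(ℝ, E) m m) (rep m (extChartAt 𝓘(ℝ, E) m m) d)
        (rep m (extChartAt 𝓘(ℝ, E) m m) d') =
      rep m (extChartAt 𝓘(ℝ, E) m m) (0, ⁅d.2, d'.2⁆)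

namespace TrivialFrame

variable {L : LieAlgebroid E F A} (Θ : L.TrivialFrame 𝔨)

theorem rep_coordAt (m : M) : ∀ᶠ x in 𝓝 m, ∀ d : TrivialBundle E M 𝔨 x,
    coordAt F A m x (Θ.toFun x d) =
      Θ.rep m (extChartAt 𝓘(ℝ, E) m x) (coordAt (E × 𝔨) (TrivialBundle E M 𝔨) m x d) := by
  filter_upwards [Θ.coordAt_apply m, (chartAt E m).open_source.mem_nhds (mem_chart_source E m)]
    with x h hx d
  rw [h, coordAt_trivialBundle hx]

theorem isInvertible_rep (m : M) :
    ∀ᶠ x in 𝓝 m, (Θ.rep m (extChartAt 𝓘(ℝ, E) m x)).IsInvertible := by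
  filter_upwards [Θ.rep_coordAt m, (isOpen_frameSource (E := E) (F := F) (A := A) m).mem_nhds
    (mem_frameSource m)] with x h hx
  have hx' := mem_baseSet_trivialBundle (𝔨 := 𝔨) hx.1
  have hb : Function.Bijective (Θ.rep m (extChartAt 𝓘(ℝ, E) m x)) := by
    constructor
    · rw [injective_iff_map_eq_zero]
      intro d hd
      rw [← coordAt_frameAt hx' d, ← h] at hd
      rw [← coordAt_frameAt hx' d]
      have h1 : Θ.toFun x (frameAt (E × 𝔨) (TrivialBundle E M 𝔨) m x d) = 0 :=
        LiftedContraction.eq_of_coordAt_eq hx.2 (hd.trans (map_zero _).symm)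
      rw [(Θ.bijective x).1 (h1.trans (map_zero _).symm), map_zero]
    · intro c
      obtain ⟨d, hd⟩ := (Θ.bijective x).2 (frameAt F A m x c)
      exact ⟨_, (h d).symm.trans (by rw [hd, coordAt_frameAt hx.2])⟩
  exact ⟨(LinearEquiv.ofBijective (Θ.rep m (extChartAt 𝓘(ℝ, E) m x)).toLinearMap
    hb).toContinuousLinearEquiv, ContinuousLinearMap.ext fun _ => rfl⟩

/-- The fibre isomorphisms `A x ≃ TₓM × 𝔨`. -/
def fiberEquiv (x : M) : A x ≃L[ℝ] TrivialBundle E M 𝔨 x :=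
  -- The equivalence passes through the model fibres, finite-dimensional normed spaces on which
  -- linear equivalences are automatically continuous.
  let e := VectorBundle.continuousLinearEquivAt ℝ F A x
  let e' := VectorBundle.continuousLinearEquivAt ℝ (E × 𝔨) (TrivialBundle E M 𝔨) x
  let f : F ≃L[ℝ] E × 𝔨 := (((e.symm.toLinearEquiv.trans
    (LinearEquiv.ofBijective (Θ.toFun x) (Θ.bijective x)).symm).trans
      e'.toLinearEquiv)).toContinuousLinearEquiv
  (e.trans f).trans e'.symm

theorem toFun_fiberEquiv (x : M) (a : A x) : Θ.toFun x (Θ.fiberEquiv x a) = a := by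
  have h : Θ.fiberEquiv x a =
      (LinearEquiv.ofBijective (Θ.toFun x) (Θ.bijective x)).symm a := by
    let e := VectorBundle.continuousLinearEquivAt ℝ F A x
    let e' := VectorBundle.continuousLinearEquivAt ℝ (E × 𝔨) (TrivialBundle E M 𝔨) x
    change e'.symm (e' ((LinearEquiv.ofBijective (Θ.toFun x) (Θ.bijective x)).symm
      (e.symm (e a)))) = _
    rw [e'.symm_apply_apply, e.symm_apply_apply]
  rw [h]
  exact (LinearEquiv.ofBijective (Θ.toFun x) (Θ.bijective x)).apply_symm_apply a

theorem fiberEquiv_symm_apply (x : M) (d : TrivialBundle E M 𝔨 x) :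
    (Θ.fiberEquiv x).symm d = Θ.toFun x d := by
  rw [← Θ.toFun_fiberEquiv x ((Θ.fiberEquiv x).symm d), (Θ.fiberEquiv x).apply_symm_apply]

theorem contMDiff_symm : ContMDiff (𝓘(ℝ, E).prod 𝓘(ℝ, E × 𝔨)) (𝓘(ℝ, E).prod 𝓘(ℝ, F)) ∞
    (fun p : TotalSpace (E × 𝔨) (TrivialBundle E M 𝔨) =>
      (⟨p.proj, (Θ.fiberEquiv p.proj).symm p.2⟩ : TotalSpace F A)) := fun p => by
  have hp := mem_baseSet_trivialBundle (𝔨 := 𝔨) (mem_chart_source E p.proj)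
  have h := (contMDiffAt_iff_coordAt (J := 𝓘(ℝ, E).prod 𝓘(ℝ, E × 𝔨))
    (f := fun q : TotalSpace (E × 𝔨) (TrivialBundle E M 𝔨) => q.proj) (s := fun q => q.2)
    (p := p) hp).1 contMDiffAt_id
  refine (contMDiffAt_iff_coordAt (f := fun q : TotalSpace (E × 𝔨) (TrivialBundle E M 𝔨) => q.proj)
    (s := fun q => (Θ.fiberEquiv q.proj).symm q.2) (x₀ := p.proj)
    (FiberBundle.mem_baseSet_trivializationAt F A p.proj)).2 ⟨h.1, ?_⟩
  have h2 : ContMDiffAt (𝓘(ℝ, E).prod 𝓘(ℝ, E × 𝔨)) 𝓘(ℝ, E × 𝔨 →L[ℝ] F) ∞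
      (fun q : TotalSpace (E × 𝔨) (TrivialBundle E M 𝔨) =>
        Θ.rep p.proj (extChartAt 𝓘(ℝ, E) p.proj q.proj)) p :=
    (Θ.contDiffAt_rep p.proj).contMDiffAt.comp p ((contMDiffAt_extChartAt
      (x := p.proj)).comp p h.1)
  refine (h2.clm_apply h.2).congr_of_eventuallyEq ?_
  filter_upwards [h.1.continuousAt.eventually (Θ.rep_coordAt p.proj)] with q hq
  rw [fiberEquiv_symm_apply, hq]

/-- In coordinates the map is the pointwise inverse of the smooth family `Θ.rep`, and inversion is
smooth near an invertible operator. -/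
theorem contMDiff_fiberEquiv : ContMDiff (𝓘(ℝ, E).prod 𝓘(ℝ, F)) (𝓘(ℝ, E).prod 𝓘(ℝ, E × 𝔨)) ∞
    (fun p : TotalSpace F A =>
      (⟨p.proj, Θ.fiberEquiv p.proj p.2⟩ : TotalSpace (E × 𝔨) (TrivialBundle E M 𝔨))) := fun p => by
  have hp := mem_baseSet_trivialBundle (𝔨 := 𝔨) (mem_chart_source E p.proj)
  have h := (contMDiffAt_iff_coordAt (J := 𝓘(ℝ, E).prod 𝓘(ℝ, F))
    (f := fun q : TotalSpace F A => q.proj) (s := fun q => q.2)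
    (p := p) (FiberBundle.mem_baseSet_trivializationAt F A p.proj)).1 contMDiffAt_id
  refine (contMDiffAt_iff_coordAt (f := fun q : TotalSpace F A => q.proj)
    (s := fun q => Θ.fiberEquiv q.proj q.2) (x₀ := p.proj) hp).2 ⟨h.1, ?_⟩
  obtain ⟨e, he⟩ := (Θ.isInvertible_rep p.proj).self_of_nhds
  have h3 : ContDiffAt ℝ ∞ (fun y => (Θ.rep p.proj y).inverse) (extChartAt 𝓘(ℝ, E) p.proj p.proj) :=
    ContDiffAt.comp (g := ContinuousLinearMap.inverse) _ (he ▸ contDiffAt_map_inverse e)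
      (Θ.contDiffAt_rep p.proj)
  have h2 : ContMDiffAt (𝓘(ℝ, E).prod 𝓘(ℝ, F)) 𝓘(ℝ, F →L[ℝ] E × 𝔨) ∞
      (fun q : TotalSpace F A =>
        (Θ.rep p.proj (extChartAt 𝓘(ℝ, E) p.proj q.proj)).inverse) p :=
    ContMDiffAt.comp p (h3.contMDiffAt) ((contMDiffAt_extChartAt (x := p.proj)).comp p h.1)
  refine (h2.clm_apply h.2).congr_of_eventuallyEq ?_
  filter_upwards [h.1.continuousAt.eventually (Θ.rep_coordAt p.proj),
    h.1.continuousAt.eventually (Θ.isInvertible_rep p.proj)] with q hq hq'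
  exact (hq'.inverse_apply_eq.2 (by rw [← hq, toFun_fiberEquiv])).symm

/-- The vector bundle isomorphism `A ≃ TM × 𝔨`. -/
def bundleIso : SmoothBundleIso E F A (E × 𝔨) (TrivialBundle E M 𝔨) where
  fiberEquiv := Θ.fiberEquiv
  contMDiff_toFun := Θ.contMDiff_fiberEquiv
  contMDiff_invFun := Θ.contMDiff_symm

theorem fiberEquiv_fst (x : M) (a : A x) : (Θ.fiberEquiv x a).1 = L.anchor x a := by
  rw [← Θ.anchor_apply, toFun_fiberEquiv]

/-- Both sides act on functions as the same commutator of derivations, because the first component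
is the anchor; functions separate tangent vectors. -/
theorem fiberEquiv_bracket_fst (σ τ : Cₛ^∞⟮𝓘(ℝ, E); F, A⟯) (x : M) :
    (Θ.fiberEquiv x (L.bracket σ τ x)).1 = (tangent E M).bracket
      (pairFst (Θ.bundleIso.mapSection σ)) (pairFst (Θ.bundleIso.mapSection τ)) x := by
  rw [fiberEquiv_fst]
  refine sub_eq_zero.1 (eq_zero_of_mvfderiv fun f => ?_)
  have hX : ∀ ρ : Cₛ^∞⟮𝓘(ℝ, E); F, A⟯, (tangent E M).lieDeriv
      (pairFst (Θ.bundleIso.mapSection ρ)) f = L.lieDeriv ρ f := fun ρ =>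
    ContMDiffMap.ext fun y => congrArg (mvfderiv 𝓘(ℝ, E) f y) (Θ.fiberEquiv_fst y (ρ y))
  have h := (tangent E M).mvfderiv_anchor_bracket (pairFst (Θ.bundleIso.mapSection σ))
    (pairFst (Θ.bundleIso.mapSection τ)) f x
  rw [hX, hX] at h
  rw [map_sub, L.mvfderiv_anchor_bracket, sub_eq_zero]
  refine Eq.trans ?_ h.symm
  exact congrArg₂ (fun v w => mvfderiv 𝓘(ℝ, E) (L.lieDeriv τ f) x v -
    mvfderiv 𝓘(ℝ, E) (L.lieDeriv σ f) x w) (Θ.fiberEquiv_fst x (σ x)).symm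
      (Θ.fiberEquiv_fst x (τ x)).symm

theorem sectionRep_eventuallyEq (σ : Cₛ^∞⟮𝓘(ℝ, E); F, A⟯) (m : M) :
    sectionRep m σ =ᶠ[𝓝 (extChartAt 𝓘(ℝ, E) m m)]
      fun y => Θ.rep m y (sectionRep m (Θ.bundleIso.mapSection σ) y) := by
  filter_upwards [eventually_symm_of_eventually (E := E) (F := F) (A := A) (mem_frameSource m)
    (Θ.rep_coordAt m), (isOpen_extChartAt_target m).mem_nhds (mem_extChartAt_target m)] with y hy hy'
  rw [(extChartAt 𝓘(ℝ, E) m).right_inv hy'] at hy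
  refine Eq.trans ?_ (hy _)
  exact congrArg (coordAt F A m _) (Θ.toFun_fiberEquiv _ _).symm

theorem fderiv_sectionRep (σ : Cₛ^∞⟮𝓘(ℝ, E); F, A⟯) (m : M) (X : E) :
    fderiv ℝ (sectionRep m σ) (extChartAt 𝓘(ℝ, E) m m) X =
      Θ.rep m (extChartAt 𝓘(ℝ, E) m m) (fderiv ℝ (sectionRep m (Θ.bundleIso.mapSection σ))
        (extChartAt 𝓘(ℝ, E) m m) X) +
      fderiv ℝ (Θ.rep m) (extChartAt 𝓘(ℝ, E) m m) X
        (sectionRep m (Θ.bundleIso.mapSection σ) (extChartAt 𝓘(ℝ, E) m m)) := by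
  have h1 : DifferentiableAt ℝ (sectionRep m (Θ.bundleIso.mapSection σ))
      (extChartAt 𝓘(ℝ, E) m m) :=
    ((contDiffOn_sectionRep m _).contDiffAt ((isOpen_frameDomain m).mem_nhds
      (map_mem_frameDomain (mem_frameSource m)))).differentiableAt (by simp)
  have h2 := ((Θ.contDiffAt_rep m).differentiableAt (by simp)).hasFDerivAt.clm_apply h1.hasFDerivAt
  rw [(Θ.sectionRep_eventuallyEq σ m).fderiv_eq, h2.fderiv]
  simp

theorem fderiv_sectionRep_snd (s : Cₛ^∞⟮𝓘(ℝ, E); E × 𝔨, TrivialBundle E M 𝔨⟯) (m : M)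
    (v : TangentSpace 𝓘(ℝ, E) m) :
    (fderiv ℝ (sectionRep m s) (extChartAt 𝓘(ℝ, E) m m) (chartDeriv E m m v)).2 =
      mvfderiv 𝓘(ℝ, E) (pairSnd s) m v := by
  have h1 : DifferentiableAt ℝ (sectionRep m s) (extChartAt 𝓘(ℝ, E) m m) :=
    ((contDiffOn_sectionRep m _).contDiffAt ((isOpen_frameDomain m).mem_nhds
      (map_mem_frameDomain (mem_frameSource m)))).differentiableAt (by simp)
  rw [mvfderiv_eq_fderiv_chart (mem_chart_source E m) (pairSnd s).contMDiff.contMDiffAt]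
  have h2 : (fun y => pairSnd s ((extChartAt 𝓘(ℝ, E) m).symm y))
      =ᶠ[𝓝 (extChartAt 𝓘(ℝ, E) m m)] fun y => (sectionRep m s y).2 := by
    filter_upwards [(isOpen_extChartAt_target m).mem_nhds (mem_extChartAt_target (I := 𝓘(ℝ, E)) m)]
      with y hy
    rw [sectionRep, coordAt_trivialBundle (by simpa using (extChartAt 𝓘(ℝ, E) m).map_target hy)]
    rfl
  rw [h2.fderiv_eq, h1.hasFDerivAt.snd.fderiv]
  rfl

/-- Writing sections of `A` as `Θ.rep` applied to sections of the trivial bundle, the product rule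
separates derivatives of the sections from derivatives of `Θ.rep`. The structure equation turns the
latter, with `bracketRep`, into the bracket of `𝔨`. Injectivity of `Θ.rep` then allows the
components to be compared. -/
theorem fiberEquiv_bracket_snd (σ τ : Cₛ^∞⟮𝓘(ℝ, E); F, A⟯) (m : M) :
    (Θ.fiberEquiv m (L.bracket σ τ m)).2 =
      (trivialBracket (Θ.bundleIso.mapSection σ) (Θ.bundleIso.mapSection τ) m).2 := by
  set y := extChartAt 𝓘(ℝ, E) m m
  set s := Θ.bundleIso.mapSection σ
  set t := Θ.bundleIso.mapSection τ
  have hm : m ∈ frameSource E F A m := mem_frameSource m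
  have hm' : m ∈ frameSource E (E × 𝔨) (TrivialBundle E M 𝔨) m := mem_frameSource m
  have hanchor : ∀ ρ : Cₛ^∞⟮𝓘(ℝ, E); F, A⟯, L.anchorRep m y (sectionRep m ρ y) =
      chartDeriv E m m (pairFst (Θ.bundleIso.mapSection ρ) m) := fun ρ => by
    rw [sectionRep_apply hm, anchorRep_coordAt _ hm]
    exact congrArg (chartDeriv E m m) (Θ.fiberEquiv_fst m (ρ m)).symm
  have hval : ∀ r : Cₛ^∞⟮𝓘(ℝ, E); E × 𝔨, TrivialBundle E M 𝔨⟯, sectionRep m r y =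
      (chartDeriv E m m (pairFst r m), pairSnd r m) := fun r => by
    rw [sectionRep_apply hm', coordAt_trivialBundle (mem_chart_source E m)]
    rfl
  have hrep : ∀ ρ : Cₛ^∞⟮𝓘(ℝ, E); F, A⟯, sectionRep m ρ y =
      Θ.rep m y (sectionRep m (Θ.bundleIso.mapSection ρ) y) := fun ρ =>
    (Θ.sectionRep_eventuallyEq ρ m).self_of_nhds
  have h1 := L.sectionRep_bracket (map_mem_frameDomain hm) σ τ
  have h2 := Θ.structure_eq m (chartDeriv E m m (pairFst s m), pairSnd s m)
    (chartDeriv E m m (pairFst t m), pairSnd t m)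
  rw [hanchor, hanchor, Θ.fderiv_sectionRep τ, Θ.fderiv_sectionRep σ,
    hrep, hrep, hrep, hval s, hval t] at h1
  have h3 : Θ.rep m y (sectionRep m (Θ.bundleIso.mapSection (L.bracket σ τ)) y) =
      Θ.rep m y (fderiv ℝ (sectionRep m t) y (chartDeriv E m m (pairFst s m)) -
        fderiv ℝ (sectionRep m s) y (chartDeriv E m m (pairFst t m)) +
        (0, ⁅pairSnd s m, pairSnd t m⁆)) := by
    rw [map_add, map_sub, ← h2]
    refine h1.trans ?_
    dsimp only
    abel
  have h4 := congrArg Prod.snd ((Θ.isInvertible_rep m).self_of_nhds.injective h3)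
  rw [hval] at h4
  refine h4.trans ?_
  rw [Prod.snd_add, Prod.snd_sub, fderiv_sectionRep_snd, fderiv_sectionRep_snd]
  change _ = ⁅pairSnd s m, pairSnd t m⁆ + mvfderiv 𝓘(ℝ, E) (pairSnd t) m (pairFst s m) -
    mvfderiv 𝓘(ℝ, E) (pairSnd s) m (pairFst t m)
  abel

/-- The Lie algebroid isomorphism `A ≃ TM × 𝔨`. -/
def iso : L.Iso (trivial E M 𝔨) where
  toSmoothBundleIso := Θ.bundleIso
  anchor_comp := Θ.fiberEquiv_fst
  map_bracket σ τ := ContMDiffSection.ext fun x =>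
    Prod.ext (Θ.fiberEquiv_bracket_fst σ τ x) (Θ.fiberEquiv_bracket_snd σ τ x)

end TrivialFrame

end LieAlgebroid

/-! ### The frame obtained at time `1` -/

namespace LieAlgebroid

variable {E : Type*} [NormedAddCommGroup E] [NormedSpace ℝ E] [FiniteDimensional ℝ E]
  {M : Type*} [TopologicalSpace M] [T2Space M] [ChartedSpace E M] [IsManifold 𝓘(ℝ, E) ∞ M]
  {F : Type*} [NormedAddCommGroup F] [NormedSpace ℝ F] [FiniteDimensional ℝ F]
  {A : M → Type*} [TopologicalSpace (TotalSpace F A)]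
  [∀ x, AddCommGroup (A x)] [∀ x, Module ℝ (A x)] [∀ x, TopologicalSpace (A x)]
  [FiberBundle F A] [VectorBundle ℝ F A] [ContMDiffVectorBundle ∞ F A 𝓘(ℝ, E)]
  {𝔨 : Type*} [NormedLieAlgebra 𝔨] [FiniteDimensional ℝ 𝔨]
  {L : LieAlgebroid E F A} {m₀ : M}

/-- Rank and nullity of the surjective anchor at `m₀` give the count. It later upgrades injectivity
on each fibre to bijectivity. -/
theorem IsotropyModel.finrank_eq (j : IsotropyModel L m₀ 𝔨) (hL : L.IsTransitive) :
    Module.finrank ℝ (E × 𝔨) = Module.finrank ℝ F := by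
  have e := (VectorBundle.continuousLinearEquivAt ℝ F A m₀).toLinearEquiv
  have : FiniteDimensional ℝ (A m₀) := e.symm.finiteDimensional
  have hrange : LinearMap.range j.toFun = LinearMap.ker (L.anchor m₀).toLinearMap := by
    ext a
    constructor
    · rintro ⟨ξ, rfl⟩
      exact j.anchor_apply ξ
    · exact fun ha => j.exists_eq a ha
  have h1 : Module.finrank ℝ (LinearMap.ker (L.anchor m₀).toLinearMap) = Module.finrank ℝ 𝔨 := by
    rw [← hrange]
    exact LinearMap.finrank_range_of_inj j.injective
  let ρ : A m₀ →ₗ[ℝ] E := (L.anchor m₀).toLinearMap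
  have h2 : Module.finrank ℝ (LinearMap.range ρ) = Module.finrank ℝ E := by
    rw [show LinearMap.range ρ = ⊤ from LinearMap.range_eq_top.2 (hL m₀), finrank_top]
  have h3 := LinearMap.finrank_range_add_finrank_ker ρ
  rw [Module.finrank_prod, ← e.finrank_eq, ← h3, h2]
  exact congrArg _ h1.symm

namespace LiftedContraction

variable (H : L.LiftedContraction m₀) {j : IsotropyModel L m₀ 𝔨} {m : M}

/-- The identification of `A (H.map (1, x))` with `A x`. -/
def atOne (x : M) : A (H.map (1, x)) →L[ℝ] A x :=
  frameAt F A x x ∘L coordAt F A x (H.map (1, x))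

/-- The point `H.map (1, x)` equals `x` only propositionally, so its fibre is a different type.
Passing through coordinates avoids casts, and in every frame the identification is invisible. -/
theorem coordAt_atOne (x₀ x : M) (a : A (H.map (1, x))) :
    coordAt F A x₀ x (H.atOne x a) = coordAt F A x₀ (H.map (1, x)) a := by
  have h : ∀ z, z = x → ∀ a : A z,
      coordAt F A x₀ x (frameAt F A x x (coordAt F A x z a)) = coordAt F A x₀ z a := by
    rintro _ rfl a
    rw [frameAt_coordAt (mem_frameSource (E := E) _).2]
  exact h _ (H.map_one x) a

theorem atOne_injective (x : M) : Function.Injective (H.atOne x) := fun a b h => by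
  refine eq_of_coordAt_eq (F := F) (x₀ := x) ?_ ?_
  · rw [H.map_one]
    exact (mem_frameSource (E := E) x).2
  · rw [← coordAt_atOne, h, coordAt_atOne]

variable {H}

theorem base_one (y : E) (hy : y ∈ (extChartAt 𝓘(ℝ, E) m).target) : H.base m m (1, y) = y := by
  rw [base, chartParam, H.map_one, (extChartAt 𝓘(ℝ, E) m).right_inv hy]

namespace TransportFamily

variable (Φ : H.TransportFamily j m)

/-- The points near `m` at which the family is defined. -/
def domain : Set M :=
  (chartAt E m).source ∩ {x | extChartAt 𝓘(ℝ, E) m x ∈ Metric.ball (extChartAt 𝓘(ℝ, E) m m) Φ.radius}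

theorem domain_mem_nhds : Φ.domain ∈ 𝓝 m :=
  inter_mem ((chartAt E m).open_source.mem_nhds (mem_chart_source E m))
    ((continuousAt_extChartAt m).preimage_mem_nhds (Metric.ball_mem_nhds _ Φ.radius_pos))

theorem mem_domain : m ∈ Φ.domain := mem_of_mem_nhds Φ.domain_mem_nhds

variable {Φ} {x : M}

theorem isTransportedAt (hx : x ∈ Φ.domain) {t : ℝ} (ht : t ∈ Ioo (-Φ.radius) (1 + Φ.radius))
    (d : E × 𝔨) :
    H.IsTransportedAt m d.1 (fun q => Φ.sec q d) (t, extChartAt 𝓘(ℝ, E) m x) :=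
  Φ.transported d _ ⟨ht, hx.2⟩

theorem isParallelAt (hx : x ∈ Φ.domain) {t : ℝ} (ht : t ∈ Ioo (-Φ.radius) (1 + Φ.radius))
    (d : TrivialBundle E M 𝔨 x) :
    H.IsParallelAt x d.1 (fun t => Φ.sec (t, x) (chartDeriv E m x d.1, d.2)) t :=
  IsTransportedAt.isParallelAt hx.1 rfl (isTransportedAt hx ht (chartDeriv E m x d.1, d.2))

theorem coordAt_sec_zero (hx : x ∈ Φ.domain) (d : E × 𝔨) :
    coordAt F A m₀ (H.map (0, x)) (Φ.sec (0, x) d) = coordAt F A m₀ m₀ (j.toFun d.2) :=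
  (rep_extChartAt hx.1 0).symm.trans (Φ.initial d _ hx.2)

theorem map_zero_mem (x : M) : H.map (0, x) ∈ (trivializationAt F A m₀).baseSet := by
  rw [H.map_zero]
  exact (mem_frameSource (E := E) m₀).2

variable (Φ) in
/-- The value of the family at time `1`. -/
def value (x : M) : TrivialBundle E M 𝔨 x →ₗ[ℝ] A x :=
  (H.atOne x).toLinearMap ∘ₗ Φ.sec (1, x) ∘ₗ
    ((chartDeriv E m x).toLinearMap.prodMap (LinearMap.id : 𝔨 →ₗ[ℝ] 𝔨))

theorem value_apply (d : TrivialBundle E M 𝔨 x) :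
    Φ.value x d = H.atOne x (Φ.sec (1, x) (chartDeriv E m x d.1, d.2)) := rfl

theorem one_mem_Ioo (Φ : H.TransportFamily j m) : (1 : ℝ) ∈ Ioo (-Φ.radius) (1 + Φ.radius) :=
  ⟨by linarith [Φ.radius_pos], by linarith [Φ.radius_pos]⟩

/-- Along the path of `x`, both families solve the same chart-free equation with the same initial
value. Hence the local frames agree on overlaps and define one global frame. -/
theorem value_eq {m' : M} {Φ' : H.TransportFamily j m'} (hx : x ∈ Φ.domain) (hx' : x ∈ Φ'.domain) :
    Φ.value x = Φ'.value x := by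
  refine LinearMap.ext fun d => congrArg (H.atOne x) ?_
  set r := min Φ.radius Φ'.radius
  have hr : 0 < r := lt_min Φ.radius_pos Φ'.radius_pos
  have h1 : r ≤ Φ.radius := min_le_left _ _
  have h2 : r ≤ Φ'.radius := min_le_right _ _
  refine eq_of_isParallelAt (J := Ioo (-r) (1 + r)) isOpen_Ioo isPreconnected_Ioo
    (fun t ht => isParallelAt hx ⟨by linarith [ht.1], by linarith [ht.2]⟩ d)
    (fun t ht => isParallelAt hx' ⟨by linarith [ht.1], by linarith [ht.2]⟩ d)
    (t₀ := 0) ⟨by linarith, by linarith⟩ ?_ 1 ⟨by linarith, by linarith⟩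
  refine eq_of_coordAt_eq (map_zero_mem x) ?_
  rw [coordAt_sec_zero hx, coordAt_sec_zero hx']

theorem rep_sec_one (hx : x ∈ (chartAt E m).source) (d : TrivialBundle E M 𝔨 x) :
    H.rep m m (fun q => Φ.sec q (chartDeriv E m x d.1, d.2)) (1, extChartAt 𝓘(ℝ, E) m x) =
      coordAt F A m x (Φ.value x d) := by
  rw [value_apply, coordAt_atOne, rep_extChartAt hx]

/-- At time `1` the contraction is the identity, so lifting `(0, X)` says that the anchor is `X`. -/
theorem anchor_value (hx : x ∈ Φ.domain) (hx' : x ∈ frameSource E F A m)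
    (d : TrivialBundle E M 𝔨 x) : L.anchor x (Φ.value x d) = d.1 := by
  have hp : (1, extChartAt 𝓘(ℝ, E) m x) ∈ H.repDomain m m :=
    mem_repDomain hx.1 (by rwa [H.map_one])
  have h := (liftsAt_iff hp).1 (isTransportedAt hx Φ.one_mem_Ioo (chartDeriv E m x d.1, d.2)).lifts
  rw [rep_sec_one hx.1, base_one _ hp.1, anchorRep_coordAt _ hx',
    ← fderiv_space ((contDiffAt_base hp).differentiableAt (by simp))] at h
  have h1 : (fun z => H.base m m (1, z)) =ᶠ[𝓝 (extChartAt 𝓘(ℝ, E) m x)] id := by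
    filter_upwards [(isOpen_extChartAt_target m).mem_nhds hp.1] with z hz using base_one z hz
  rw [h1.fderiv_eq, fderiv_id] at h
  exact chartDeriv_injective hx.1 h

/-- A vanishing value forces the tangent component to vanish through the anchor. Uniqueness
backwards in time then makes the initial isotropy vector zero. -/
theorem value_injective (hx : x ∈ Φ.domain) (hx' : x ∈ frameSource E F A m) :
    Function.Injective (Φ.value x) := by
  rw [injective_iff_map_eq_zero]
  intro d hd
  have h1 : d.1 = 0 := by
    rw [← anchor_value hx hx' d, hd, _root_.map_zero]
  obtain ⟨v, ξ⟩ := d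
  obtain rfl : v = 0 := h1
  have h2 : Φ.value x (0, ξ) = Φ.value x 0 := hd.trans (_root_.map_zero _).symm
  have h3 := eq_of_isParallelAt (J := Ioo (-Φ.radius) (1 + Φ.radius)) isOpen_Ioo isPreconnected_Ioo
    (fun t ht => isParallelAt hx ht ((0, ξ) : TrivialBundle E M 𝔨 x))
    (fun t ht => isParallelAt hx ht (0 : TrivialBundle E M 𝔨 x)) Φ.one_mem_Ioo
    (H.atOne_injective x h2) 0 ⟨by linarith [Φ.radius_pos], by linarith [Φ.radius_pos]⟩
  have h4 := congrArg (coordAt F A m₀ _) h3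
  rw [coordAt_sec_zero hx, coordAt_sec_zero hx] at h4
  have h5 : ξ = 0 := j.injective (eq_of_coordAt_eq (mem_frameSource (E := E) m₀).2 h4)
  rw [h5]
  rfl

variable (Φ) in
/-- The family at time `1` in the chart and the frame at `m`. -/
def repOne (y : E) : E × 𝔨 →L[ℝ] F :=
  LinearMap.toContinuousLinearMap ((coordAt F A m (H.map (chartParam E m (1, y)))).toLinearMap ∘ₗ
    Φ.sec (chartParam E m (1, y)))

theorem repOne_apply (y : E) (d : E × 𝔨) :
    Φ.repOne y d = H.rep m m (fun q => Φ.sec q d) (1, y) := rfl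

theorem one_mem_repDomain (m : M) :
    ((1 : ℝ), extChartAt 𝓘(ℝ, E) m m) ∈ H.repDomain m m :=
  mem_repDomain (mem_chart_source E m) (by rw [H.map_one]; exact mem_frameSource m)

theorem contDiffAt_rep_sec (d : E × 𝔨) :
    ContDiffAt ℝ ∞ (H.rep m m fun q => Φ.sec q d) (1, extChartAt 𝓘(ℝ, E) m m) :=
  contDiffAt_rep (one_mem_repDomain m) (isTransportedAt Φ.mem_domain Φ.one_mem_Ioo d).smooth

theorem contDiffAt_repOne : ContDiffAt ℝ ∞ Φ.repOne (extChartAt 𝓘(ℝ, E) m m) :=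
  contDiffAt_clm_of_apply fun d =>
    ContDiffAt.comp (g := H.rep m m fun q => Φ.sec q d) _ (contDiffAt_rep_sec d)
      (contDiffAt_const.prodMk contDiffAt_id)

theorem fderiv_repOne (X : E) (d : E × 𝔨) :
    fderiv ℝ Φ.repOne (extChartAt 𝓘(ℝ, E) m m) X d =
      fderiv ℝ (H.rep m m fun q => Φ.sec q d) (1, extChartAt 𝓘(ℝ, E) m m) (0, X) := by
  have h : DifferentiableAt ℝ Φ.repOne (extChartAt 𝓘(ℝ, E) m m) :=
    contDiffAt_repOne.differentiableAt (by simp)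
  rw [← fderiv_clm_apply_const h,
    ← fderiv_space ((contDiffAt_rep_sec d).differentiableAt (by simp))]
  rfl

end TransportFamily

/-- Transport along the contraction trivializes a transitive Lie algebroid. -/
def trivialFrame (H : L.LiftedContraction m₀) (j : IsotropyModel L m₀ 𝔨) (hL : L.IsTransitive) :
    L.TrivialFrame 𝔨 :=
  let Φ : ∀ m, H.TransportFamily j m := fun m => (H.nonempty_transportFamily j m).some
  { toFun := fun x => (Φ x).value x
    bijective := fun x => by
      have hi := TransportFamily.value_injective (Φ x).mem_domain (mem_frameSource x)
      let e := (VectorBundle.continuousLinearEquivAt ℝ F A x).toLinearEquiv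
      let f : E × 𝔨 →ₗ[ℝ] F := e.toLinearMap ∘ₗ (Φ x).value x
      have hf : Function.Injective f := e.injective.comp hi
      refine ⟨hi, fun a => ?_⟩
      -- The two model fibres have equal dimension, so injectivity implies surjectivity.
      obtain ⟨d, hd⟩ := (LinearMap.injective_iff_surjective_of_finrank_eq_finrank
        (j.finrank_eq hL)).1 hf (e a)
      exact ⟨d, e.injective hd⟩
    anchor_apply := fun x => TransportFamily.anchor_value (Φ x).mem_domain (mem_frameSource x)
    rep := fun m => (Φ m).repOne
    contDiffAt_rep := fun m => TransportFamily.contDiffAt_repOne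
    coordAt_apply := fun m => by
      filter_upwards [(Φ m).domain_mem_nhds] with x hx d
      -- At each `x` the frame is defined by the family chosen at `x`; near `m` it may be replaced
      -- by the one smooth family chosen at `m`.
      rw [TransportFamily.value_eq (Φ x).mem_domain hx, TransportFamily.repOne_apply,
        TransportFamily.rep_sec_one hx.1]
    structure_eq := fun m d d' => by
      -- At time `1` the base map is the identity of the chart, so the bracket along the contraction
      -- is the ordinary bracket in the frame.
      have h := (Φ m).bracketIn_sec (Φ m).one_mem_Ioo (Metric.mem_ball_self (Φ m).radius_pos)
        (TransportFamily.one_mem_repDomain m) d d'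
      rw [bracketIn, bracketAlong, base_one _ (mem_extChartAt_target m)] at h
      rw [TransportFamily.fderiv_repOne, TransportFamily.fderiv_repOne]
      exact h }

end LiftedContraction

end LieAlgebroid

/-! ### Restriction to open sets, contractible neighbourhoods, and the isotropy bundle -/

namespace LieAlgebroid

variable {E : Type*} [NormedAddCommGroup E] [NormedSpace ℝ E] [FiniteDimensional ℝ E]
  {M : Type*} [TopologicalSpace M] [T2Space M] [ChartedSpace E M] [IsManifold 𝓘(ℝ, E) ∞ M]
  {F : Type*} [NormedAddCommGroup F] [NormedSpace ℝ F] [FiniteDimensional ℝ F]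
  {A : M → Type*} [TopologicalSpace (TotalSpace F A)]
  [∀ x, AddCommGroup (A x)] [∀ x, Module ℝ (A x)] [∀ x, TopologicalSpace (A x)]
  [FiberBundle F A] [VectorBundle ℝ F A] [ContMDiffVectorBundle ∞ F A 𝓘(ℝ, E)]
  {𝔨 : Type*} [NormedLieAlgebra 𝔨] [FiniteDimensional ℝ 𝔨]
  (L : LieAlgebroid E F A) {U : Opens M}

theorem restrictAnchor_eq_iff {x : U} {a : A x} {v : TangentSpace 𝓘(ℝ, E) x} :
    (L.restrict U).anchor x a = v ↔
      L.anchor x a = mfderiv 𝓘(ℝ, E) 𝓘(ℝ, E) (openIncl E U) x v :=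
  (isInvertible_mfderiv_openIncl x).inverse_apply_eq

theorem restrictAnchor_eq_zero_iff {x : U} {a : A x} :
    (L.restrict U).anchor x a = 0 ↔ L.anchor x a = 0 := by
  rw [restrictAnchor_eq_iff, map_zero]
  rfl

variable {L} in
theorem IsTransitive.restrict (hL : L.IsTransitive) (U : Opens M) : (L.restrict U).IsTransitive :=
  fun x v => by
    obtain ⟨a, ha⟩ := hL x (mfderiv 𝓘(ℝ, E) 𝓘(ℝ, E) (openIncl E U) x v)
    exact ⟨a, (L.restrictAnchor_eq_iff).2 ha⟩

variable {L} in
theorem Isotropy.incl_bracket_restrict {x : U} {ξ η : L.Isotropy (x : M)}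
    {s t : Cₛ^∞⟮𝓘(ℝ, E); F, RestrictBundle E A U⟯} (hs : s x = Isotropy.incl L (x : M) ξ)
    (ht : t x = Isotropy.incl L (x : M) η) :
    (L.restrict U).bracket s t x = Isotropy.incl L (x : M) ⁅ξ, η⁆ :=
  (Isotropy.incl_bracket ((germExt_eventuallyEq s x).self_of_nhds.trans hs)
    ((germExt_eventuallyEq t x).self_of_nhds.trans ht)).symm

/-- The isotropy Lie algebra of the restriction to an open subset. -/
def isotropyModelRestrict (m₀ : U) : IsotropyModel (L.restrict U) m₀ (L.Isotropy (m₀ : M)) where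
  toFun := Isotropy.incl L (m₀ : M)
  injective := Isotropy.incl_injective
  anchor_apply ξ := L.restrictAnchor_eq_zero_iff.2 ξ.anchor_incl
  exists_eq a ha := ⟨⟨a, L.restrictAnchor_eq_zero_iff.1 ha⟩, rfl⟩
  bracketRep_apply ξ η := by
    have hm := mem_frameSource (E := E) (F := F) (A := RestrictBundle E A U) m₀
    have h : ∀ a : RestrictBundle E A U m₀, (constSection E m₀ m₀
        (coordAt F (RestrictBundle E A U) m₀ m₀ a) : Cₛ^∞⟮𝓘(ℝ, E); F, RestrictBundle E A U⟯) m₀ =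
          a := fun a => by
      rw [(constSection_eventuallyEq hm _).self_of_nhds, frameAt_coordAt hm.2]
    rw [bracketRep_apply _ hm]
    exact congrArg _ (Isotropy.incl_bracket_restrict (h _) (h _))

/-- A transitive Lie algebroid over a contractible open subset is trivial. -/
theorem nonempty_iso_trivial [SecondCountableTopology M] (hL : L.IsTransitive) {m₀ : U}
    {φ : ℝ × U → U} (hφ : IsSmoothDeformationRetraction (E := E) U m₀ φ) :
    Nonempty ((L.restrict U).Iso (trivial E U (L.Isotropy (m₀ : M)))) := by
  obtain ⟨H⟩ := (L.restrict U).exists_liftedContraction (hL.restrict U) hφ.contMDiffOn hφ.map_zero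
    hφ.map_one
  exact ⟨(H.trivialFrame (L.isotropyModelRestrict m₀) (hL.restrict U)).iso⟩

/-- Every point of a manifold has a smoothly contractible open neighbourhood. -/
theorem exists_isSmoothDeformationRetraction (m : M) :
    ∃ (U : Opens M) (hm : m ∈ U) (φ : ℝ × U → U),
      IsSmoothDeformationRetraction (E := E) U ⟨m, hm⟩ φ := by
  set ψ := extChartAt 𝓘(ℝ, E) m
  obtain ⟨r, hr, hball⟩ := Metric.isOpen_iff.1 (isOpen_extChartAt_target (I := 𝓘(ℝ, E)) m) _
    (mem_extChartAt_target (I := 𝓘(ℝ, E)) m)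
  let U : Opens M := ⟨ψ.source ∩ ψ ⁻¹' Metric.ball (ψ m) r,
    isOpen_extChartAt_preimage' m Metric.isOpen_ball⟩
  have hm : m ∈ U := ⟨mem_extChartAt_source m, Metric.mem_ball_self hr⟩
  -- The contraction runs along straight lines in the chart. Convexity keeps it in the ball for
  -- times in `[0, 1]`; `openRetr` supplies harmless values at other times.
  let c : ℝ × U → E := fun q => ψ m + q.1 • (ψ q.2 - ψ m)
  have hc : ∀ q : ℝ × U, q.1 ∈ Icc (0 : ℝ) 1 → c q ∈ Metric.ball (ψ m) r := fun q hq =>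
    (convex_ball (ψ m) r).add_smul_sub_mem (Metric.mem_ball_self hr) q.2.2.2 hq
  have hU : ∀ y ∈ Metric.ball (ψ m) r, ψ.symm y ∈ U := fun y hy =>
    ⟨ψ.map_target (hball hy), by rwa [mem_preimage, ψ.right_inv (hball hy)]⟩
  refine ⟨U, hm, fun q => openRetr ⟨m, hm⟩ (ψ.symm (c q)), ?_, fun x => ?_, fun x => ?_⟩
  · rintro q ⟨hq, -⟩
    have h1 : ContMDiffAt 𝓘(ℝ, E) 𝓘(ℝ, E) ∞ (fun x : U => ψ (x : M)) q.2 :=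
      (contMDiffAt_extChartAt' (by simpa [ψ] using q.2.2.1)).comp q.2
        contMDiff_subtype_val.contMDiffAt
    have h2 : ContMDiffAt (𝓘(ℝ, ℝ).prod 𝓘(ℝ, E)) 𝓘(ℝ, E) ∞ c q :=
      contMDiffAt_const.add (contMDiffAt_fst.smul
        ((h1.comp q contMDiffAt_snd).sub contMDiffAt_const))
    have h3 := (contMDiffAt_extChartAt_symm (hball (hc q hq))).comp q h2
    exact ((contMDiffAt_openRetr (E := E) (⟨m, hm⟩ : U) ⟨_, hU _ (hc q hq)⟩).comp q
      h3).contMDiffWithinAt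
  · have h : ψ.symm (c (0, x)) = m := by
      simpa [c] using ψ.left_inv (mem_extChartAt_source m)
    rw [h]
    exact openRetr_coe _ ⟨m, hm⟩
  · have h : ψ.symm (c (1, x)) = x := by
      simpa [c] using ψ.left_inv x.2.1
    rw [h]
    exact openRetr_coe _ x

theorem contMDiff_trivialBundle_inr :
    ContMDiff (𝓘(ℝ, E).prod 𝓘(ℝ, 𝔨)) (𝓘(ℝ, E).prod 𝓘(ℝ, E × 𝔨)) ∞
      (fun p : M × 𝔨 => (⟨p.1, (0, p.2)⟩ : TotalSpace (E × 𝔨) (TrivialBundle E M 𝔨))) := fun p => by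
  refine (contMDiffAt_iff_coordAt (F := E × 𝔨) (A := TrivialBundle E M 𝔨) (f := fun q : M × 𝔨 => q.1)
    (s := fun q => ((0, q.2) : TrivialBundle E M 𝔨 q.1)) (x₀ := p.1)
    (p := p) (mem_baseSet_trivialBundle (mem_chart_source E p.1))).2 ⟨contMDiffAt_fst, ?_⟩
  have h : ContMDiffAt (𝓘(ℝ, E).prod 𝓘(ℝ, 𝔨)) 𝓘(ℝ, E × 𝔨) ∞
      (fun q : M × 𝔨 => ContinuousLinearMap.inr ℝ E 𝔨 q.2) p :=
    (ContinuousLinearMap.inr ℝ E 𝔨).contMDiff.contMDiffAt.comp p contMDiffAt_snd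
  refine h.congr_of_eventuallyEq ?_
  filter_upwards [continuous_fst.continuousAt.preimage_mem_nhds
    ((chartAt E p.1).open_source.mem_nhds (mem_chart_source E p.1))] with q hq
  rw [coordAt_trivialBundle hq, map_zero]
  rfl

theorem contMDiff_trivialBundle_snd :
    ContMDiff (𝓘(ℝ, E).prod 𝓘(ℝ, E × 𝔨)) 𝓘(ℝ, 𝔨) ∞
      (fun p : TotalSpace (E × 𝔨) (TrivialBundle E M 𝔨) => (p.2.2 : 𝔨)) := fun p => by
  have h := (contMDiffAt_iff_coordAt (J := 𝓘(ℝ, E).prod 𝓘(ℝ, E × 𝔨))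
    (f := fun q : TotalSpace (E × 𝔨) (TrivialBundle E M 𝔨) => q.proj) (s := fun q => q.2)
    (p := p) (mem_baseSet_trivialBundle (mem_chart_source E p.proj))).1 contMDiffAt_id
  refine ((ContinuousLinearMap.snd ℝ E 𝔨).contMDiff.contMDiffAt.comp p
    h.2).congr_of_eventuallyEq ?_
  filter_upwards [h.1.continuousAt.preimage_mem_nhds
    ((chartAt E p.proj).open_source.mem_nhds (mem_chart_source E p.proj))] with q hq
  rw [Function.comp_apply, coordAt_trivialBundle hq]
  rfl

namespace Iso

variable {L} (Ψ : (L.restrict U).Iso (trivial E U 𝔨))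

theorem fiberEquiv_fst (x : U) (a : A x) : (Ψ.fiberEquiv x a).1 = (L.restrict U).anchor x a :=
  Ψ.anchor_comp x a

theorem anchor_symm_inr (x : U) (ξ : 𝔨) :
    L.anchor (x : M) ((Ψ.fiberEquiv x).symm (0, ξ)) = 0 :=
  L.restrictAnchor_eq_zero_iff.1 ((Ψ.fiberEquiv_fst x _).symm.trans
    (congrArg Prod.fst ((Ψ.fiberEquiv x).apply_symm_apply (0, ξ))))

/-- The isotropy vector with `𝔨`-component `ξ`. -/
def isotropyMk (x : U) (ξ : 𝔨) : L.Isotropy (x : M) :=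
  ⟨(Ψ.fiberEquiv x).symm (0, ξ), Ψ.anchor_symm_inr x ξ⟩

theorem fiberEquiv_incl (x : U) (ζ : L.Isotropy (x : M)) :
    Ψ.fiberEquiv x (Isotropy.incl L (x : M) ζ) =
      (0, (Ψ.fiberEquiv x (Isotropy.incl L (x : M) ζ)).2) := by
  refine Prod.ext ?_ rfl
  exact (Ψ.fiberEquiv_fst x _).trans (L.restrictAnchor_eq_zero_iff.2 ζ.anchor_incl)

/-- The section with constant `𝔨`-component `ξ` and zero anchor. -/
def constInr (ξ : 𝔨) : Cₛ^∞⟮𝓘(ℝ, E); F, RestrictBundle E A U⟯ :=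
  ⟨fun x => (Ψ.fiberEquiv x).symm (0, ξ), Ψ.contMDiff_invFun.comp
    (contMDiff_trivialBundle_inr.comp (contMDiff_id.prodMk (contMDiff_const (c := ξ))))⟩

/-- The isotropy vectors extend to sections with constant `𝔨`-component and zero vector field. In
the bracket of the trivial algebroid both derivative terms then vanish, and the bracket of `𝔨`
remains. -/
theorem isotropyMk_lie (x : U) (ξ η : 𝔨) :
    Ψ.isotropyMk x ⁅ξ, η⁆ = ⁅Ψ.isotropyMk x ξ, Ψ.isotropyMk x η⁆ := by
  suffices h : ⁅ξ, η⁆ =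
      (Ψ.fiberEquiv x (Isotropy.incl L (x : M) ⁅Ψ.isotropyMk x ξ, Ψ.isotropyMk x η⁆)).2 from
    Isotropy.incl_injective ((Ψ.fiberEquiv x).symm_apply_eq.2
      ((congrArg (fun ζ : 𝔨 => ((0, ζ) : TrivialBundle E U 𝔨 x)) h).trans
        (Ψ.fiberEquiv_incl x _).symm))
  have hs : ∀ ξ, Ψ.mapSection (Ψ.constInr ξ) x = ((0, ξ) : TrivialBundle E U 𝔨 x) := fun ξ =>
    (Ψ.fiberEquiv x).apply_symm_apply _
  have h1 : Ψ.fiberEquiv x ((L.restrict U).bracket (Ψ.constInr ξ) (Ψ.constInr η) x) =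
      trivialBracket (Ψ.mapSection (Ψ.constInr ξ)) (Ψ.mapSection (Ψ.constInr η)) x :=
    congrArg (fun s => s x) (Ψ.map_bracket (Ψ.constInr ξ) (Ψ.constInr η))
  rw [Isotropy.incl_bracket_restrict (ξ := Ψ.isotropyMk x ξ) (η := Ψ.isotropyMk x η) rfl rfl] at h1
  refine Eq.trans ?_ (congrArg Prod.snd h1).symm
  change _ = ⁅(Ψ.mapSection (Ψ.constInr ξ) x).2, (Ψ.mapSection (Ψ.constInr η) x).2⁆ +
    mvfderiv 𝓘(ℝ, E) (pairSnd (Ψ.mapSection (Ψ.constInr η))) x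
      (Ψ.mapSection (Ψ.constInr ξ) x).1 -
    mvfderiv 𝓘(ℝ, E) (pairSnd (Ψ.mapSection (Ψ.constInr ξ))) x
      (Ψ.mapSection (Ψ.constInr η) x).1
  rw [hs, hs, map_zero, map_zero, add_zero, sub_zero]

/-- The Lie algebra isomorphisms `𝔨 ≃ 𝔥ₓ` induced by an isomorphism `A|_U ≃ TU × 𝔨`. -/
def isotropyEquiv (x : U) : 𝔨 ≃ₗ⁅ℝ⁆ L.Isotropy (x : M) where
  toFun := Ψ.isotropyMk x
  map_add' ξ η := Isotropy.incl_injective <| by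
    have h : ((0, ξ + η) : TrivialBundle E U 𝔨 x) = (0, ξ) + (0, η) :=
      Prod.ext (zero_add 0).symm rfl
    exact (congrArg (Ψ.fiberEquiv x).symm h).trans (map_add (Ψ.fiberEquiv x).symm _ _)
  map_smul' c ξ := Isotropy.incl_injective <| by
    have h : ((0, c • ξ) : TrivialBundle E U 𝔨 x) = c • (0, ξ) := Prod.ext (smul_zero c).symm rfl
    exact (congrArg (Ψ.fiberEquiv x).symm h).trans (map_smul (Ψ.fiberEquiv x).symm _ _)
  map_lie' := Ψ.isotropyMk_lie x _ _
  invFun ζ := (Ψ.fiberEquiv x (Isotropy.incl L (x : M) ζ)).2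
  left_inv ξ := congrArg Prod.snd ((Ψ.fiberEquiv x).apply_symm_apply (0, ξ))
  right_inv ζ := Isotropy.incl_injective 
    ((Ψ.fiberEquiv x).symm_apply_eq.2 (Ψ.fiberEquiv_incl x ζ).symm)

/-- The trivialization of the isotropy bundle induced by an isomorphism `A|_U ≃ TU × 𝔨`. -/
def isotropyTrivialization : L.IsotropyTrivialization U 𝔨 where
  fiberEquiv := Ψ.isotropyEquiv
  contMDiff_toFun := contMDiff_lift.comp (Ψ.contMDiff_invFun.comp contMDiff_trivialBundle_inr)
  -- The `𝔨`-component of the isomorphism is defined and smooth on all of `A|_U`, so it serves as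
  -- the required extension of the inverse.
  contMDiff_invFun := ⟨fun p => (Ψ.fiberEquiv p.proj p.2).2,
    contMDiff_trivialBundle_snd.comp Ψ.contMDiff_toFun, fun _ _ => rfl⟩

end Iso

end LieAlgebroid

end

theorem mainTheorem7
    {E : Type*} [NormedAddCommGroup E] [NormedSpace ℝ E] [FiniteDimensional ℝ E]
    {M : Type*} [TopologicalSpace M] [T2Space M] [SecondCountableTopology M]
    [ChartedSpace E M] [IsManifold 𝓘(ℝ, E) ∞ M]
    {F : Type*} [NormedAddCommGroup F] [NormedSpace ℝ F] [FiniteDimensional ℝ F]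
    {A : M → Type*} [TopologicalSpace (TotalSpace F A)]
    [∀ x, AddCommGroup (A x)] [∀ x, Module ℝ (A x)] [∀ x, TopologicalSpace (A x)]
    [FiberBundle F A] [VectorBundle ℝ F A] [ContMDiffVectorBundle ∞ F A 𝓘(ℝ, E)]
    (L : LieAlgebroid E F A) (hL : L.IsTransitive) :
    L.IsotropyLocallyTrivial ∧
      ∀ (U : Opens M) (m₀ : U) (φ : ℝ × U → U),
        IsSmoothDeformationRetraction (E := E) U m₀ φ →
          Nonempty ((L.restrict U).Iso (LieAlgebroid.trivial E U (L.Isotropy (m₀ : M)))) := by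
  refine ⟨fun m => ?_, fun U m₀ φ hφ => L.nonempty_iso_trivial hL hφ⟩
  -- Local triviality is the second statement applied to a contractible neighbourhood whose base
  -- point is `m` itself, so the model fibre is the isotropy at `m`.
  obtain ⟨U, hm, φ, hφ⟩ := LieAlgebroid.exists_isSmoothDeformationRetraction (E := E) m
  obtain ⟨Ψ⟩ := L.nonempty_iso_trivial hL hφ
  exact ⟨U, hm, ⟨Ψ.isotropyTrivialization⟩⟩
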